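/- Let $\Delta_{\mathrm{aff}}$ be an extended Dynkin diagram of type $\tilde{A}_n$ ($n\ge 1$; for $n=1$ two vertices joined by two edges), $\tilde{D}_n$ ($n\ge 4$), $\tilde{E}_6$, $\tilde{E}_7$ or $\tilde{E}_8$, with extended vertex $0$. Let $\delta_j$ be its label at the vertex $j$, that is, $\delta$ is the vector of positive integers with $\delta_0=1$ such that $2\delta_i$ is the sum of the labels of the neighbours of $i$ (counted with edge multiplicity), for every $i$; equivalently, $\delta_j$ is the dimension of the irreducible representation attached to $j$ by the McKay correspondence. Let $\Pi$ be the preprojective algebra of $\Delta_{\mathrm{aff}}$ over $\mathbb{C}$: choose an orientation $Q$ of $\Delta_{\mathrm{aff}}$, let $\overline{Q}$ be the double quiver with a reversed arrow $c^*$ for every arrow $c$ of $Q$, and put $\Pi=\mathbb{C}\overline{Q}/\bigl(\sum_{c}(cc^*-c^*c)\bigr)$. For a set $I$ of vertices that contains $0$, put $e_I=\sum_{i\in I}e_i$ and $\Gamma_I=e_I\Pi e_I$, graded by path length, and let $J$ be the ideal of $\Gamma_I$ of all elements of positive degree. The quiver of $\Gamma_I$ has the vertex set $I$, and the number of arrows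 from $i$ to $j$ is $r_{i,j}=\dim_{\mathbb{C}} e_i(J/J^2)e_j$; put $r_{i,j}=0$ if $i$ or $j$ is not in $I$. Theorem. Let $I$ be a set of vertices of $\Delta_{\mathrm{aff}}$ with $0\in I$, and let $j$ be a vertex of $\Delta_{\mathrm{aff}}$; exclude the case where $I=\{0\}$ and $j=0$. Then $r_{0,j}\in\{0,1,2\}$. Furthermore, $r_{0,j}=2$ if and only if $I=\{0,j\}$ and $\delta_j=1$. -/

import Mathlib

noncomputable section

/-- A quiver with vertex set `V` and arrow set `E`; an arrow `a` goes from `tail a` to `head a`.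
Several arrows with the same end points are allowed. -/
structure ArrowQuiver (V E : Type) where
  tail : E → V
  head : E → V

namespace ArrowQuiver

/-- The double quiver: `Sum.inl c` is the original arrow `c`, and `Sum.inr c` is the additional
reversed arrow `c*`. -/
def double {V E : Type} (Q : ArrowQuiver V E) : ArrowQuiver V (E ⊕ E) where
  tail := Sum.elim Q.tail Q.head
  head := Sum.elim Q.head Q.tail

/-- The relations between the trivial paths `e i` (the generators `Sum.inl i`) and the arrows
(the generators `Sum.inr a`) that define the path algebra. A product `p * q` is read as
`p` followed by `q`. -/
inductive PathRel {V E : Type} [Fintype V] (Q : ArrowQuiver V E) :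
    FreeAlgebra ℂ (V ⊕ E) → FreeAlgebra ℂ (V ⊕ E) → Prop
  | idem (i : V) : PathRel Q
      (FreeAlgebra.ι ℂ (Sum.inl i) * FreeAlgebra.ι ℂ (Sum.inl i)) (FreeAlgebra.ι ℂ (Sum.inl i))
  | orth (i j : V) (h : i ≠ j) : PathRel Q
      (FreeAlgebra.ι ℂ (Sum.inl i) * FreeAlgebra.ι ℂ (Sum.inl j)) 0
  | complete : PathRel Q (∑ i : V, FreeAlgebra.ι ℂ (Sum.inl i)) 1
  | tail_mul (a : E) : PathRel Q
      (FreeAlgebra.ι ℂ (Sum.inl (Q.tail a)) * FreeAlgebra.ι ℂ (Sum.inr a))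
      (FreeAlgebra.ι ℂ (Sum.inr a))
  | mul_head (a : E) : PathRel Q
      (FreeAlgebra.ι ℂ (Sum.inr a) * FreeAlgebra.ι ℂ (Sum.inl (Q.head a)))
      (FreeAlgebra.ι ℂ (Sum.inr a))

/-- The path algebra `ℂQ` of a quiver with finitely many vertices. -/
def PathAlgebra {V E : Type} [Fintype V] (Q : ArrowQuiver V E) : Type :=
  RingQuot (PathRel Q)

instance {V E : Type} [Fintype V] (Q : ArrowQuiver V E) : Ring (PathAlgebra Q) :=
  inferInstanceAs (Ring (RingQuot (PathRel Q)))

instance {V E : Type} [Fintype V] (Q : ArrowQuiver V E) : Algebra ℂ (PathAlgebra Q) :=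
  inferInstanceAs (Algebra ℂ (RingQuot (PathRel Q)))

/-- The quotient map onto the path algebra. -/
def pathMk {V E : Type} [Fintype V] (Q : ArrowQuiver V E) :
    FreeAlgebra ℂ (V ⊕ E) →ₐ[ℂ] PathAlgebra Q :=
  RingQuot.mkAlgHom ℂ (PathRel Q)

/-- The trivial path at `i`, in the path algebra. -/
def pathIdem {V E : Type} [Fintype V] (Q : ArrowQuiver V E) (i : V) : PathAlgebra Q :=
  pathMk Q (FreeAlgebra.ι ℂ (Sum.inl i))

/-- The arrow `a`, in the path algebra. -/
def pathArrow {V E : Type} [Fintype V] (Q : ArrowQuiver V E) (a : E) : PathAlgebra Q :=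
  pathMk Q (FreeAlgebra.ι ℂ (Sum.inr a))

/-- The preprojective relation `∑ (c c* - c* c) = 0`, the sum being over the arrows `c` of `Q`. -/
inductive PreprojRel {V E : Type} [Fintype V] [Fintype E] (Q : ArrowQuiver V E) :
    PathAlgebra Q.double → PathAlgebra Q.double → Prop
  | rel : PreprojRel Q
      (∑ c : E, (pathArrow Q.double (Sum.inl c) * pathArrow Q.double (Sum.inr c) -
        pathArrow Q.double (Sum.inr c) * pathArrow Q.double (Sum.inl c))) 0

/-- The preprojective algebra `Π` of `Q`. -/
def Preproj {V E : Type} [Fintype V] [Fintype E] (Q : ArrowQuiver V E) : Type :=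
  RingQuot (PreprojRel Q)

instance {V E : Type} [Fintype V] [Fintype E] (Q : ArrowQuiver V E) : Ring (Preproj Q) :=
  inferInstanceAs (Ring (RingQuot (PreprojRel Q)))

instance {V E : Type} [Fintype V] [Fintype E] (Q : ArrowQuiver V E) : Algebra ℂ (Preproj Q) :=
  inferInstanceAs (Algebra ℂ (RingQuot (PreprojRel Q)))

/-- The quotient map onto the preprojective algebra. -/
def preprojMk {V E : Type} [Fintype V] [Fintype E] (Q : ArrowQuiver V E) :
    PathAlgebra Q.double →ₐ[ℂ] Preproj Q :=
  RingQuot.mkAlgHom ℂ (PreprojRel Q)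

/-- The idempotent `e i` of `Π`. -/
def idem {V E : Type} [Fintype V] [Fintype E] (Q : ArrowQuiver V E) (i : V) : Preproj Q :=
  preprojMk Q (pathIdem Q.double i)

/-- The element of `Π` given by an arrow of the double quiver. -/
def arrow {V E : Type} [Fintype V] [Fintype E] (Q : ArrowQuiver V E) (a : E ⊕ E) : Preproj Q :=
  preprojMk Q (pathArrow Q.double a)

/-- The two-sided ideal of `Π` generated by the arrows. It is the span of the paths of positive
length, that is, the positive part of `Π` for the grading by path length. -/
def posPart {V E : Type} [Fintype V] [Fintype E] (Q : ArrowQuiver V E) :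
    Submodule ℂ (Preproj Q) :=
  Submodule.span ℂ {z | ∃ (x y : Preproj Q) (a : E ⊕ E), z = x * arrow Q a * y}

/-- The map `z ↦ x z y`. -/
def sandwich {A : Type} [Ring A] [Algebra ℂ A] (x y : A) : A →ₗ[ℂ] A :=
  LinearMap.mulLeft ℂ x ∘ₗ LinearMap.mulRight ℂ y

/-- The algebra `Γ_I = e_I Π e_I`, where `e_I = ∑ i ∈ I, e i`, as a subspace of `Π`
(it is closed under multiplication and has the unit `e_I`). -/
def Gam {V E : Type} [Fintype V] [Fintype E] (Q : ArrowQuiver V E) (I : Finset V) :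
    Submodule ℂ (Preproj Q) :=
  LinearMap.range (sandwich (∑ i ∈ I, idem Q i) (∑ i ∈ I, idem Q i))

/-- The graded radical `J` of `Γ_I`: the two-sided ideal of the elements of `Γ_I` that are
combinations of paths of positive length. The degree zero part of `Γ_I` is spanned by the
idempotents `e i` with `i ∈ I`. -/
def gamRad {V E : Type} [Fintype V] [Fintype E] (Q : ArrowQuiver V E) (I : Finset V) :
    Submodule ℂ (Preproj Q) :=
  Gam Q I ⊓ posPart Q

/-- The space `e i (J / J²) e j = e i J e j / e i J² e j` spanned by the arrows from `i` to `j`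
in the quiver of `Γ_I`. It vanishes unless `i` and `j` both lie in `I`. -/
abbrev ArrowSpace {V E : Type} [Fintype V] [Fintype E] (Q : ArrowQuiver V E) (I : Finset V)
    (i j : V) : Type :=
  ↥((gamRad Q I).map (sandwich (idem Q i) (idem Q j))) ⧸
    ((gamRad Q I * gamRad Q I).map (sandwich (idem Q i) (idem Q j))).comap
      ((gamRad Q I).map (sandwich (idem Q i) (idem Q j))).subtype

/-- The number `r_{i,j}` of arrows from `i` to `j` in the quiver of `Γ_I`. -/
def numArrows {V E : Type} [Fintype V] [Fintype E] (Q : ArrowQuiver V E) (I : Finset V)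
    (i j : V) : Cardinal :=
  Module.rank ℂ (ArrowSpace Q I i j)

end ArrowQuiver

/-- The extended Dynkin diagrams of type ADE. -/
inductive ExtDynkin : Type
  | A (n : ℕ) (hn : 1 ≤ n) : ExtDynkin
  | D (n : ℕ) (hn : 4 ≤ n) : ExtDynkin
  | E6 : ExtDynkin
  | E7 : ExtDynkin
  | E8 : ExtDynkin

namespace ExtDynkin

/-- The number of vertices of the (non-extended) Dynkin diagram. -/
def rank : ExtDynkin → ℕ
  | A n _ => n
  | D n _ => n
  | E6 => 6
  | E7 => 7
  | E8 => 8

/-- The vertices `0, …, n` of the extended diagram; `0` is the extended vertex. -/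
abbrev Vertex (Δ : ExtDynkin) : Type := Fin (Δ.rank + 1)

/-- The number of edges of the extended diagram. -/
def numEdges : ExtDynkin → ℕ
  | A n _ => n + 1
  | D n _ => n
  | E6 => 6
  | E7 => 7
  | E8 => 8

/-- The extended diagram with a chosen orientation.
* `A n`: the cycle `0 - 1 - ⋯ - n - 0` (a double edge between `0` and `1` if `n = 1`);
* `D n`: the chain `2 - 3 - ⋯ - (n-2)`, with `0` and `1` joined to `2`, and `n-1` and `n` joined
  to `n-2`;
* `E6`: three arms `4 - 1 - 0`, `4 - 3 - 2`, `4 - 5 - 6` at the vertex `4`;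
* `E7`: the chain `0 - 1 - ⋯ - 6`, with `7` joined to `3`;
* `E8`: the chain `0 - 1 - ⋯ - 7`, with `8` joined to `5`. -/
def quiver : (Δ : ExtDynkin) → ArrowQuiver Δ.Vertex (Fin Δ.numEdges)
  | A n _ =>
    { tail := fun k : Fin (n + 1) => (k : Fin (n + 1))
      head := fun k : Fin (n + 1) => (k + 1 : Fin (n + 1)) }
  | D n hn =>
    { tail := fun k : Fin n =>
        (if k.val = n - 1 then ⟨n - 2, by omega⟩ else ⟨k.val, by omega⟩ : Fin (n + 1))
      head := fun k : Fin n =>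
        (if k.val = 0 then ⟨2, by omega⟩ else ⟨k.val + 1, by omega⟩ : Fin (n + 1)) }
  | E6 =>
    { tail := (![0, 1, 2, 3, 4, 5] : Fin 6 → Fin 7)
      head := (![1, 4, 3, 4, 5, 6] : Fin 6 → Fin 7) }
  | E7 =>
    { tail := (![0, 1, 2, 3, 4, 5, 3] : Fin 7 → Fin 8)
      head := (![1, 2, 3, 4, 5, 6, 7] : Fin 7 → Fin 8) }
  | E8 =>
    { tail := (![0, 1, 2, 3, 4, 5, 6, 5] : Fin 8 → Fin 9)
      head := (![1, 2, 3, 4, 5, 6, 7, 8] : Fin 8 → Fin 9) }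

/-- The labels `δ_j` of the extended diagram, the dimensions of the irreducible representations
attached to the vertices: the vector of positive integers with `δ_0 = 1` such that `2 δ_i` is the
sum of the labels of the neighbours of `i` (with multiplicity). -/
def delta : (Δ : ExtDynkin) → Δ.Vertex → ℕ
  | A _ _ => fun _ => 1
  | D n _ => fun i : Fin (n + 1) =>
      if i.val = 0 ∨ i.val = 1 ∨ i.val = n - 1 ∨ i.val = n then 1 else 2
  | E6 => (![1, 2, 1, 2, 3, 2, 1] : Fin 7 → ℕ)
  | E7 => (![1, 2, 3, 4, 3, 2, 1, 2] : Fin 8 → ℕ)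
  | E8 => (![1, 2, 3, 4, 5, 6, 4, 2, 3] : Fin 9 → ℕ)

end ExtDynkin

end

/-! Write `o` for the extended vertex. A product of two elements of `J` is a combination of paths
that meet `I` strictly between their ends. For `o` and `k` in `I`, the space `e_o (J / J²) e_k`
therefore embeds into `Π / Π₊ e_I Π₊` (`arrowSpaceMap_injective`), and in this quotient a path dies
as soon as it meets `I` at an inner vertex. A larger `I` only adds relations, so everything is read
off from the sets `{o, k}` with `k ≠ o`; the data needed for each of them form an `ArrowBasis`.

Upper bounds come from `map_mem_of_closed`: subspaces `S v` that contain the arrows out of `o` and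
are stable under all arrows contain all nontrivial paths from `o`. To find them, note that the
relation at a vertex of valency two lets a turn slide along an arm of the diagram, until it is
killed at `o` or `k` or becomes a loop at a branching vertex. On a cycle only the two straight ways
from `o` to `k` survive. In type `D̃ₙ` with `k ≥ 3`, the loop from the vertex `2` through `1` has
square zero and can be inserted at most once into the straight path; for `k = 1` one goes to `1`
directly, or to the far end and back. In type `Ẽ`, let `s` be the straight path to the branching
vertex and `x`, `y`, `z` the loops there along the three arms, `x` on the arm of `o`. Up to signs `x
= y + z`; moreover `s x = 0`, and the loops are nilpotent, the more so on an arm that meets `k`. The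
words `s`, `s y`, ... that remain are at most four (`loops_one` to `loops_four`), and at most two of
them survive the continuation to `k`. The second one occurs only if `δ_k = 1`.

For `δ_k = 1` the two survivors `p₁`, `p₂` are independent, because explicit matrices satisfy the
preprojective relations, kill all products of arrows through `o` or `k`, and separate the two
(`linearIndependent_of_rep`).

A third vertex `l` of `I` lies on one of the two paths, sometimes only after rewriting by the
relation at a branching vertex, and kills it; so two arrows force `I = {o, k}`. The loops at `o` are
spanned by a single element `q`, which settles `j = o`. `numArrows_of_arrowBasis` turns these facts
into the count. -/

set_option linter.unusedSectionVars false

noncomputable section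

/-! ### Generators, relations and induction for the preprojective algebra -/

namespace ArrowQuiver

variable {V E : Type} [Fintype V] [Fintype E] (Q : ArrowQuiver V E)

theorem pathMk_rel {F : Type} (Q : ArrowQuiver V F) {x y : FreeAlgebra ℂ (V ⊕ F)}
    (h : PathRel Q x y) : pathMk Q x = pathMk Q y :=
  RingQuot.mkAlgHom_rel ℂ h

theorem preprojMk_rel {x y : PathAlgebra Q.double} (h : PreprojRel Q x y) :
    preprojMk Q x = preprojMk Q y :=
  RingQuot.mkAlgHom_rel ℂ h

theorem idem_mul_self (i : V) : idem Q i * idem Q i = idem Q i := by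
  have h : pathIdem Q.double i * pathIdem Q.double i = pathIdem Q.double i := by
    unfold pathIdem
    rw [← map_mul]
    exact pathMk_rel _ (PathRel.idem i)
  unfold idem
  rw [← map_mul, h]

theorem idem_mul_of_ne {i j : V} (hij : i ≠ j) : idem Q i * idem Q j = 0 := by
  have h : pathIdem Q.double i * pathIdem Q.double j = 0 := by
    unfold pathIdem
    rw [← map_mul, pathMk_rel _ (PathRel.orth i j hij), map_zero]
  unfold idem
  rw [← map_mul, h, map_zero]

theorem sum_idem : ∑ i, idem Q i = 1 := by
  have h := pathMk_rel Q.double PathRel.complete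
  rw [map_sum, map_one] at h
  rw [← map_one (preprojMk Q), ← h, map_sum]
  rfl

theorem idem_tail_mul (a : E ⊕ E) : idem Q (Q.double.tail a) * arrow Q a = arrow Q a := by
  have h : pathIdem Q.double (Q.double.tail a) * pathArrow Q.double a = pathArrow Q.double a := by
    unfold pathIdem pathArrow
    rw [← map_mul]
    exact pathMk_rel _ (PathRel.tail_mul a)
  unfold idem arrow
  rw [← map_mul, h]

theorem mul_idem_head (a : E ⊕ E) : arrow Q a * idem Q (Q.double.head a) = arrow Q a := by
  have h : pathArrow Q.double a * pathIdem Q.double (Q.double.head a) = pathArrow Q.double a := by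
    unfold pathIdem pathArrow
    rw [← map_mul]
    exact pathMk_rel _ (PathRel.mul_head a)
  unfold idem arrow
  rw [← map_mul, h]

theorem preproj_relation :
    ∑ c : E, (arrow Q (Sum.inl c) * arrow Q (Sum.inr c) -
      arrow Q (Sum.inr c) * arrow Q (Sum.inl c)) = 0 := by
  have h := preprojMk_rel Q PreprojRel.rel
  rw [map_zero, map_sum] at h
  rw [← h]
  refine Finset.sum_congr rfl fun c _ => ?_
  rw [map_sub, map_mul, map_mul]
  rfl

theorem idem_mul_arrow_of_ne {i : V} {a : E ⊕ E} (h : i ≠ Q.double.tail a) :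
    idem Q i * arrow Q a = 0 := by
  rw [← idem_tail_mul, ← mul_assoc, idem_mul_of_ne Q h, zero_mul]

theorem arrow_mul_idem_of_ne {i : V} {a : E ⊕ E} (h : Q.double.head a ≠ i) :
    arrow Q a * idem Q i = 0 := by
  rw [← mul_idem_head, mul_assoc, idem_mul_of_ne Q h, mul_zero]

/-- The part of the preprojective relation at a single vertex. -/
theorem vertex_relation [DecidableEq V] (v : V) :
    ∑ c : E, (if Q.tail c = v then arrow Q (Sum.inl c) * arrow Q (Sum.inr c) else 0) =
      ∑ c : E, (if Q.head c = v then arrow Q (Sum.inr c) * arrow Q (Sum.inl c) else 0) := by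
  -- Left multiplication by the idempotent at `v` keeps exactly the terms that start at `v`.
  have h := congrArg (fun z => idem Q v * z) (preproj_relation Q)
  simp only [mul_zero, Finset.mul_sum, mul_sub, Finset.sum_sub_distrib] at h
  rw [sub_eq_zero] at h
  convert h using 2 with c _ c _
  · split_ifs with hc
    · rw [← mul_assoc, show v = Q.double.tail (Sum.inl c) from hc.symm, idem_tail_mul]
    · rw [← mul_assoc, idem_mul_arrow_of_ne Q (a := Sum.inl c) (fun h => hc h.symm), zero_mul]
  · split_ifs with hc
    · rw [← mul_assoc, show v = Q.double.tail (Sum.inr c) from hc.symm, idem_tail_mul]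
    · rw [← mul_assoc, idem_mul_arrow_of_ne Q (a := Sum.inr c) (fun h => hc h.symm), zero_mul]

theorem preproj_induction {C : Preproj Q → Prop} (hc : ∀ r : ℂ, C (algebraMap ℂ _ r))
    (hi : ∀ i, C (idem Q i)) (ha : ∀ a, C (arrow Q a))
    (hmul : ∀ x y, C x → C y → C (x * y)) (hadd : ∀ x y, C x → C y → C (x + y))
    (z : Preproj Q) : C z := by
  obtain ⟨y, rfl⟩ := RingQuot.mkAlgHom_surjective ℂ (PreprojRel Q) z
  obtain ⟨x, rfl⟩ := RingQuot.mkAlgHom_surjective ℂ (PathRel Q.double) y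
  change C (preprojMk Q (pathMk Q.double x))
  induction x using FreeAlgebra.induction with
  | grade0 r => rw [AlgHom.commutes, AlgHom.commutes]; exact hc r
  | grade1 x =>
    rcases x with i | a
    · exact hi i
    · exact ha a
  | mul x y hx hy => rw [map_mul, map_mul]; exact hmul _ _ hx hy
  | add x y hx hy => rw [map_add, map_add]; exact hadd _ _ hx hy

/-! ### The positive part and its description by paths -/

section PosPart

theorem arrow_mem_posPart (a : E ⊕ E) : arrow Q a ∈ posPart Q :=
  Submodule.subset_span ⟨1, 1, a, by rw [one_mul, mul_one]⟩

variable {Q}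

theorem mul_mem_posPart_left (x : Preproj Q) {z : Preproj Q} (hz : z ∈ posPart Q) :
    x * z ∈ posPart Q := by
  induction hz using Submodule.span_induction with
  | mem z h =>
    obtain ⟨u, v, a, rfl⟩ := h
    exact Submodule.subset_span ⟨x * u, v, a, by simp only [mul_assoc]⟩
  | zero => rw [mul_zero]; exact zero_mem _
  | add y z _ _ hy hz => rw [mul_add]; exact add_mem hy hz
  | smul c y _ hy => rw [mul_smul_comm]; exact Submodule.smul_mem _ _ hy

theorem mul_mem_posPart_right {z : Preproj Q} (hz : z ∈ posPart Q) (x : Preproj Q) :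
    z * x ∈ posPart Q := by
  induction hz using Submodule.span_induction with
  | mem z h =>
    obtain ⟨u, v, a, rfl⟩ := h
    exact Submodule.subset_span ⟨u, v * x, a, by simp only [mul_assoc]⟩
  | zero => rw [zero_mul]; exact zero_mem _
  | add y z _ _ hy hz => rw [add_mul]; exact add_mem hy hz
  | smul c y _ hy => rw [smul_mul_assoc]; exact Submodule.smul_mem _ _ hy

end PosPart

/-- If subspaces `S v` of an algebra contain the images of the arrows that start at `o` and are
stable under the arrows, they contain the images of all combinations of nontrivial paths that
start at `o`. -/
theorem map_mem_of_closed {R : Type} [Ring R] [Algebra ℂ R] (φ : Preproj Q →ₐ[ℂ] R) (o : V)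
    (S : V → Submodule ℂ R)
    (h0 : ∀ a, Q.double.tail a = o → φ (arrow Q a) ∈ S (Q.double.head a))
    (hS : ∀ a, ∀ s ∈ S (Q.double.tail a), s * φ (arrow Q a) ∈ S (Q.double.head a))
    {z : Preproj Q} (hz : z ∈ posPart Q) (j : V) :
    φ (idem Q o * z * idem Q j) ∈ S j := by
  classical
  -- `G` collects the elements whose component at each vertex `l` lies in `S l`; it will be stable
  -- under right multiplication by all of `Π`.
  let G : Submodule ℂ R := ⨅ l, (S l).comap (LinearMap.mulRight ℂ (φ (idem Q l)))
  have hG : ∀ t, t ∈ G ↔ ∀ l, t * φ (idem Q l) ∈ S l := fun t => by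
    simp only [G, Submodule.mem_iInf, Submodule.mem_comap, LinearMap.mulRight_apply]
  have hGe : ∀ t ∈ G, ∀ i, t * φ (idem Q i) ∈ G := by
    intro t ht i
    rw [hG] at ht ⊢
    intro l
    rw [mul_assoc, ← map_mul]
    by_cases hil : i = l
    · subst hil; rw [idem_mul_self]; exact ht i
    · rw [idem_mul_of_ne Q hil, map_zero, mul_zero]; exact zero_mem _
  have hGa : ∀ t ∈ G, ∀ a, t * φ (arrow Q a) ∈ G := by
    intro t ht a
    rw [hG] at ht ⊢
    intro l
    by_cases hl : Q.double.head a = l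
    · subst hl
      rw [mul_assoc, ← map_mul, mul_idem_head, ← idem_tail_mul, map_mul, ← mul_assoc]
      exact hS a _ (ht _)
    · rw [mul_assoc, ← map_mul, arrow_mul_idem_of_ne Q hl, map_zero, mul_zero]; exact zero_mem _
  have hGo : ∀ a, φ (idem Q o) * φ (arrow Q a) ∈ G := by
    intro a
    rw [hG]
    intro l
    rw [← map_mul, ← map_mul]
    by_cases ho : o = Q.double.tail a
    · by_cases hl : Q.double.head a = l
      · subst hl
        rw [mul_assoc, mul_idem_head, ho, idem_tail_mul]
        exact h0 a ho.symm
      · rw [mul_assoc, arrow_mul_idem_of_ne Q hl, mul_zero, map_zero]; exact zero_mem _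
    · rw [idem_mul_arrow_of_ne Q ho, zero_mul, map_zero]; exact zero_mem _
  have hGx : ∀ x : Preproj Q, ∀ t ∈ G, t * φ x ∈ G := by
    intro x
    induction x using preproj_induction with
    | hc r =>
      intro t ht
      rw [AlgHom.commutes, ← Algebra.commutes, ← Algebra.smul_def]
      exact G.smul_mem r ht
    | hi i => exact fun t ht => hGe t ht i
    | ha a => exact fun t ht => hGa t ht a
    | hmul x y hx hy =>
      intro t ht
      rw [map_mul, ← mul_assoc]
      exact hy _ (hx t ht)
    | hadd x y hx hy =>
      intro t ht
      rw [map_add, mul_add]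
      exact add_mem (hx t ht) (hy t ht)
  -- Here `r` is the coefficient in `x` of the trivial path at `o`; the rest of `e_o x` consists of
  -- nontrivial paths.
  have hGy : ∀ x : Preproj Q, ∃ r : ℂ, φ (idem Q o) * φ x - r • φ (idem Q o) ∈ G := by
    intro x
    induction x using preproj_induction with
    | hc r =>
      refine ⟨r, ?_⟩
      rw [AlgHom.commutes, ← Algebra.commutes, ← Algebra.smul_def, sub_self]
      exact zero_mem _
    | hi i =>
      by_cases hi : o = i
      · subst hi
        refine ⟨1, ?_⟩
        rw [← map_mul, idem_mul_self, one_smul, sub_self]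
        exact zero_mem _
      · refine ⟨0, ?_⟩
        rw [← map_mul, idem_mul_of_ne Q hi, map_zero, zero_smul, sub_self]
        exact zero_mem _
    | ha a =>
      refine ⟨0, ?_⟩
      rw [zero_smul, sub_zero]
      exact hGo a
    | hmul x y hx hy =>
      obtain ⟨r, hr⟩ := hx
      obtain ⟨r', hr'⟩ := hy
      refine ⟨r * r', ?_⟩
      have h1 := add_mem (hGx y _ hr) (G.smul_mem r hr')
      convert h1 using 1
      rw [map_mul, sub_mul, smul_mul_assoc, smul_sub, smul_smul, mul_assoc]
      abel
    | hadd x y hx hy =>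
      obtain ⟨r, hr⟩ := hx
      obtain ⟨r', hr'⟩ := hy
      refine ⟨r + r', ?_⟩
      convert add_mem hr hr' using 1
      rw [map_add, mul_add, add_smul]
      abel
  -- On a generator `x a y`, split `e_o x` into `r e_o` and an element of `G`; the arrow `a` carries
  -- both into `G`, and `y` preserves `G`.
  have key : φ (idem Q o) * φ z ∈ G := by
    induction hz using Submodule.span_induction with
    | mem z h =>
      obtain ⟨x, y, a, rfl⟩ := h
      obtain ⟨r, hr⟩ := hGy x
      rw [map_mul, ← mul_assoc]
      refine hGx y _ ?_
      have h1 := add_mem (hGa _ hr a) (G.smul_mem r (hGo a))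
      convert h1 using 1
      rw [map_mul, sub_mul, smul_mul_assoc, sub_add_cancel, mul_assoc]
    | zero => rw [map_zero, mul_zero]; exact zero_mem _
    | add y z _ _ hy hz => rw [map_add, mul_add]; exact add_mem hy hz
    | smul c y _ hy => rw [map_smul, mul_smul_comm]; exact Submodule.smul_mem _ _ hy
  rw [map_mul, map_mul]
  exact (hG _).1 key j

/-! ### The quotient `Π / Π₊ e_I Π₊` and its relation to the arrow space -/

/-- The ideal `Π₊ e_I Π₊`. -/
def radSq (I : Finset V) : Ideal (Preproj Q) :=
  Ideal.span {z | ∃ i ∈ I, ∃ u ∈ posPart Q, ∃ v ∈ posPart Q, z = u * idem Q i * v}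

/-- `Ideal.span` generates a left ideal only. The right side is free because the generators `u e_i
v` absorb right factors into `v`. -/
instance (I : Finset V) : (radSq Q I).IsTwoSided := by
  constructor
  intro a b ha
  induction ha using Submodule.span_induction with
  | mem z h =>
    obtain ⟨i, hi, u, hu, v, hv, rfl⟩ := h
    exact Ideal.subset_span ⟨i, hi, u, hu, v * b, mul_mem_posPart_right hv b, by rw [mul_assoc]⟩
  | zero => rw [zero_mul]; exact zero_mem _
  | add y z _ _ hy hz => rw [add_mul]; exact add_mem hy hz
  | smul c y _ hy =>
    rw [smul_eq_mul, mul_assoc]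
    exact Ideal.mul_mem_left _ _ hy

/-- The algebra `Π / Π₊ e_I Π₊`. -/
abbrev RadQuot (I : Finset V) : Type := Preproj Q ⧸ radSq Q I

/-- The quotient map onto `Π / Π₊ e_I Π₊`. -/
def radMk (I : Finset V) : Preproj Q →ₐ[ℂ] RadQuot Q I := Ideal.Quotient.mkₐ ℂ (radSq Q I)

variable {Q}

theorem radMk_eq_zero {I : Finset V} {z : Preproj Q} : radMk Q I z = 0 ↔ z ∈ radSq Q I :=
  Ideal.Quotient.eq_zero_iff_mem

theorem radSq_mono {I J : Finset V} (h : I ⊆ J) : radSq Q I ≤ radSq Q J :=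
  Ideal.span_mono fun _ ⟨i, hi, H⟩ => ⟨i, h hi, H⟩

theorem radMk_arrow_mul_arrow {I : Finset V} {a : E ⊕ E} (ha : Q.double.head a ∈ I) (b : E ⊕ E) :
    radMk Q I (arrow Q a) * radMk Q I (arrow Q b) = 0 := by
  rw [← map_mul, radMk_eq_zero, ← mul_idem_head Q a]
  exact Ideal.subset_span ⟨_, ha, _, arrow_mem_posPart Q a, _, arrow_mem_posPart Q b, rfl⟩

/-- The idempotent in the middle can be doubled: `e_o u e_i v e_j` is the product of `e_o u e_i` and
`e_i v e_j`, both in `J`. This is the half of the comparison with `J²` that gives injectivity. -/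
theorem sandwich_mem_of_mem_radSq {I : Finset V} {o j : V} (ho : o ∈ I) (hj : j ∈ I)
    {z : Preproj Q} (hz : z ∈ radSq Q I) :
    idem Q o * z * idem Q j ∈
      (gamRad Q I * gamRad Q I).map (sandwich (idem Q o) (idem Q j)) := by
  classical
  have hsum : ∀ i ∈ I, (∑ l ∈ I, idem Q l) * idem Q i = idem Q i := fun i hi => by
    rw [Finset.sum_mul, Finset.sum_eq_single i (fun l _ hl => idem_mul_of_ne Q hl)
      (fun h => absurd hi h), idem_mul_self]
  have hsum' : ∀ i ∈ I, idem Q i * (∑ l ∈ I, idem Q l) = idem Q i := fun i hi => by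
    rw [Finset.mul_sum, Finset.sum_eq_single i (fun l _ hl => idem_mul_of_ne Q hl.symm)
      (fun h => absurd hi h), idem_mul_self]
  have hmem : ∀ i ∈ I, ∀ l ∈ I, ∀ u ∈ posPart Q, idem Q i * u * idem Q l ∈ gamRad Q I := by
    intro i hi l hl u hu
    refine ⟨⟨idem Q i * u * idem Q l, ?_⟩, mul_mem_posPart_right (mul_mem_posPart_left _ hu) _⟩
    simp only [sandwich, LinearMap.comp_apply, LinearMap.mulLeft_apply, LinearMap.mulRight_apply]
    rw [mul_assoc _ (idem Q l), hsum' l hl, ← mul_assoc, ← mul_assoc, hsum i hi]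
  -- The extra left factor `r` makes the induction over a left ideal go through, where scalars are
  -- elements of `Π`.
  suffices H : ∀ r, idem Q o * (r * z) * idem Q j ∈
      (gamRad Q I * gamRad Q I).map (sandwich (idem Q o) (idem Q j)) by
    simpa using H 1
  induction hz using Submodule.span_induction with
  | mem z h =>
    obtain ⟨i, hi, u, hu, v, hv, rfl⟩ := h
    intro r
    refine ⟨_, Submodule.mul_mem_mul (hmem o ho i hi (r * u) (mul_mem_posPart_left _ hu))
      (hmem i hi j hj v hv), ?_⟩
    simp only [sandwich, LinearMap.comp_apply, LinearMap.mulLeft_apply, LinearMap.mulRight_apply]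
    simp only [mul_assoc, idem_mul_self]
    rw [← mul_assoc (idem Q o) (idem Q o), ← mul_assoc (idem Q i) (idem Q i), idem_mul_self,
      idem_mul_self]
  | zero => intro r; rw [mul_zero, mul_zero, zero_mul]; exact zero_mem _
  | add y z _ _ hy hz => intro r; rw [mul_add, mul_add, add_mul]; exact add_mem (hy r) (hz r)
  | smul c y _ hy => intro r; rw [smul_eq_mul, ← mul_assoc r]; exact hy _

/-- An element of `Γ_I` absorbs `e_I` on the right, so `x y = x e_I y = ∑ x e_i y`. -/
theorem gamRad_mul_le {I : Finset V} {z : Preproj Q} (hz : z ∈ gamRad Q I * gamRad Q I) :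
    z ∈ radSq Q I := by
  classical
  refine Submodule.mul_induction_on hz (fun x hx y hy => ?_) fun x y hx hy => add_mem hx hy
  · obtain ⟨⟨w, rfl⟩, h⟩ := hx
    have hsq : (∑ l ∈ I, idem Q l) * (∑ l ∈ I, idem Q l) = ∑ l ∈ I, idem Q l := by
      rw [Finset.sum_mul]
      refine Finset.sum_congr rfl fun i hi => ?_
      rw [Finset.mul_sum, Finset.sum_eq_single i (fun l _ hl => idem_mul_of_ne Q hl.symm)
        (fun h => absurd hi h), idem_mul_self]
    have : sandwich (∑ l ∈ I, idem Q l) (∑ l ∈ I, idem Q l) w * (∑ l ∈ I, idem Q l) =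
        sandwich (∑ l ∈ I, idem Q l) (∑ l ∈ I, idem Q l) w := by
      simp only [sandwich, LinearMap.comp_apply, LinearMap.mulLeft_apply, LinearMap.mulRight_apply]
      rw [mul_assoc, mul_assoc w, hsq]
    rw [← this, Finset.mul_sum, Finset.sum_mul]
    exact Ideal.sum_mem _ fun i hi => Ideal.subset_span ⟨i, hi, _, h, _, hy.2, rfl⟩

theorem mem_map_sandwich {o j : V} {F : Submodule ℂ (Preproj Q)} {z : Preproj Q}
    (hz : z ∈ F.map (sandwich (idem Q o) (idem Q j))) :
    ∃ w ∈ F, z = idem Q o * w * idem Q j := by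
  obtain ⟨w, hw, rfl⟩ := hz
  exact ⟨w, hw, by
    simp only [sandwich, LinearMap.comp_apply, LinearMap.mulLeft_apply, LinearMap.mulRight_apply,
      mul_assoc]⟩

variable (Q) in
/-- The arrow space embeds into `Π / Π₊ e_I Π₊`. -/
def arrowSpaceMap (I : Finset V) (o j : V) : ArrowSpace Q I o j →ₗ[ℂ] RadQuot Q I :=
  Submodule.liftQ _ ((radMk Q I).toLinearMap ∘ₗ
      ((gamRad Q I).map (sandwich (idem Q o) (idem Q j))).subtype) (by
    rintro ⟨z, hz⟩ h
    obtain ⟨w, hw, hw'⟩ : ∃ w ∈ gamRad Q I * gamRad Q I, z = idem Q o * w * idem Q j :=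
      mem_map_sandwich h
    change radMk Q I z = 0
    rw [radMk_eq_zero, hw']
    exact Ideal.mul_mem_right _ _ (Ideal.mul_mem_left _ _ (gamRad_mul_le hw)))

/-- An element of `e_o J e_j` that lies in `Π₊ e_I Π₊` is unchanged by the sandwich with `e_o` and
`e_j`, which places it in `e_o J² e_j`. -/
theorem arrowSpaceMap_injective {I : Finset V} {o j : V} (ho : o ∈ I) (hj : j ∈ I) :
    Function.Injective (arrowSpaceMap Q I o j) := by
  rw [← LinearMap.ker_eq_bot]
  refine Submodule.ker_liftQ_eq_bot _ _ _ ?_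
  rintro ⟨z, hz⟩ h
  change radMk Q I z = 0 at h
  rw [radMk_eq_zero] at h
  have h1 := sandwich_mem_of_mem_radSq ho hj h
  obtain ⟨w, -, hw⟩ : ∃ w ∈ gamRad Q I, z = idem Q o * w * idem Q j := mem_map_sandwich hz
  rw [Submodule.mem_comap, Submodule.subtype_apply]
  convert h1 using 1
  rw [Subtype.coe_mk, hw]
  simp only [mul_assoc, idem_mul_self]
  rw [← mul_assoc (idem Q o) (idem Q o), idem_mul_self]

theorem numArrows_eq_zero {I : Finset V} (o : V) {j : V} (hj : j ∉ I) :
    numArrows Q I o j = 0 := by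
  have : Subsingleton ↥((gamRad Q I).map (sandwich (idem Q o) (idem Q j))) := by
    rw [Submodule.subsingleton_iff_eq_bot, eq_bot_iff]
    intro z hz
    obtain ⟨w, ⟨⟨y, rfl⟩, -⟩, rfl⟩ := mem_map_sandwich hz
    have h : (∑ l ∈ I, idem Q l) * idem Q j = 0 := by
      rw [Finset.sum_mul]
      exact Finset.sum_eq_zero fun i hi => idem_mul_of_ne Q (by rintro rfl; exact hj hi)
    simp only [sandwich, LinearMap.comp_apply, LinearMap.mulLeft_apply, LinearMap.mulRight_apply]
    rw [mul_assoc, mul_assoc, mul_assoc, h]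
    simp
  exact rank_subsingleton' ℂ _

theorem numArrows_le_card {I : Finset V} {o j : V} (ho : o ∈ I) (hj : j ∈ I)
    (P : Finset (RadQuot Q I))
    (h : ∀ z ∈ posPart Q, radMk Q I (idem Q o * z * idem Q j) ∈
      Submodule.span ℂ (P : Set (RadQuot Q I))) :
    numArrows Q I o j ≤ P.card := by
  have hr : ∀ x, arrowSpaceMap Q I o j x ∈ Submodule.span ℂ (P : Set (RadQuot Q I)) := by
    intro x
    obtain ⟨⟨z, hz⟩, rfl⟩ := Submodule.Quotient.mk_surjective _ x
    obtain ⟨w, hw, rfl⟩ := mem_map_sandwich hz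
    exact h w hw.2
  calc numArrows Q I o j
      ≤ Module.rank ℂ (Submodule.span ℂ (P : Set (RadQuot Q I))) :=
        LinearMap.rank_le_of_injective ((arrowSpaceMap Q I o j).codRestrict _ hr)
          (fun x y hxy => arrowSpaceMap_injective ho hj (congrArg Subtype.val hxy))
    _ ≤ P.card := rank_span_finset_le P

theorem le_numArrows {I : Finset V} {o j : V} (ho : o ∈ I) (hj : j ∈ I) {n : ℕ}
    (p : Fin n → Preproj Q) (hp : ∀ i, p i ∈ posPart Q)
    (h : LinearIndependent ℂ fun i => radMk Q I (idem Q o * p i * idem Q j)) :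
    (n : Cardinal) ≤ numArrows Q I o j := by
  classical
  have hsum : (∑ l ∈ I, idem Q l) * idem Q o = idem Q o := by
    rw [Finset.sum_mul, Finset.sum_eq_single o (fun l _ hl => idem_mul_of_ne Q hl)
      (fun h => absurd ho h), idem_mul_self]
  have hsum' : idem Q j * (∑ l ∈ I, idem Q l) = idem Q j := by
    rw [Finset.mul_sum, Finset.sum_eq_single j (fun l _ hl => idem_mul_of_ne Q hl.symm)
      (fun h => absurd hj h), idem_mul_self]
  have hmem : ∀ i, idem Q o * p i * idem Q j ∈
      (gamRad Q I).map (sandwich (idem Q o) (idem Q j)) := by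
    intro i
    refine ⟨idem Q o * p i * idem Q j, ⟨⟨idem Q o * p i * idem Q j, ?_⟩,
      mul_mem_posPart_right (mul_mem_posPart_left _ (hp i)) _⟩, ?_⟩ <;>
    simp only [sandwich, LinearMap.comp_apply, LinearMap.mulLeft_apply, LinearMap.mulRight_apply]
    · rw [mul_assoc _ (idem Q j), hsum', ← mul_assoc, ← mul_assoc, hsum]
    · rw [mul_assoc _ (idem Q j), idem_mul_self, ← mul_assoc, ← mul_assoc, idem_mul_self]
  have h1 : LinearIndependent ℂ fun i =>
      (Submodule.Quotient.mk ⟨_, hmem i⟩ : ArrowSpace Q I o j) :=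
    LinearIndependent.of_comp (arrowSpaceMap Q I o j) h
  have h2 := h1.cardinal_le_rank
  rwa [Cardinal.mk_fin] at h2

/-! ### Representations by matrices over an algebra, for linear independence -/

section Representation

variable {M : Type} [Ring M] [Algebra ℂ M] [DecidableEq V] (m : E ⊕ E → M)

variable (Q) in
/-- The generators of the representation of `Π` given by elements `m a` of an algebra. -/
def repGen : V ⊕ (E ⊕ E) → Matrix V V M
  | Sum.inl i => Matrix.single i i 1
  | Sum.inr a => Matrix.single (Q.double.tail a) (Q.double.head a) (m a)

variable (Q) in
/-- The homomorphism from the path algebra of the double quiver. -/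
def pathRep : PathAlgebra Q.double →ₐ[ℂ] Matrix V V M :=
  RingQuot.liftAlgHom ℂ ⟨FreeAlgebra.lift ℂ (repGen Q m), by
    intro x y h
    induction h with
    | idem i => simp [repGen]
    | orth i j h => simp [repGen, Matrix.single_mul_single_of_ne _ _ _ _ h]
    | complete =>
      simp only [map_sum, FreeAlgebra.lift_ι_apply, map_one, repGen]
      ext i j
      rw [Matrix.sum_apply, Matrix.one_apply]
      by_cases hij : i = j
      · subst hij
        simp [Matrix.single_apply]
      · rw [if_neg hij]
        exact Finset.sum_eq_zero fun x _ => if_neg fun h => hij (h.1.symm.trans h.2)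
    | tail_mul a => simp [repGen]
    | mul_head a => simp [repGen]⟩

theorem pathRep_arrow (a : E ⊕ E) : pathRep Q m (pathArrow Q.double a) =
    Matrix.single (Q.double.tail a) (Q.double.head a) (m a) := by
  have : pathRep Q m (pathArrow Q.double a) =
      FreeAlgebra.lift ℂ (repGen Q m) (FreeAlgebra.ι ℂ (Sum.inr a)) :=
    RingQuot.liftAlgHom_mkAlgHom_apply ..
  rw [this, FreeAlgebra.lift_ι_apply]
  rfl

theorem pathRep_idem (i : V) : pathRep Q m (pathIdem Q.double i) = Matrix.single i i 1 := by
  have : pathRep Q m (pathIdem Q.double i) =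
      FreeAlgebra.lift ℂ (repGen Q m) (FreeAlgebra.ι ℂ (Sum.inl i)) :=
    RingQuot.liftAlgHom_mkAlgHom_apply ..
  rw [this, FreeAlgebra.lift_ι_apply]
  rfl

variable (hm : ∀ v, ∑ c : E, (if Q.tail c = v then m (Sum.inl c) * m (Sum.inr c) else 0) =
      ∑ c : E, (if Q.head c = v then m (Sum.inr c) * m (Sum.inl c) else 0))

/-- The representation of `Π` given by elements `m a` that satisfy the relation at each vertex. -/
def rep : Preproj Q →ₐ[ℂ] Matrix V V M :=
  RingQuot.liftAlgHom ℂ ⟨pathRep Q m, by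
    rintro _ _ ⟨⟩
    simp only [map_sum, map_sub, map_mul, pathRep_arrow, map_zero]
    have h1 : ∀ c : E, Matrix.single (Q.double.tail (Sum.inl c)) (Q.double.head (Sum.inl c))
        (m (Sum.inl c)) * Matrix.single (Q.double.tail (Sum.inr c)) (Q.double.head (Sum.inr c))
        (m (Sum.inr c)) = Matrix.single (Q.tail c) (Q.tail c) (m (Sum.inl c) * m (Sum.inr c)) :=
      fun c => Matrix.single_mul_single_same ..
    have h2 : ∀ c : E, Matrix.single (Q.double.tail (Sum.inr c)) (Q.double.head (Sum.inr c))
        (m (Sum.inr c)) * Matrix.single (Q.double.tail (Sum.inl c)) (Q.double.head (Sum.inl c))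
        (m (Sum.inl c)) = Matrix.single (Q.head c) (Q.head c) (m (Sum.inr c) * m (Sum.inl c)) :=
      fun c => Matrix.single_mul_single_same ..
    simp only [h1, h2, Finset.sum_sub_distrib]
    rw [sub_eq_zero]
    ext i j
    simp only [Matrix.sum_apply, Matrix.single_apply]
    by_cases hij : i = j
    · subst hij
      simpa using hm i
    · have h3 : ∀ v : V, ¬ (v = i ∧ v = j) := fun v h => hij (h.1.symm.trans h.2)
      simp [h3]⟩

theorem rep_arrow (a : E ⊕ E) : rep m hm (arrow Q a) =
    Matrix.single (Q.double.tail a) (Q.double.head a) (m a) := by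
  have : rep m hm (arrow Q a) = pathRep Q m (pathArrow Q.double a) :=
    RingQuot.liftAlgHom_mkAlgHom_apply ..
  rw [this, pathRep_arrow]

theorem rep_idem (i : V) : rep m hm (idem Q i) = Matrix.single i i 1 := by
  have : rep m hm (idem Q i) = pathRep Q m (pathIdem Q.double i) :=
    RingQuot.liftAlgHom_mkAlgHom_apply ..
  rw [this, pathRep_idem]

variable {m}

/-- Only products of two arrows have to be checked: in `u e_i v` the last arrow of `u` and the first
arrow of `v` meet at `i`. The two ends are treated one after the other by `map_mem_of_closed`. -/
theorem rep_eq_zero_of_mem_radSq {I : Finset V}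
    (hI : ∀ a b, Q.double.head a ∈ I → Q.double.head a = Q.double.tail b → m a * m b = 0)
    {z : Preproj Q} (hz : z ∈ radSq Q I) : rep m hm z = 0 := by
  have h1 : ∀ i ∈ I, ∀ a, Q.double.head a = i → ∀ v ∈ posPart Q,
      rep m hm (arrow Q a) * rep m hm v = 0 := by
    intro i hi a ha v hv
    -- The same subspace at every vertex: the right annihilator of the arrow `a`.
    have h := map_mem_of_closed Q (rep m hm) i
      (fun _ => LinearMap.ker (LinearMap.mulLeft ℂ (rep m hm (arrow Q a))))
      (by
        intro b hb
        rw [LinearMap.mem_ker, LinearMap.mulLeft_apply, rep_arrow, rep_arrow, ha, hb,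
          Matrix.single_mul_single_same, hI a b (ha ▸ hi) (ha.trans hb.symm), Matrix.single_zero])
      (by
        intro b s hs
        rw [LinearMap.mem_ker, LinearMap.mulLeft_apply] at hs ⊢
        rw [← mul_assoc, hs, zero_mul]) hv
    simp only [LinearMap.mem_ker, LinearMap.mulLeft_apply, ← map_mul, ← mul_assoc] at h
    rw [← ha] at h
    simp only [mul_idem_head] at h
    rw [← map_mul, ← mul_one (arrow Q a * v), ← sum_idem, Finset.mul_sum, map_sum]
    exact Finset.sum_eq_zero fun j _ => h j
  have h2 : ∀ i ∈ I, ∀ u ∈ posPart Q, ∀ v ∈ posPart Q, rep m hm (u * idem Q i * v) = 0 := by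
    intro i hi u hu v hv
    -- The condition sits at the vertex `i` alone: paths that end there annihilate `v`, because
    -- their last arrow does by `h1`.
    have h := fun o => map_mem_of_closed Q (rep m hm) o
      (fun l => if l = i then LinearMap.ker (LinearMap.mulRight ℂ (rep m hm v)) else ⊤)
      (by
        intro b _
        split_ifs with hb
        · exact h1 i hi b hb v hv
        · exact Submodule.mem_top)
      (by
        intro b s _
        split_ifs with hb
        · rw [LinearMap.mem_ker, LinearMap.mulRight_apply, mul_assoc, h1 i hi b hb v hv, mul_zero]
        · exact Submodule.mem_top) hu i
    simp only [if_true, LinearMap.mem_ker, LinearMap.mulRight_apply, ← map_mul] at h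
    rw [← one_mul (u * idem Q i * v), ← sum_idem, Finset.sum_mul, map_sum]
    refine Finset.sum_eq_zero fun o _ => ?_
    rw [← h o]
    simp only [mul_assoc]
  induction hz using Submodule.span_induction with
  | mem z h =>
    obtain ⟨i, hi, u, hu, v, hv, rfl⟩ := h
    exact h2 i hi u hu v hv
  | zero => exact map_zero _
  | add y z _ _ hy hz => rw [map_add, hy, hz, add_zero]
  | smul c y _ hy => rw [smul_eq_mul, map_mul, hy, mul_zero]

/-- A linear relation in the quotient lifts to an element of `Π₊ e_I Π₊`, which the representation
kills; the entry at `(o, j)` is then a relation between `x₁` and `x₂`. -/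
theorem linearIndependent_of_rep {I : Finset V}
    (hI : ∀ a b, Q.double.head a ∈ I → Q.double.head a = Q.double.tail b → m a * m b = 0)
    {o j : V} {p₁ p₂ : Preproj Q} {x₁ x₂ : M}
    (h₁ : rep m hm p₁ = Matrix.single o j x₁) (h₂ : rep m hm p₂ = Matrix.single o j x₂)
    (hx : LinearIndependent ℂ ![x₁, x₂]) :
    LinearIndependent ℂ ![radMk Q I (idem Q o * p₁ * idem Q j),
      radMk Q I (idem Q o * p₂ * idem Q j)] := by
  rw [LinearIndependent.pair_iff] at hx ⊢
  intro c d hcd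
  rw [← map_smul, ← map_smul, ← map_add, radMk_eq_zero] at hcd
  have h := rep_eq_zero_of_mem_radSq hm hI hcd
  rw [map_add, map_smul, map_smul] at h
  simp only [map_mul, rep_idem, h₁, h₂, Matrix.single_mul_single_same, one_mul, mul_one,
    Matrix.smul_single, ← Matrix.single_add] at h
  refine hx c d ?_
  simpa using congrFun (congrFun h o) j

end Representation

/-! ### Bases of the arrow spaces and the count of arrows -/

/-- Elements `p₁`, `p₂` that span `e_o (J / J²) e_k` and an element `q` that spans
`e_o (J / J²) e_o`, for `I = {o, k}`, with the further properties of `p₁` and `p₂` in the case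
that the vertex `k` is extremal. -/
structure ArrowBasis [DecidableEq V] (Q : ArrowQuiver V E) (o k : V) (extremal : Prop) where
  p₁ : Preproj Q
  p₂ : Preproj Q
  q : Preproj Q
  p₁_mem : p₁ ∈ posPart Q
  p₂_mem : p₂ ∈ posPart Q
  span_eq : ∀ z ∈ posPart Q, radMk Q {o, k} (idem Q o * z * idem Q k) ∈
    Submodule.span ℂ {radMk Q {o, k} p₁, radMk Q {o, k} p₂}
  span_zero : ∀ z ∈ posPart Q, radMk Q {o, k} (idem Q o * z * idem Q o) ∈
    Submodule.span ℂ {radMk Q {o, k} q}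
  eq_zero : ¬ extremal → radMk Q {o, k} p₂ = 0
  -- A third vertex in `I` makes one of the two elements decomposable; this is what forces `I = {o,
  -- k}` when there are two arrows.
  factor : extremal → ∀ l, l ≠ o → l ≠ k →
    radMk Q {o, k, l} p₁ = 0 ∨ radMk Q {o, k, l} p₂ = 0
  indep : extremal → LinearIndependent ℂ ![radMk Q {o, k} (idem Q o * p₁ * idem Q k),
    radMk Q {o, k} (idem Q o * p₂ * idem Q k)]

/-- The quotient for `J` is a further quotient of the one for `I`, so spanning statements for `{o,
k}` persist for every larger set. -/
theorem mem_span_radMk_of_subset (I J : Finset V) (h : I ⊆ J) (z : Preproj Q)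
    (P : Set (Preproj Q)) (hz : radMk Q I z ∈ Submodule.span ℂ (radMk Q I '' P)) :
    radMk Q J z ∈ Submodule.span ℂ (radMk Q J '' P) := by
  have h1 : Submodule.span ℂ (radMk Q I '' P) =
      (Submodule.span ℂ P).map (radMk Q I).toLinearMap :=
    (Submodule.map_span (radMk Q I).toLinearMap P).symm
  have h2 : Submodule.span ℂ (radMk Q J '' P) =
      (Submodule.span ℂ P).map (radMk Q J).toLinearMap :=
    (Submodule.map_span (radMk Q J).toLinearMap P).symm
  rw [h1, Submodule.mem_map] at hz
  rw [h2, Submodule.mem_map]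
  obtain ⟨w, hw, hwz⟩ := hz
  refine ⟨w, hw, ?_⟩
  rw [AlgHom.toLinearMap_apply] at hwz ⊢
  rw [← sub_eq_zero, ← map_sub, radMk_eq_zero] at hwz ⊢
  exact radSq_mono h hwz

theorem numArrows_le_two [DecidableEq V] {o k : V} {δ : Prop} (B : ArrowBasis Q o k δ)
    {I : Finset V} (ho : o ∈ I) (hk : k ∈ I) : numArrows Q I o k ≤ 2 := by
  classical
  have h := numArrows_le_card ho hk {radMk Q I B.p₁, radMk Q I B.p₂} fun z hz => by
    have h := mem_span_radMk_of_subset {o, k} I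
      (by simp [Finset.insert_subset_iff, ho, hk]) _ {B.p₁, B.p₂}
      (by rw [Set.image_pair]; exact B.span_eq z hz)
    rw [Set.image_pair] at h
    simpa using h
  exact h.trans (by exact_mod_cast Finset.card_le_two)

theorem numArrows_le_one_of [DecidableEq V] {o k : V} {δ : Prop} (B : ArrowBasis Q o k δ)
    {I : Finset V} (ho : o ∈ I) (hk : k ∈ I)
    (h : radMk Q I B.p₁ = 0 ∨ radMk Q I B.p₂ = 0) : numArrows Q I o k ≤ 1 := by
  have key : ∀ z ∈ posPart Q, radMk Q I (idem Q o * z * idem Q k) ∈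
      Submodule.span ℂ {radMk Q I B.p₁, radMk Q I B.p₂} := fun z hz => by
    have h := mem_span_radMk_of_subset {o, k} I
      (by simp [Finset.insert_subset_iff, ho, hk]) _ {B.p₁, B.p₂}
      (by rw [Set.image_pair]; exact B.span_eq z hz)
    rwa [Set.image_pair] at h
  rcases h with h | h
  · rw [h] at key
    simpa using numArrows_le_card ho hk {radMk Q I B.p₂} (by simpa using key)
  · rw [h, Set.pair_comm] at key
    simpa using numArrows_le_card ho hk {radMk Q I B.p₁} (by simpa using key)

/-- The count of arrows that start at `o`, from bases for all the sets `{o, k}`. -/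
theorem numArrows_of_arrowBasis [DecidableEq V] {o : V} (δ : V → Prop)
    (B : ∀ k, k ≠ o → ArrowBasis Q o k (δ k)) {I : Finset V} (ho : o ∈ I) (j : V)
    (hj : ¬ (I = {o} ∧ j = o)) :
    (numArrows Q I o j = 0 ∨ numArrows Q I o j = 1 ∨ numArrows Q I o j = 2) ∧
    (numArrows Q I o j = 2 ↔ I = {o, j} ∧ δ j) := by
  have cases : ∀ c : Cardinal, c ≤ 2 → c = 0 ∨ c = 1 ∨ c = 2 := by
    intro c hc
    obtain ⟨n, rfl⟩ := Cardinal.lt_aleph0.1 (hc.trans_lt Cardinal.natCast_lt_aleph0)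
    have : n ≤ 2 := by exact_mod_cast hc
    interval_cases n <;> simp
  have lt : ∀ c : Cardinal, c ≤ 1 → c ≠ 2 := by
    rintro c hc rfl
    exact absurd hc (by norm_num)
  have one_le_two : ∀ c : Cardinal, c ≤ 1 → c ≤ 2 := fun c hc => hc.trans (by norm_num)
  by_cases hjI : j ∈ I
  swap
  · rw [numArrows_eq_zero o hjI]
    refine ⟨Or.inl rfl, ⟨fun h => absurd h (by norm_num), fun h => absurd ?_ hjI⟩⟩
    rw [h.1]
    simp
  by_cases hjo : j = o
  · subst hjo
    -- The excluded case `I = {o}`, `j = o` is used here: any second vertex `k` of `I` supplies the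
    -- single generator `q` of the loops.
    obtain ⟨k, hk, hko⟩ : ∃ k ∈ I, k ≠ j := by
      by_contra! h
      exact hj ⟨Finset.eq_singleton_iff_unique_mem.2 ⟨ho, h⟩, rfl⟩
    have h1 : numArrows Q I j j ≤ 1 := by
      have h := numArrows_le_card ho ho {radMk Q I (B k hko).q} fun z hz => by
        have h := mem_span_radMk_of_subset {j, k} I
          (by simp [Finset.insert_subset_iff, ho, hk]) _ {(B k hko).q}
          (by rw [Set.image_singleton]; exact (B k hko).span_zero z hz)
        rw [Set.image_singleton] at h
        simpa using h
      simpa using h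
    refine ⟨cases _ (one_le_two _ h1), ⟨fun h => absurd h (lt _ h1), fun h => ?_⟩⟩
    exact absurd ⟨by simpa using h.1, rfl⟩ hj
  · have h2 := numArrows_le_two (B j hjo) ho hjI
    refine ⟨cases _ h2, ?_⟩
    by_cases hδ : δ j
    · by_cases hI : I = {o, j}
      · refine ⟨fun _ => ⟨hI, hδ⟩, fun _ => le_antisymm h2 ?_⟩
        have h := le_numArrows ho hjI ![(B j hjo).p₁, (B j hjo).p₂] (by
          intro i
          fin_cases i
          · exact (B j hjo).p₁_mem
          · exact (B j hjo).p₂_mem) (by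
          have h := (B j hjo).indep hδ
          rw [← hI] at h
          convert h using 1
          ext i
          fin_cases i <;> rfl)
        exact_mod_cast h
      · obtain ⟨l, hl, hlo, hlj⟩ : ∃ l ∈ I, l ≠ o ∧ l ≠ j := by
          by_contra! h
          refine hI (Finset.Subset.antisymm (fun l hl => ?_) ?_)
          · by_cases hlo : l = o
            · simp [hlo]
            · simp [h l hl hlo]
          · simp [Finset.insert_subset_iff, ho, hjI]
        have hsub : {o, j, l} ⊆ I := by simp [Finset.insert_subset_iff, ho, hjI, hl]
        have h1 := numArrows_le_one_of (B j hjo) ho hjI (((B j hjo).factor hδ l hlo hlj).imp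
          (fun h => radMk_eq_zero.2 (radSq_mono hsub (radMk_eq_zero.1 h)))
          (fun h => radMk_eq_zero.2 (radSq_mono hsub (radMk_eq_zero.1 h))))
        exact ⟨fun h => absurd h (lt _ h1), fun h => absurd h.1 hI⟩
    · have h1 := numArrows_le_one_of (B j hjo) ho hjI (Or.inr (radMk_eq_zero.2
        (radSq_mono (show {o, j} ⊆ I by simp [Finset.insert_subset_iff, ho, hjI])
          (radMk_eq_zero.1 ((B j hjo).eq_zero hδ)))))
      exact ⟨fun h => absurd h (lt _ h1), fun h => absurd h.2 hδ⟩

end ArrowQuiver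

/-! ### Products along chains, matrix units -/

/-- The product `f a * f (a + 1) * ⋯ * f (a + d - 1)`. -/
def chain {A : Type} [Monoid A] (f : ℕ → A) (a : ℕ) : ℕ → A
  | 0 => 1
  | d + 1 => chain f a d * f (a + d)

theorem chain_zero {A : Type} [Monoid A] (f : ℕ → A) (a : ℕ) : chain f a 0 = 1 := rfl

theorem chain_succ {A : Type} [Monoid A] (f : ℕ → A) (a d : ℕ) :
    chain f a (d + 1) = chain f a d * f (a + d) := rfl

theorem chain_one {A : Type} [Monoid A] (f : ℕ → A) (a : ℕ) : chain f a 1 = f a := by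
  rw [chain_succ, chain_zero, one_mul, add_zero]

theorem map_chain {A B F : Type} [Monoid A] [Monoid B] [FunLike F A B] [MonoidHomClass F A B]
    (φ : F) (f : ℕ → A) (a d : ℕ) : φ (chain f a d) = chain (fun i => φ (f i)) a d := by
  induction d with
  | zero => exact map_one φ
  | succ d ih => rw [chain_succ, map_mul, ih, chain_succ]

/-- The two bad neighbours are either both inside the shorter product or they are its last two
factors. -/
theorem chain_eq_zero {A : Type} [Ring A] {f : ℕ → A} {i : ℕ} (h : f i * f (i + 1) = 0)
    {a d : ℕ} (ha : a ≤ i) (hd : i + 2 ≤ a + d) : chain f a d = 0 := by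
  induction d with
  | zero => omega
  | succ d ih =>
    rw [chain_succ]
    rcases Nat.lt_or_ge (i + 2) (a + (d + 1)) with h1 | h1
    · rw [ih (by omega), zero_mul]
    · obtain ⟨d, rfl⟩ : ∃ d', d = d' + 1 := ⟨d - 1, by omega⟩
      rw [chain_succ, mul_assoc, show a + d = i by omega, show a + (d + 1) = i + 1 by omega, h,
        mul_zero]

/-- Along a chain of vertices of valency two, a path that goes straight ahead and then one step
back is zero as soon as it is so at the beginning. -/
theorem chain_mul_back {A : Type} [Ring A] {f g : ℕ → A} {m : ℕ} (h : f 0 * g 0 * f 0 = 0)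
    (hr : ∀ i < m, f (i + 1) * g (i + 1) = g i * f i) {i : ℕ} (hi : i < m) :
    chain f 0 (i + 2) * g (i + 1) = 0 := by
  induction i with
  | zero =>
    -- The relation slides the turn one vertex towards the start, where it becomes `f 0 * g 0 * f
    -- 0`.
    rw [chain_succ, chain_one, mul_assoc, zero_add, hr 0 hi, ← mul_assoc, h]
  | succ i ih =>
    rw [chain_succ, zero_add, mul_assoc, hr _ hi, ← mul_assoc, ih (by omega), zero_mul]

/-- The matrix units of the algebra of complex matrices. -/
abbrev mUnit {d : ℕ} (i j : Fin d) : Matrix (Fin d) (Fin d) ℂ := Matrix.single i j 1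

theorem linearIndependent_mUnit {d : ℕ} {i j k : Fin d} (h : j ≠ k) :
    LinearIndependent ℂ ![mUnit i j, mUnit i k] := by
  rw [LinearIndependent.pair_iff]
  intro s t hst
  constructor
  · simpa [Matrix.single_apply, h.symm] using congrFun (congrFun hst i) j
  · simpa [Matrix.single_apply, h] using congrFun (congrFun hst i) k

namespace ArrowQuiver

theorem mul_mem_of_span {R : Type} [Ring R] [Algebra ℂ R] {X : Set R} {S : Submodule ℂ R} {y : R}
    (h : ∀ x ∈ X, x * y ∈ S) {s : R} (hs : s ∈ Submodule.span ℂ X) : s * y ∈ S :=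
  (Submodule.span_le (p := S.comap (LinearMap.mulRight ℂ y))).2 h hs

/-! ### Type `Ãₙ` -/

/-- The cycle with the vertices `0, …, n`. -/
def cycle (n : ℕ) : ArrowQuiver (Fin (n + 1)) (Fin (n + 1)) where
  tail := fun k => k
  head := fun k => k + 1

namespace cycle

variable (n : ℕ)

/-- The arrow `i → i + 1`. -/
def fwd (i : ℕ) : Preproj (cycle n) :=
  if h : i < n + 1 then arrow (cycle n) (Sum.inl ⟨i, h⟩) else 0

/-- The arrow `i + 1 → i`. -/
def bwd (i : ℕ) : Preproj (cycle n) :=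
  if h : i < n + 1 then arrow (cycle n) (Sum.inr ⟨i, h⟩) else 0

variable {n}

theorem fwd_val (c : Fin (n + 1)) : fwd n c = arrow (cycle n) (Sum.inl c) := dif_pos c.2

theorem bwd_val (c : Fin (n + 1)) : bwd n c = arrow (cycle n) (Sum.inr c) := dif_pos c.2

theorem head_inl_val {c : Fin (n + 1)} (h : c.val < n) :
    ((cycle n).double.head (Sum.inl c)).val = c.val + 1 :=
  Fin.val_add_one_of_lt (Fin.lt_def.2 (by simpa using h))

theorem head_inl_last {c : Fin (n + 1)} (h : c.val = n) :
    (cycle n).double.head (Sum.inl c) = 0 := by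
  obtain rfl : c = Fin.last n := Fin.ext h
  exact Fin.last_add_one n

/-- Taken at the vertex `v + 1`, whose outgoing edge is `v + 1` and whose incoming edge is `v`, so
that no subtraction modulo `n + 1` occurs. -/
theorem relation (v : Fin (n + 1)) :
    arrow (cycle n) (Sum.inl (v + 1)) * arrow (cycle n) (Sum.inr (v + 1)) =
      arrow (cycle n) (Sum.inr v) * arrow (cycle n) (Sum.inl v) := by
  have h := vertex_relation (cycle n) (v + 1)
  have ht : ∀ c, (cycle n).tail c = c := fun _ => rfl
  have hh : ∀ c, (cycle n).head c = c + 1 := fun _ => rfl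
  simpa only [ht, hh, add_left_inj, Finset.sum_ite_eq', Finset.mem_univ, if_true] using h

theorem relation_zero : fwd n 0 * bwd n 0 = bwd n n * fwd n n := by
  have h := relation (Fin.last n)
  rw [Fin.last_add_one] at h
  simpa only [← fwd_val, ← bwd_val, Fin.val_zero, Fin.val_last] using h

theorem relation_succ {i : ℕ} (hi : i < n) :
    fwd n (i + 1) * bwd n (i + 1) = bwd n i * fwd n i := by
  have h := relation (⟨i, by omega⟩ : Fin (n + 1))
  have h1 : ((⟨i, by omega⟩ : Fin (n + 1)) + 1).val = i + 1 := head_inl_val (c := ⟨i, by omega⟩) hi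
  simpa only [← fwd_val, ← bwd_val, h1] using h

/-- The elements that represent the straight paths from `0` in the positive direction. -/
def pos (n d : ℕ) : Preproj (cycle n) := chain (fwd n) 0 d

/-- The elements that represent the straight paths from `0` in the negative direction. -/
def neg (n d : ℕ) : Preproj (cycle n) := chain (fun i => bwd n (n - i)) 0 d

section Quot

variable {I : Finset (Fin (n + 1))}

theorem fwd_mul {i : ℕ} (hi : i < n) (h : (⟨i + 1, by omega⟩ : Fin (n + 1)) ∈ I) (a) :
    radMk (cycle n) I (fwd n i) * radMk (cycle n) I (arrow (cycle n) a) = 0 := by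
  rw [show fwd n i = _ from fwd_val ⟨i, by omega⟩]
  refine radMk_arrow_mul_arrow ?_ a
  have h1 : (cycle n).double.head (Sum.inl ⟨i, by omega⟩) = ⟨i + 1, by omega⟩ :=
    Fin.ext (head_inl_val (c := ⟨i, by omega⟩) hi)
  rwa [h1]

theorem bwd_mul {i : ℕ} (hi : i < n + 1) (h : (⟨i, hi⟩ : Fin (n + 1)) ∈ I) (a) :
    radMk (cycle n) I (bwd n i) * radMk (cycle n) I (arrow (cycle n) a) = 0 := by
  rw [show bwd n i = _ from bwd_val ⟨i, hi⟩]
  exact radMk_arrow_mul_arrow h a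

theorem radMk_pos_eq_zero {l : Fin (n + 1)} (hl : l ∈ I) (hl0 : l ≠ 0) {d : ℕ}
    (hd : l.val < d) : radMk (cycle n) I (pos n d) = 0 := by
  have h0 : 0 < l.val := Nat.pos_of_ne_zero fun h => hl0 (Fin.ext h)
  rw [pos, map_chain]
  -- The factors `l - 1` and `l` enter and leave the vertex `l`.
  refine chain_eq_zero (i := l.val - 1) ?_ (Nat.zero_le _) (by omega)
  rw [show l.val - 1 + 1 = l.val by omega, fwd_val l]
  refine fwd_mul (by omega) ?_ _
  convert hl
  omega

theorem radMk_neg_eq_zero {l : Fin (n + 1)} (hl : l ∈ I) (hl0 : l ≠ 0) {d : ℕ}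
    (hd : n + 1 < l.val + d) : radMk (cycle n) I (neg n d) = 0 := by
  have h0 : 0 < l.val := Nat.pos_of_ne_zero fun h => hl0 (Fin.ext h)
  rw [neg, map_chain]
  refine chain_eq_zero (i := n - l.val) ?_ (Nat.zero_le _) (by omega)
  rw [show n - (n - l.val) = l.val by omega,
    show bwd n (n - (n - l.val + 1)) = _ from bwd_val ⟨n - (n - l.val + 1), by omega⟩]
  exact bwd_mul l.2 hl _

/-- The turn slides back to the start, and `fwd 0 * bwd 0 * fwd 0` passes through the vertex `0` of
`I`. A turn after the very first step does survive; it is the loop `q`. -/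
theorem radMk_pos_mul_bwd (h0 : 0 ∈ I) {d : ℕ} (hd : d < n) :
    radMk (cycle n) I (pos n (d + 2)) * radMk (cycle n) I (bwd n (d + 1)) = 0 := by
  rw [pos, map_chain]
  refine chain_mul_back (g := fun i => radMk (cycle n) I (bwd n i)) (m := n) ?_ ?_ hd
  · rw [mul_assoc, show fwd n 0 = _ from fwd_val 0, bwd_mul (Nat.succ_pos n) h0, mul_zero]
  · intro i hi
    rw [← map_mul, ← map_mul, relation_succ hi]

theorem radMk_neg_mul_fwd (h0 : 0 ∈ I) {d : ℕ} (hd : d < n) :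
    radMk (cycle n) I (neg n (d + 2)) * radMk (cycle n) I (fwd n (n - (d + 1))) = 0 := by
  rw [neg, map_chain]
  refine chain_mul_back (g := fun i => radMk (cycle n) I (fwd n (n - i))) (m := n) ?_ ?_ hd
  · rw [Nat.sub_zero, ← map_mul, ← relation_zero, map_mul, mul_assoc,
      show bwd n n = _ from bwd_val (Fin.last n), bwd_mul (Nat.succ_pos n) h0, mul_zero]
  · intro i hi
    rw [← map_mul, ← map_mul, show n - i = n - (i + 1) + 1 by omega, relation_succ (by omega)]

end Quot

variable (k : Fin (n + 1))

/-- The spans of the paths from `0` that end at a given vertex. -/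
def spans (v : Fin (n + 1)) : Submodule ℂ (RadQuot (cycle n) {0, k}) :=
  if v = 0 then Submodule.span ℂ {radMk (cycle n) {0, k} (fwd n 0 * bwd n 0)}
  else Submodule.span ℂ {radMk (cycle n) {0, k} (pos n v),
    radMk (cycle n) {0, k} (neg n (n + 1 - v))}

variable {k}

/-- An arrow prolongs a straight path, turns it back, or brings it to `0`. Turns after at least two
steps vanish, and a path that goes all the way round has passed `k`. -/
theorem spans_closed (hk : k ≠ 0) (a : Fin (n + 1) ⊕ Fin (n + 1))
    (s : RadQuot (cycle n) {0, k}) (hs : s ∈ spans k ((cycle n).double.tail a)) :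
    s * radMk (cycle n) {0, k} (arrow (cycle n) a) ∈ spans k ((cycle n).double.head a) := by
  have h0 : (0 : Fin (n + 1)) ∈ ({0, k} : Finset (Fin (n + 1))) := by simp
  have hkm : k ∈ ({0, k} : Finset (Fin (n + 1))) := by simp
  have hkpos : 0 < k.val := Nat.pos_of_ne_zero fun h => hk (Fin.ext h)
  by_cases ht : (cycle n).double.tail a = 0
  · rw [ht, spans, if_pos rfl] at hs
    refine mul_mem_of_span ?_ hs
    rintro x rfl
    rw [map_mul, mul_assoc, bwd_mul (Nat.succ_pos n) h0, mul_zero]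
    exact zero_mem _
  rw [spans, if_neg ht] at hs
  refine mul_mem_of_span ?_ hs
  rcases a with c | c
  · have hc0 : 0 < c.val := Nat.pos_of_ne_zero fun h => ht (Fin.ext h)
    have hcn : c.val ≤ n := Nat.lt_succ_iff.1 c.2
    change ∀ x ∈ ({radMk (cycle n) {0, k} (pos n c),
      radMk (cycle n) {0, k} (neg n (n + 1 - c))} : Set _), _
    rw [← fwd_val]
    rcases Nat.lt_or_ge c.val n with hc | hc
    · have hh := head_inl_val hc
      rw [spans, if_neg (fun h => by simp [h] at hh), hh]
      rintro x (rfl | rfl)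
      · rw [← map_mul]
        refine Submodule.subset_span (Or.inl ?_)
        rw [pos, pos, chain_succ, zero_add]
      · have h1 := radMk_neg_mul_fwd h0 (show n - c.val - 1 < n by omega)
        rw [show n - c.val - 1 + 2 = n + 1 - c by omega,
          show n - (n - c.val - 1 + 1) = c by omega] at h1
        rw [h1]
        exact zero_mem _
    · rw [spans, if_pos (head_inl_last (by omega))]
      rintro x (rfl | rfl)
      · rw [← map_mul, show pos n c * fwd n c = pos n (c + 1) by
          rw [pos, pos, chain_succ, zero_add], radMk_pos_eq_zero hkm hk (by omega)]
        exact zero_mem _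
      -- One negative step and back: by the relation at `0` this is the same loop as one positive
      -- step and back.
      · rw [← map_mul]
        refine Submodule.subset_span ?_
        rw [show c.val = n by omega, relation_zero, show n + 1 - n = 1 by omega, neg, chain_one]
        rfl
  · change ∀ x ∈ ({radMk (cycle n) {0, k} (pos n ((cycle n).double.head (Sum.inl c))),
      radMk (cycle n) {0, k} (neg n (n + 1 - ((cycle n).double.head (Sum.inl c))))} : Set _), _
    have hc : c.val < n := by
      refine lt_of_le_of_ne (Nat.lt_succ_iff.1 c.2) fun h => ht ?_
      exact head_inl_last h
    rw [head_inl_val hc, ← bwd_val]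
    change ∀ x ∈ _, _ ∈ spans k c
    by_cases hc0 : c = 0
    · subst hc0
      rw [spans, if_pos rfl]
      rintro x (rfl | rfl)
      · rw [← map_mul]
        refine Submodule.subset_span ?_
        rw [Fin.val_zero, zero_add, pos, chain_one]
        rfl
      · rw [← map_mul, show neg n (n + 1 - ((0 : Fin (n + 1)).val + 1)) * bwd n (0 : Fin (n + 1)).val
          = neg n (n + 1) by
          rw [neg, neg, chain_succ, Fin.val_zero]
          congr 2
          omega, radMk_neg_eq_zero hkm hk (by omega)]
        exact zero_mem _
    · have hc1 : 0 < c.val := Nat.pos_of_ne_zero fun h => hc0 (Fin.ext h)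
      rw [spans, if_neg hc0]
      rintro x (rfl | rfl)
      · have h1 := radMk_pos_mul_bwd h0 (show c.val - 1 < n by omega)
        rw [show c.val - 1 + 2 = c.val + 1 by omega, show c.val - 1 + 1 = c by omega] at h1
        rw [h1]
        exact zero_mem _
      · rw [← map_mul]
        refine Submodule.subset_span (Or.inr ?_)
        rw [show n + 1 - c.val = n + 1 - (c.val + 1) + 1 by omega, neg, neg, chain_succ]
        rw [show n - (0 + (n + 1 - (c.val + 1))) = c.val by omega]
        rfl

theorem spans_start (hn : 1 ≤ n) (a : Fin (n + 1) ⊕ Fin (n + 1))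
    (ha : (cycle n).double.tail a = 0) :
    radMk (cycle n) {0, k} (arrow (cycle n) a) ∈ spans k ((cycle n).double.head a) := by
  rcases a with c | c
  · obtain rfl : c = 0 := ha
    have hh := head_inl_val (c := (0 : Fin (n + 1))) hn
    rw [spans, if_neg (fun h => by simp [h] at hh), hh]
    refine Submodule.subset_span (Or.inl ?_)
    rw [← fwd_val, Fin.val_zero, zero_add, pos, chain_one]
  · have hc : c = Fin.last n := by
      by_contra hc
      have hh := head_inl_val (c := c) (lt_of_le_of_ne (Nat.lt_succ_iff.1 c.2)
        fun h => hc (Fin.ext h))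
      change ((cycle n).double.tail (Sum.inr c)).val = _ at hh
      rw [ha] at hh
      simp at hh
    subst hc
    change _ ∈ spans k (Fin.last n)
    rw [spans, if_neg (fun h => by simp [Fin.ext_iff] at h; omega)]
    refine Submodule.subset_span (Or.inr ?_)
    rw [← bwd_val, Fin.val_last, show n + 1 - n = 1 by omega, neg, chain_one]
    rfl

section Rep

variable (k) in
/-- A representation with two linearly independent paths from `0` to `k`. -/
def repMat : Fin (n + 1) ⊕ Fin (n + 1) → Matrix (Fin 2) (Fin 2) ℂ
  | Sum.inl c => if c.val < k.val then mUnit 0 0 else 0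
  | Sum.inr c => if c.val < k.val then 0 else if c.val = n then mUnit 0 1 else mUnit 1 1

/-- Edges below `k` act only forwards and the others only backwards, so every product of an arrow
with its reverse is zero. -/
theorem repMat_relation (v : Fin (n + 1)) :
    ∑ c, (if (cycle n).tail c = v then repMat k (Sum.inl c) * repMat k (Sum.inr c) else 0) =
      ∑ c, (if (cycle n).head c = v then repMat k (Sum.inr c) * repMat k (Sum.inl c) else 0) := by
  have h1 : ∀ c, repMat k (Sum.inl c) * repMat k (Sum.inr c) = 0 := fun c => by
    by_cases h : c.val < k.val <;> simp [repMat, h]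
  have h2 : ∀ c, repMat k (Sum.inr c) * repMat k (Sum.inl c) = 0 := fun c => by
    by_cases h : c.val < k.val <;> simp [repMat, h]
  simp [h1, h2]

/-- All arrows out of `k` and all arrows into `0` act as zero. -/
theorem repMat_mul (hk : k ≠ 0) (a b : Fin (n + 1) ⊕ Fin (n + 1))
    (ha : (cycle n).double.head a ∈ ({0, k} : Finset (Fin (n + 1))))
    (hab : (cycle n).double.head a = (cycle n).double.tail b) : repMat k a * repMat k b = 0 := by
  rw [Finset.mem_insert, Finset.mem_singleton] at ha
  have step : ∀ c : Fin (n + 1), (cycle n).double.head (Sum.inl c) = k → c.val < k.val := by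
    intro c hc
    rcases Nat.lt_or_ge c.val n with h | h
    · rw [← hc, head_inl_val h]
      exact Nat.lt_succ_self _
    · exact absurd (hc.symm.trans (head_inl_last (by omega))) hk
  rcases a with c | c
  · by_cases hc : c.val < k.val
    · have hh := head_inl_val (c := c) (by omega)
      have hck : (cycle n).double.head (Sum.inl c) = k :=
        ha.resolve_left fun h => by simp [h] at hh
      rw [hck] at hab
      rcases b with c' | c'
      · obtain rfl : k = c' := hab
        simp [repMat]
      · simp [repMat, step c' hab.symm]
    · simp [repMat, hc]
  · rcases (ha : c = 0 ∨ c = k) with rfl | rfl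
    · have hkpos : 0 < k.val := Nat.pos_of_ne_zero fun h => hk (Fin.ext h)
      simp [repMat, hkpos]
    · rcases b with c' | c'
      · obtain rfl : c = c' := hab
        simp [repMat]
      · simp [repMat, step c' hab.symm]

theorem rep_fwd {i : ℕ} (hi : i < k.val) : rep (repMat k) repMat_relation (fwd n i) =
    Matrix.single ⟨i, by omega⟩ ⟨i + 1, by omega⟩ (mUnit 0 0) := by
  have h1 : (cycle n).double.head (Sum.inl ⟨i, by omega⟩) = ⟨i + 1, by omega⟩ :=
    Fin.ext (head_inl_val (c := ⟨i, by omega⟩) (by simp; omega))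
  rw [show fwd n i = _ from fwd_val ⟨i, by omega⟩, rep_arrow, h1]
  simp only [repMat, hi, if_true]
  rfl

theorem rep_bwd {i : ℕ} (hi : k.val ≤ i) (hin : i < n) :
    rep (repMat k) repMat_relation (bwd n i) =
      Matrix.single ⟨i + 1, by omega⟩ ⟨i, by omega⟩ (mUnit 1 1) := by
  have h1 : (cycle n).double.tail (Sum.inr ⟨i, by omega⟩) = ⟨i + 1, by omega⟩ :=
    Fin.ext (head_inl_val (c := ⟨i, by omega⟩) hin)
  rw [show bwd n i = _ from bwd_val ⟨i, by omega⟩, rep_arrow, h1]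
  simp only [repMat, hi.not_gt, hin.ne, if_false]
  rfl

theorem rep_bwd_last : rep (repMat k) repMat_relation (bwd n n) =
    Matrix.single 0 (Fin.last n) (mUnit 0 1) := by
  have h1 : (cycle n).double.tail (Sum.inr (Fin.last n)) = 0 := head_inl_last rfl
  rw [show bwd n n = _ from bwd_val (Fin.last n), rep_arrow, h1]
  simp only [repMat, Fin.val_last, (Nat.lt_succ_iff.1 k.2).not_gt, if_true, if_false]
  rfl

theorem rep_pos {d : ℕ} (hd : d < k.val) :
    rep (repMat k) repMat_relation (pos n (d + 1)) =
      Matrix.single 0 ⟨d + 1, by omega⟩ (mUnit 0 0) := by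
  induction d with
  | zero => rw [pos, chain_one, rep_fwd hd]; rfl
  | succ d ih =>
    rw [pos, chain_succ, map_mul, ← pos, ih (by omega), zero_add, rep_fwd hd,
      Matrix.single_mul_single_same, Matrix.single_mul_single_same, one_mul]

theorem rep_neg {d : ℕ} (hd : d < n + 1 - k.val) :
    rep (repMat k) repMat_relation (neg n (d + 1)) =
      Matrix.single 0 ⟨n - d, by omega⟩ (mUnit 0 1) := by
  induction d with
  | zero => rw [neg, chain_one]; exact rep_bwd_last
  | succ d ih =>
    have h1 : (⟨n - d, by omega⟩ : Fin (n + 1)) = ⟨n - (d + 1) + 1, by omega⟩ := by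
      ext; simp; omega
    rw [neg, chain_succ, map_mul, ← neg, ih (by omega), zero_add, rep_bwd (by omega) (by omega),
      h1, Matrix.single_mul_single_same, Matrix.single_mul_single_same, one_mul]

end Rep

end cycle

open cycle in
/-- The basis for the cycle. -/
def arrowBasisCycle {n : ℕ} (hn : 1 ≤ n) (k : Fin (n + 1)) (hk : k ≠ 0) {δ : Prop} (hδ : δ) :
    ArrowBasis (cycle n) 0 k δ where
  p₁ := pos n k
  p₂ := neg n (n + 1 - k)
  q := fwd n 0 * bwd n 0
  p₁_mem := by
    have hkpos : 0 < k.val := Nat.pos_of_ne_zero fun h => hk (Fin.ext h)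
    rw [show k.val = k.val - 1 + 1 by omega, pos, chain_succ,
      show 0 + (k.val - 1) = ((⟨k.val - 1, by omega⟩ : Fin (n + 1)) : ℕ) by simp, fwd_val]
    exact mul_mem_posPart_left _ (arrow_mem_posPart _ _)
  p₂_mem := by
    rw [show n + 1 - k.val = n - k.val + 1 by omega, neg, chain_succ,
      show n - (0 + (n - k.val)) = k.val by omega, bwd_val]
    exact mul_mem_posPart_left _ (arrow_mem_posPart _ _)
  span_eq z hz := by
    have h := map_mem_of_closed _ (radMk (cycle n) {0, k}) 0 (spans k) (spans_start hn)
      (spans_closed hk) hz k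
    rwa [spans, if_neg hk] at h
  span_zero z hz := by
    have h := map_mem_of_closed _ (radMk (cycle n) {0, k}) 0 (spans k) (spans_start hn)
      (spans_closed hk) hz 0
    rwa [spans, if_pos rfl] at h
  eq_zero h := absurd hδ h
  factor _ l hl0 hlk := by
    rcases lt_or_gt_of_ne hlk with h | h
    · exact Or.inl (radMk_pos_eq_zero (l := l) (by simp) hl0 h)
    · exact Or.inr (radMk_neg_eq_zero (l := l) (by simp) hl0 (by omega))
  indep _ := by
    have hkpos : 0 < k.val := Nat.pos_of_ne_zero fun h => hk (Fin.ext h)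
    refine linearIndependent_of_rep (x₁ := mUnit 0 0) (x₂ := mUnit 0 1) repMat_relation
      (repMat_mul hk) ?_ ?_ (linearIndependent_mUnit (by decide))
    · have h := rep_pos (show k.val - 1 < k.val by omega)
      simpa only [show k.val - 1 + 1 = k.val by omega] using h
    · have h := rep_neg (k := k) (show n - k.val < n + 1 - k.val by omega)
      simpa only [show n - k.val + 1 = n + 1 - k.val by omega,
        show n - (n - k.val) = k.val by omega] using h

theorem radMk_arrow_mul {V E : Type} [Fintype V] [Fintype E] {Q : ArrowQuiver V E} {I : Finset V}
    {a : E ⊕ E} (ha : Q.double.head a ∈ I) {z : Preproj Q} (hz : z ∈ posPart Q) :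
    radMk Q I (arrow Q a) * radMk Q I z = 0 := by
  rw [← map_mul, radMk_eq_zero, ← mul_idem_head Q a]
  exact Ideal.subset_span ⟨_, ha, _, arrow_mem_posPart Q a, _, hz, rfl⟩

/-! ### Type `D̃ₙ`: the relations and how loops move along the chain -/

/-- The quiver of type `D̃ₙ`: the chain `2, …, n - 2` with two more vertices at each end. -/
def fork (n : ℕ) (hn : 4 ≤ n) : ArrowQuiver (Fin (n + 1)) (Fin n) where
  tail := fun k => if k.val = n - 1 then ⟨n - 2, by omega⟩ else ⟨k.val, by omega⟩
  head := fun k => if k.val = 0 then ⟨2, by omega⟩ else ⟨k.val + 1, by omega⟩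

namespace fork

variable {n : ℕ} (hn : 4 ≤ n)

theorem tail_val (c : Fin n) :
    ((fork n hn).tail c).val = if c.val = n - 1 then n - 2 else c.val := by
  simp only [fork]
  split_ifs <;> rfl

theorem head_val (c : Fin n) :
    ((fork n hn).head c).val = if c.val = 0 then 2 else c.val + 1 := by
  simp only [fork]
  split_ifs <;> rfl

section Sums

variable {M : Type} [AddCommMonoid M] (g : ℕ → M)

theorem sum_tail {v : Fin (n + 1)} (hv : v.val + 3 ≤ n) :
    ∑ c : Fin n, (if (fork n hn).tail c = v then g c else 0) = g v := by
  rw [← Finset.sum_filter, show Finset.filter (fun c => (fork n hn).tail c = v) Finset.univ =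
    {⟨v.val, by omega⟩} from ?_, Finset.sum_singleton]
  ext c
  simp only [Finset.mem_filter, Finset.mem_univ, true_and, Finset.mem_singleton, Fin.ext_iff,
    tail_val]
  split_ifs <;> omega

theorem sum_tail_branch {v : Fin (n + 1)} (hv : v.val + 2 = n) :
    ∑ c : Fin n, (if (fork n hn).tail c = v then g c else 0) = g (n - 2) + g (n - 1) := by
  rw [← Finset.sum_filter, show Finset.filter (fun c => (fork n hn).tail c = v) Finset.univ =
    {⟨n - 2, by omega⟩, ⟨n - 1, by omega⟩} from ?_, Finset.sum_pair (by simp; omega)]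
  ext c
  simp only [Finset.mem_filter, Finset.mem_univ, true_and, Finset.mem_singleton, Fin.ext_iff,
    tail_val, Finset.mem_insert]
  split_ifs <;> omega

theorem sum_tail_end {v : Fin (n + 1)} (hv : n < v.val + 2) :
    ∑ c : Fin n, (if (fork n hn).tail c = v then g c else 0) = 0 := by
  refine Finset.sum_eq_zero fun c _ => if_neg ?_
  rw [Fin.ext_iff, tail_val]
  split_ifs <;> omega

theorem sum_head_end {v : Fin (n + 1)} (hv : v.val < 2) :
    ∑ c : Fin n, (if (fork n hn).head c = v then g c else 0) = 0 := by
  refine Finset.sum_eq_zero fun c _ => if_neg ?_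
  rw [Fin.ext_iff, head_val]
  split_ifs <;> omega

theorem sum_head_branch {v : Fin (n + 1)} (hv : v.val = 2) :
    ∑ c : Fin n, (if (fork n hn).head c = v then g c else 0) = g 0 + g 1 := by
  rw [← Finset.sum_filter, show Finset.filter (fun c => (fork n hn).head c = v) Finset.univ =
    {⟨0, by omega⟩, ⟨1, by omega⟩} from ?_, Finset.sum_pair (by simp)]
  ext c
  simp only [Finset.mem_filter, Finset.mem_univ, true_and, Finset.mem_singleton, Fin.ext_iff,
    head_val, Finset.mem_insert]
  split_ifs <;> omega

theorem sum_head {v : Fin (n + 1)} (hv : 2 < v.val) :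
    ∑ c : Fin n, (if (fork n hn).head c = v then g c else 0) = g (v - 1) := by
  rw [← Finset.sum_filter, show Finset.filter (fun c => (fork n hn).head c = v) Finset.univ =
    {⟨v.val - 1, by omega⟩} from ?_, Finset.sum_singleton]
  ext c
  simp only [Finset.mem_filter, Finset.mem_univ, true_and, Finset.mem_singleton, Fin.ext_iff,
    head_val]
  split_ifs <;> omega

end Sums

/-- The arrow that belongs to the edge `i`. -/
def fwd (i : ℕ) : Preproj (fork n hn) :=
  if h : i < n then arrow (fork n hn) (Sum.inl ⟨i, h⟩) else 0

/-- The reversed arrow that belongs to the edge `i`. -/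
def bwd (i : ℕ) : Preproj (fork n hn) :=
  if h : i < n then arrow (fork n hn) (Sum.inr ⟨i, h⟩) else 0

theorem fwd_val (c : Fin n) : fwd hn c = arrow (fork n hn) (Sum.inl c) := dif_pos c.2

theorem bwd_val (c : Fin n) : bwd hn c = arrow (fork n hn) (Sum.inr c) := dif_pos c.2

theorem fwd_mem (i : ℕ) : fwd hn i ∈ posPart (fork n hn) := by
  rw [fwd]
  split_ifs
  · exact arrow_mem_posPart _ _
  · exact zero_mem _

theorem bwd_mem (i : ℕ) : bwd hn i ∈ posPart (fork n hn) := by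
  rw [bwd]
  split_ifs
  · exact arrow_mem_posPart _ _
  · exact zero_mem _

/-- The step back along the chain from the vertex `v`, and forth again. -/
def loopBack {R : Type} [Ring R] (F G : ℕ → R) (v : ℕ) : R :=
  if v = 2 then G 0 * F 0 + G 1 * F 1 else G (v - 1) * F (v - 1)

/-- The relations of the preprojective algebra of type `D̃ₙ`. -/
structure Rel {R : Type} [Ring R] (n : ℕ) (F G : ℕ → R) : Prop where
  zero : F 0 * G 0 = 0
  one : F 1 * G 1 = 0
  mid : ∀ i, 2 ≤ i → i + 3 ≤ n → F i * G i = loopBack F G i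
  branch : F (n - 2) * G (n - 2) + F (n - 1) * G (n - 1) = loopBack F G (n - 2)
  last : G (n - 2) * F (n - 2) = 0
  last' : G (n - 1) * F (n - 1) = 0

/-- The relations are kept for an arbitrary ring: they are extracted here for `Π` and pushed to its
quotients, and the converse `vertex_of_rel` is what makes explicit matrices into representations. -/
theorem rel_of_vertex {R : Type} [Ring R] {F G : ℕ → R}
    (h : ∀ v, ∑ c : Fin n, (if (fork n hn).tail c = v then F c * G c else 0) =
      ∑ c : Fin n, (if (fork n hn).head c = v then G c * F c else 0)) : Rel n F G where
  zero := by
    have h := h ⟨0, by omega⟩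
    rwa [sum_tail hn (fun i => F i * G i) (by simp; omega),
      sum_head_end hn (fun i => G i * F i) (by simp)] at h
  one := by
    have h := h ⟨1, by omega⟩
    rwa [sum_tail hn (fun i => F i * G i) (by simp; omega),
      sum_head_end hn (fun i => G i * F i) (by simp)] at h
  mid i hi hin := by
    have h := h ⟨i, by omega⟩
    rw [sum_tail hn (fun i => F i * G i) (by simp; omega)] at h
    rw [loopBack]
    split_ifs with h2
    · rwa [sum_head_branch hn (fun i => G i * F i) h2] at h
    · rwa [sum_head hn (fun i => G i * F i) (by simp; omega)] at h
  branch := by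
    have h := h ⟨n - 2, by omega⟩
    rw [sum_tail_branch hn (fun i => F i * G i) (by simp; omega)] at h
    rw [loopBack]
    split_ifs with h2
    · rwa [sum_head_branch hn (fun i => G i * F i) h2] at h
    · rwa [sum_head hn (fun i => G i * F i) (by simp; omega)] at h
  last := by
    have h := h ⟨n - 1, by omega⟩
    rw [sum_tail_end hn (fun i => F i * G i) (by simp; omega),
      sum_head hn (fun i => G i * F i) (by simp; omega)] at h
    exact h.symm
  last' := by
    have h := h ⟨n, by omega⟩
    rw [sum_tail_end hn (fun i => F i * G i) (by simp),
      sum_head hn (fun i => G i * F i) (by simp; omega)] at h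
    exact h.symm

theorem vertex_of_rel {R : Type} [Ring R] {F G : ℕ → R} (h : Rel n F G) (v : Fin (n + 1)) :
    ∑ c : Fin n, (if (fork n hn).tail c = v then F c * G c else 0) =
      ∑ c : Fin n, (if (fork n hn).head c = v then G c * F c else 0) := by
  have hv := v.2
  rcases lt_trichotomy (v.val + 2) n with h1 | h1 | h1
  · rw [sum_tail hn (fun i => F i * G i) h1]
    rcases Nat.lt_or_ge v.val 2 with h2 | h2
    · rw [sum_head_end hn (fun i => G i * F i) h2]
      interval_cases v.val
      · exact h.zero
      · exact h.one
    · rw [h.mid v h2 h1, loopBack]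
      split_ifs with h3
      · rw [sum_head_branch hn (fun i => G i * F i) h3]
      · rw [sum_head hn (fun i => G i * F i) (by omega)]
  · rw [sum_tail_branch hn (fun i => F i * G i) h1, h.branch, loopBack]
    split_ifs with h3
    · rw [sum_head_branch hn (fun i => G i * F i) (by omega)]
    · rw [sum_head hn (fun i => G i * F i) (by omega), show n - 2 = v.val by omega]
  · rw [sum_tail_end hn (fun i => F i * G i) h1, sum_head hn (fun i => G i * F i) (by omega)]
    rcases Nat.lt_or_ge v.val n with h2 | h2
    · rw [show v.val - 1 = n - 2 by omega, h.last]
    · rw [show v.val - 1 = n - 1 by omega, h.last']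

theorem rel_preproj : Rel n (fwd hn) (bwd hn) := by
  refine rel_of_vertex hn fun v => ?_
  simpa only [fwd_val, bwd_val] using vertex_relation (fork n hn) v

theorem Rel.map {R R' : Type} [Ring R] [Ring R'] {F G : ℕ → R} (h : Rel n F G) (φ : R →+* R') :
    Rel n (fun i => φ (F i)) (fun i => φ (G i)) := by
  have hl : ∀ v, loopBack (fun i => φ (F i)) (fun i => φ (G i)) v = φ (loopBack F G v) := by
    intro v
    simp only [loopBack]
    split_ifs <;> simp only [map_add, map_mul]
  refine ⟨?_, ?_, fun i h2 h3 => ?_, ?_, ?_, ?_⟩ <;>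
  simp only [hl, ← map_mul, ← map_add, h.zero, h.one, h.branch, h.last, h.last', map_zero]
  rw [h.mid i h2 h3]

section Chain

variable {R : Type} [Ring R] {F G : ℕ → R} (h : Rel n F G)
include h

/-- At an inner vertex of the chain the loop backwards equals the loop forwards, so a loop moves
freely between the two branching vertices. -/
theorem chain_mul_loopBack {d : ℕ} (hd : d + 4 ≤ n) :
    chain F 2 d * loopBack F G (2 + d) = loopBack F G 2 * chain F 2 d := by
  induction d with
  | zero => rw [chain_zero, mul_one, one_mul]
  | succ d ih =>
    rw [chain_succ, ← mul_assoc (loopBack F G 2), ← ih (by omega),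
      ← h.mid (2 + d) (by omega) (by omega), loopBack, if_neg (by omega),
      show 2 + (d + 1) - 1 = 2 + d by omega]
    simp only [mul_assoc]

theorem chain_succ_mul_back {d : ℕ} (hd : d + 5 ≤ n) :
    chain F 2 (d + 1) * G (2 + d) = loopBack F G 2 * chain F 2 d := by
  rw [chain_succ, mul_assoc, h.mid _ (by omega) (by omega), chain_mul_loopBack h (by omega)]

/-- The loop at the vertex `2`, moved to `n - 2`, splits there into the loops through the two far
leaves. -/
theorem chain_mul_branch (hn : 4 ≤ n) :
    chain F 2 (n - 4) * F (n - 2) * G (n - 2) + chain F 2 (n - 4) * F (n - 1) * G (n - 1) =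
      loopBack F G 2 * chain F 2 (n - 4) := by
  rw [mul_assoc, mul_assoc, ← mul_add, h.branch, show n - 2 = 2 + (n - 4) by omega,
    chain_mul_loopBack h (by omega)]

end Chain

section Quot

variable {I : Finset (Fin (n + 1))}

theorem rel_radMk (I : Finset (Fin (n + 1))) :
    Rel n (fun i => radMk (fork n hn) I (fwd hn i)) (fun i => radMk (fork n hn) I (bwd hn i)) :=
  (rel_preproj hn).map (radMk (fork n hn) I).toRingHom

theorem fwd_mul {i l : ℕ} (hi : i < n) (hl : l = if i = 0 then 2 else i + 1)
    (h : ∀ v : Fin (n + 1), v.val = l → v ∈ I) {z : Preproj (fork n hn)}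
    (hz : z ∈ posPart (fork n hn)) :
    radMk (fork n hn) I (fwd hn i) * radMk (fork n hn) I z = 0 := by
  rw [show fwd hn i = _ from fwd_val hn ⟨i, hi⟩]
  refine radMk_arrow_mul (h _ ?_) hz
  change ((fork n hn).head _).val = _
  rw [head_val, hl]

theorem bwd_mul {i l : ℕ} (hi : i < n) (hl : l = if i = n - 1 then n - 2 else i)
    (h : ∀ v : Fin (n + 1), v.val = l → v ∈ I) {z : Preproj (fork n hn)}
    (hz : z ∈ posPart (fork n hn)) :
    radMk (fork n hn) I (bwd hn i) * radMk (fork n hn) I z = 0 := by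
  rw [show bwd hn i = _ from bwd_val hn ⟨i, hi⟩]
  refine radMk_arrow_mul (h _ ?_) hz
  change ((fork n hn).tail _).val = _
  rw [tail_val, hl]

/-- The vertex `l` of `I` is met inside the chain or exactly at its end; in the latter case the
factor `z` is needed to make `l` an inner vertex. -/
theorem chain_mul_radMk_eq_zero {l d : ℕ} (hl : 3 ≤ l) (hln : l + 2 ≤ n)
    (h : ∀ v : Fin (n + 1), v.val = l → v ∈ I) (hd : l ≤ d + 2) {z : Preproj (fork n hn)}
    (hz : z ∈ posPart (fork n hn)) :
    chain (fun i => radMk (fork n hn) I (fwd hn i)) 2 d * radMk (fork n hn) I z = 0 := by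
  obtain ⟨d, rfl⟩ : ∃ d', d = d' + 1 := ⟨d - 1, by omega⟩
  rcases Nat.lt_or_ge l (d + 3) with h1 | h1
  · rw [chain_eq_zero (i := l - 1) (fwd_mul hn (l := l) (by omega) (by split_ifs <;> omega) h
      (fwd_mem hn _)) (by omega) (by omega), zero_mul]
  · rw [chain_succ, mul_assoc, fwd_mul hn (l := l) (by omega) (by split_ifs <;> omega) h hz,
      mul_zero]

end Quot

end fork

/-! ### Type `D̃ₙ`: the vertices `k ≥ 3` -/

namespace fork

variable {n : ℕ} (hn : 4 ≤ n)

theorem closed_of {R : Type} [Ring R] [Algebra ℂ R] (φ : Preproj (fork n hn) →ₐ[ℂ] R)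
    {S : ℕ → Submodule ℂ R}
    (h : ∀ i t u, i < n → t = (if i = n - 1 then n - 2 else i) → u = (if i = 0 then 2 else i + 1) →
      (∀ s ∈ S t, s * φ (fwd hn i) ∈ S u) ∧ (∀ s ∈ S u, s * φ (bwd hn i) ∈ S t))
    (a : Fin n ⊕ Fin n) : ∀ s ∈ S ((fork n hn).double.tail a).val,
      s * φ (arrow (fork n hn) a) ∈ S ((fork n hn).double.head a).val := by
  rcases a with c | c
  · rw [← fwd_val]
    exact (h c _ _ c.2 (tail_val hn c) (head_val hn c)).1
  · rw [← bwd_val]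
    exact (h c _ _ c.2 (tail_val hn c) (head_val hn c)).2

theorem start_of {R : Type} [Ring R] [Algebra ℂ R] (φ : Preproj (fork n hn) →ₐ[ℂ] R)
    {S : ℕ → Submodule ℂ R} (h : φ (fwd hn 0) ∈ S 2) (a : Fin n ⊕ Fin n)
    (ha : (fork n hn).double.tail a = 0) :
    φ (arrow (fork n hn) a) ∈ S ((fork n hn).double.head a).val := by
  rcases a with c | c
  · have h1 := tail_val hn c
    have h2 : (fork n hn).tail c = 0 := ha
    have h3 : c.val = 0 := by
      rw [h2, Fin.val_zero] at h1
      split_ifs at h1 <;> omega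
    have h4 : ((fork n hn).double.head (Sum.inl c)).val = 2 := by
      change ((fork n hn).head c).val = 2
      rw [head_val, if_pos h3]
    rw [← fwd_val, h3, h4]
    exact h
  · have h1 := head_val hn c
    have h2 : (fork n hn).head c = 0 := ha
    rw [h2, Fin.val_zero] at h1
    split_ifs at h1

section FarEnd

variable {R : Type} [Ring R] [Algebra ℂ R] (n) (F G : ℕ → R)

/-- The straight path from the vertex `2` to the vertex `v`. -/
def toFar {A : Type} [Monoid A] (n : ℕ) (F : ℕ → A) (v : ℕ) : A :=
  if v = n then chain F 2 (n - 4) * F (n - 1) else chain F 2 (v - 2)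

/-- The spans of the paths from `0`, in the case that `k` is at least `3`. -/
def farSpan (v : ℕ) : Submodule ℂ R :=
  if v = 0 then Submodule.span ℂ {F 0 * (G 1 * F 1) * G 0}
  else if v = 1 then Submodule.span ℂ {F 0 * G 1}
  else Submodule.span ℂ {F 0 * toFar n F v, F 0 * (G 1 * F 1) * toFar n F v}

variable {n F G}

theorem toFar_sub_two {A : Type} [Monoid A] (hn : 4 ≤ n) (F : ℕ → A) :
    toFar n F (n - 2) = chain F 2 (n - 4) := by
  rw [toFar, if_neg (by omega), show n - 2 - 2 = n - 4 by omega]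

theorem toFar_two {A : Type} [Monoid A] (hn : 4 ≤ n) (F : ℕ → A) : toFar n F 2 = 1 := by
  rw [toFar, if_neg (by omega), chain_zero]

theorem toFar_mul {A : Type} [Monoid A] (hn : 4 ≤ n) (F : ℕ → A) {i t u : ℕ} (hi : 2 ≤ i)
    (hi' : i < n) (ht : t = if i = n - 1 then n - 2 else i) (hu : u = if i = 0 then 2 else i + 1) :
    toFar n F t * F i = toFar n F u := by
  rw [if_neg (by omega)] at hu
  subst hu
  split_ifs at ht with h3
  · rw [ht, toFar_sub_two hn, toFar, if_pos (by omega), h3]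
  · rw [ht, toFar, if_neg (by omega), toFar, if_neg (by omega),
      show i + 1 - 2 = i - 2 + 1 by omega, chain_succ, show 2 + (i - 2) = i by omega]

/-- Put `y = G 1 * F 1`. Since `G 0 * F 0 = 0`, `y` is the whole backward loop at `2`, and `F 1 * G
1 = 0` gives `y² = 0`. Any step back beyond `2` amounts, up to a scalar, to inserting `y` at the
vertex `2`, so a second one gives zero. The scalars in `hc` and `hc'` hide which of the far loops is
killed by `k`. -/
theorem farSpan_closed (hn : 4 ≤ n) (h : Rel n F G) (h0 : G 0 * F 0 = 0)
    (hc : ∃ c : ℂ, chain F 2 (n - 4) * F (n - 2) * G (n - 2) =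
      c • (G 1 * F 1 * chain F 2 (n - 4)))
    (hc' : ∃ c : ℂ, chain F 2 (n - 4) * F (n - 1) * G (n - 1) =
      c • (G 1 * F 1 * chain F 2 (n - 4)))
    {i t u : ℕ} (hi : i < n) (ht : t = if i = n - 1 then n - 2 else i)
    (hu : u = if i = 0 then 2 else i + 1) :
    (∀ s ∈ farSpan n F G t, s * F i ∈ farSpan n F G u) ∧
      (∀ s ∈ farSpan n F G u, s * G i ∈ farSpan n F G t) := by
  have hlast := toFar_sub_two hn F
  have htwo := toFar_two hn F
  have hyy : F 1 * (G 1 * F 1) = 0 := by rw [← mul_assoc, h.one, zero_mul]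
  rcases Nat.lt_or_ge i 2 with h2 | h2
  · interval_cases i
    · rw [if_neg (by omega)] at ht
      rw [if_pos rfl] at hu
      subst ht hu
      rw [farSpan, if_pos rfl, farSpan, if_neg (by decide), if_neg (by decide), htwo]
      constructor <;> intro s hs <;> refine mul_mem_of_span ?_ hs
      · rintro x rfl
        rw [mul_assoc _ (G 0), h0, mul_zero]
        exact zero_mem _
      · rintro x (rfl | rfl)
        · rw [mul_one, h.zero]
          exact zero_mem _
        · rw [mul_one]
          exact Submodule.subset_span rfl
    · rw [if_neg (by omega)] at ht
      rw [if_neg (by omega)] at hu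
      subst ht hu
      rw [farSpan, if_neg (by decide), if_pos rfl, farSpan, if_neg (by decide),
        if_neg (by decide), htwo]
      constructor <;> intro s hs <;> refine mul_mem_of_span ?_ hs
      · rintro x rfl
        refine Submodule.subset_span (Or.inr ?_)
        simp only [mul_one, mul_assoc, Set.mem_singleton_iff]
      · rintro x (rfl | rfl)
        · rw [mul_one]
          exact Submodule.subset_span rfl
        · rw [mul_one, mul_assoc, mul_assoc, h.one, mul_zero, mul_zero]
          exact zero_mem _
  · have hfwd := toFar_mul hn F h2 hi ht hu
    -- The scalar is `1` inside the chain; at the two far leaves it comes from `hc` and `hc'`.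
    have hbwd : ∃ c : ℂ, toFar n F u * G i = c • (G 1 * F 1 * toFar n F t) := by
      rw [← hfwd]
      split_ifs at ht with h3
      · rw [ht, hlast, h3]
        exact hc'
      · subst ht
        rcases Nat.lt_or_ge (t + 2) n with h4 | h4
        · refine ⟨1, ?_⟩
          have h5 := chain_succ_mul_back h (show t - 2 + 5 ≤ n by omega)
          rw [loopBack, if_pos rfl, h0, zero_add, chain_succ, show 2 + (t - 2) = t by omega] at h5
          rw [one_smul, toFar, if_neg (by omega), h5]
        · rw [show t = n - 2 by omega, hlast]
          exact hc
    obtain ⟨c, hbwd⟩ := hbwd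
    rw [farSpan, if_neg (by split_ifs at ht <;> omega), if_neg (by split_ifs at ht <;> omega),
      farSpan, if_neg (by split_ifs at hu <;> omega), if_neg (by split_ifs at hu <;> omega)]
    constructor <;> intro s hs <;> refine mul_mem_of_span ?_ hs
    · rintro x (rfl | rfl)
      · exact Submodule.subset_span (Or.inl (by rw [mul_assoc, hfwd]))
      · exact Submodule.subset_span (Or.inr (by rw [mul_assoc _ _ (F i), hfwd]; rfl))
    · rintro x (rfl | rfl)
      · rw [mul_assoc _ _ (G i), hbwd, mul_smul_comm,
          ← mul_assoc (F 0) (G 1 * F 1)]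
        exact Submodule.smul_mem _ _ (Submodule.subset_span (Or.inr rfl))
      · have h5 : F 0 * (G 1 * F 1) * (G 1 * F 1 * toFar n F t) = 0 := by
          rw [mul_assoc (F 0), mul_assoc (G 1), ← mul_assoc (F 1), hyy, zero_mul, mul_zero,
            mul_zero]
        rw [mul_assoc _ _ (G i), hbwd, mul_smul_comm, h5, smul_zero]
        exact zero_mem _

end FarEnd

/-- A representation with two linearly independent paths from `0` to `k`, where `k` is `n - 1`
or `n`. -/
def farFwd (n k i : ℕ) : Matrix (Fin 2) (Fin 2) ℂ :=
  if i = 0 then mUnit 0 0 else if i = 1 then mUnit 0 1 else if i + 1 = k then 1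
  else if n ≤ i + 2 then mUnit 0 0 else 1

/-- The action of the reversed arrows in the representation. -/
def farBwd (k i : ℕ) : Matrix (Fin 2) (Fin 2) ℂ :=
  if i = 0 then 0 else if i = 1 then mUnit 0 0 else if i + 1 = k then 0 else mUnit 0 1

/-- Inside the chain arrows act as `1` and reversed arrows as `mUnit 0 1`, so each loop is the
nilpotent `mUnit 0 1`. At the far end only the leaf other than `k` carries this loop, because the
arrow out of `k` is zero. -/
theorem far_rel (hn : 4 ≤ n) {k : ℕ} (hk : n ≤ k + 1) (hkn : k ≤ n) :
    Rel n (farFwd n k) (farBwd k) := by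
  have h2 : loopBack (farFwd n k) (farBwd k) 2 = mUnit 0 1 := by
    simp [loopBack, farFwd, farBwd]
  have hmid : ∀ i, 2 ≤ i → i + 3 ≤ n → farFwd n k i = 1 ∧ farBwd k i = mUnit 0 1 := by
    intro i hi hin
    rw [farFwd, farBwd, if_neg (by omega), if_neg (by omega), if_neg (by omega), if_neg (by omega),
      if_neg (by omega), if_neg (by omega), if_neg (by omega)]
    exact ⟨rfl, rfl⟩
  have hloop : ∀ i, 2 ≤ i → i + 2 ≤ n → loopBack (farFwd n k) (farBwd k) i = mUnit 0 1 := by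
    intro i hi hin
    by_cases h : i = 2
    · rw [h, h2]
    · rw [loopBack, if_neg h, (hmid (i - 1) (by omega) (by omega)).1,
        (hmid (i - 1) (by omega) (by omega)).2, mul_one]
  have hend : ∀ i, 2 ≤ i → n ≤ i + 2 → i < n →
      (farFwd n k i * farBwd k i = if i + 1 = k then 0 else mUnit 0 1) ∧
      farBwd k i * farFwd n k i = 0 := by
    intro i hi hin hi'
    have e0 : i ≠ 0 := by omega
    have e1 : i ≠ 1 := by omega
    simp only [farFwd, farBwd, e0, e1, hin, if_false, if_true]
    split_ifs <;> simp
  refine ⟨by simp [farFwd, farBwd], by simp [farFwd, farBwd], ?_, ?_, ?_, ?_⟩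
  · intro i hi hin
    rw [hloop i hi (by omega), (hmid i hi hin).1, (hmid i hi hin).2, one_mul]
  · rw [hloop _ (by omega) (by omega), (hend _ (by omega) (by omega) (by omega)).1,
      (hend _ (by omega) (by omega) (by omega)).1]
    rcases Nat.lt_or_ge k n with h | h
    · rw [if_pos (by omega), if_neg (by omega), zero_add]
    · rw [if_neg (by omega), if_pos (by omega), add_zero]
  · exact (hend _ (by omega) (by omega) (by omega)).2
  · exact (hend _ (by omega) (by omega) (by omega)).2

/-- Elements of an algebra that correspond to the edges, as a function on the arrows. -/
def edgeRep {M : Type} (F G : ℕ → M) : Fin n ⊕ Fin n → M :=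
  Sum.elim (fun c => F c) (fun c => G c)

theorem edgeRep_relation {M : Type} [Ring M] {F G : ℕ → M} (h : Rel n F G) (v : Fin (n + 1)) :
    ∑ c : Fin n, (if (fork n hn).tail c = v then
        edgeRep F G (Sum.inl c) * edgeRep F G (Sum.inr c) else 0) =
      ∑ c : Fin n, (if (fork n hn).head c = v then
        edgeRep F G (Sum.inr c) * edgeRep F G (Sum.inl c) else 0) :=
  vertex_of_rel hn h v

theorem rep_fwd {M : Type} [Ring M] [Algebra ℂ M] {F G : ℕ → M} (h : Rel n F G) {i : ℕ}
    (hi : i < n) {t u : Fin (n + 1)} (ht : t.val = if i = n - 1 then n - 2 else i)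
    (hu : u.val = if i = 0 then 2 else i + 1) :
    rep (edgeRep F G) (edgeRep_relation hn h) (fwd hn i) = Matrix.single t u (F i) := by
  rw [show fwd hn i = _ from fwd_val hn ⟨i, hi⟩, rep_arrow]
  congr 1
  · exact Fin.ext ((tail_val hn _).trans ht.symm)
  · exact Fin.ext ((head_val hn _).trans hu.symm)

theorem rep_bwd {M : Type} [Ring M] [Algebra ℂ M] {F G : ℕ → M} (h : Rel n F G) {i : ℕ}
    (hi : i < n) {t u : Fin (n + 1)} (ht : t.val = if i = n - 1 then n - 2 else i)
    (hu : u.val = if i = 0 then 2 else i + 1) :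
    rep (edgeRep F G) (edgeRep_relation hn h) (bwd hn i) = Matrix.single u t (G i) := by
  rw [show bwd hn i = _ from bwd_val hn ⟨i, hi⟩, rep_arrow]
  congr 1
  · exact Fin.ext ((head_val hn _).trans hu.symm)
  · exact Fin.ext ((tail_val hn _).trans ht.symm)

theorem rep_chain {M : Type} [Ring M] [Algebra ℂ M] {F G : ℕ → M} (h : Rel n F G) {d : ℕ}
    (hd : d + 4 ≤ n + 1) {t u : Fin (n + 1)} (ht : t.val = 2) (hu : u.val = d + 2) (x : M) :
    Matrix.single (0 : Fin (n + 1)) t x * rep (edgeRep F G) (edgeRep_relation hn h) (chain (fwd hn) 2 d) =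
      Matrix.single 0 u (x * chain F 2 d) := by
  induction d generalizing u with
  | zero =>
    obtain rfl : t = u := Fin.ext (ht.trans hu.symm)
    rw [chain_zero, chain_zero, map_one, mul_one, mul_one]
  | succ d ih =>
    rw [chain_succ, map_mul, ← mul_assoc, ih (by omega) (u := ⟨d + 2, by omega⟩) rfl,
      rep_fwd hn h (i := 2 + d) (t := ⟨d + 2, by omega⟩) (u := u) (by omega)
        (by simp only; split_ifs <;> omega) (by split_ifs <;> omega),
      Matrix.single_mul_single_same, chain_succ, mul_assoc]

/-- Incidence is rephrased by natural numbers so that the vanishing can be decided by arithmetic on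
edge numbers. -/
theorem edgeRep_mul {M : Type} [Ring M] {F G : ℕ → M} {k : Fin (n + 1)}
    (hI : ∀ i j v, i < n → j < n → (v = 0 ∨ v = k.val) →
      ((v = (if i = 0 then 2 else i + 1) → v = (if j = n - 1 then n - 2 else j) → F i * F j = 0) ∧
      (v = (if i = 0 then 2 else i + 1) → v = (if j = 0 then 2 else j + 1) → F i * G j = 0) ∧
      (v = (if i = n - 1 then n - 2 else i) → v = (if j = n - 1 then n - 2 else j) →
        G i * F j = 0) ∧
      (v = (if i = n - 1 then n - 2 else i) → v = (if j = 0 then 2 else j + 1) → G i * G j = 0)))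
    (a b : Fin n ⊕ Fin n) (ha : (fork n hn).double.head a ∈ ({0, k} : Finset (Fin (n + 1))))
    (hab : (fork n hn).double.head a = (fork n hn).double.tail b) :
    edgeRep F G a * edgeRep F G b = 0 := by
  have hv : ((fork n hn).double.head a).val = 0 ∨ ((fork n hn).double.head a).val = k.val := by
    rw [Finset.mem_insert, Finset.mem_singleton] at ha
    exact ha.imp (fun h => by rw [h, Fin.val_zero]) (fun h => by rw [h])
  have hab' := congrArg Fin.val hab
  rcases a with c | c <;> rcases b with c' | c'
  · exact (hI c c' _ c.2 c'.2 hv).1 (head_val hn c) (hab'.trans (tail_val hn c'))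
  · exact (hI c c' _ c.2 c'.2 hv).2.1 (head_val hn c) (hab'.trans (head_val hn c'))
  · exact (hI c c' _ c.2 c'.2 hv).2.2.1 (tail_val hn c) (hab'.trans (tail_val hn c'))
  · exact (hI c c' _ c.2 c'.2 hv).2.2.2 (tail_val hn c) (hab'.trans (head_val hn c'))

end fork

namespace fork

variable {n : ℕ} (hn : 4 ≤ n)

theorem chain_mem {d : ℕ} (hd : 0 < d) : chain (fwd hn) 2 d ∈ posPart (fork n hn) := by
  obtain ⟨d, rfl⟩ : ∃ d', d = d' + 1 := ⟨d - 1, by omega⟩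
  exact mul_mem_posPart_left _ (fwd_mem hn _)

theorem toFar_mem {v : ℕ} (hv : 3 ≤ v) : toFar n (fwd hn) v ∈ posPart (fork n hn) := by
  rw [toFar]
  split_ifs
  · exact mul_mem_posPart_left _ (fwd_mem hn _)
  · exact chain_mem hn (by omega)

theorem map_toFar {A B F : Type} [Monoid A] [Monoid B] [FunLike F A B] [MonoidHomClass F A B]
    (φ : F) (f : ℕ → A) (v : ℕ) : φ (toFar n f v) = toFar n (fun i => φ (f i)) v := by
  rw [toFar, toFar]
  split_ifs
  · rw [map_mul, map_chain]
  · rw [map_chain]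

section

variable {I : Finset (Fin (n + 1))}

theorem mem_of_val {I : Finset (Fin (n + 1))} {v : Fin (n + 1)} (hv : v ∈ I) :
    ∀ u : Fin (n + 1), u.val = v.val → u ∈ I := fun u hu => by rwa [Fin.ext hu]

/-- The two far loops add up to the inserted loop. If `k` lies on the chain both are zero; if `k` is
a far leaf its own loop is zero and the other one is everything. -/
theorem far_branch {k : Fin (n + 1)} (h0 : 0 ∈ I) (hkI : k ∈ I) (hk : 3 ≤ k.val) :
    (∃ c : ℂ, chain (fun i => radMk (fork n hn) I (fwd hn i)) 2 (n - 4) *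
        radMk (fork n hn) I (fwd hn (n - 2)) * radMk (fork n hn) I (bwd hn (n - 2)) =
      c • (radMk (fork n hn) I (bwd hn 1) * radMk (fork n hn) I (fwd hn 1) *
        chain (fun i => radMk (fork n hn) I (fwd hn i)) 2 (n - 4))) ∧
    (∃ c : ℂ, chain (fun i => radMk (fork n hn) I (fwd hn i)) 2 (n - 4) *
        radMk (fork n hn) I (fwd hn (n - 1)) * radMk (fork n hn) I (bwd hn (n - 1)) =
      c • (radMk (fork n hn) I (bwd hn 1) * radMk (fork n hn) I (fwd hn 1) *
        chain (fun i => radMk (fork n hn) I (fwd hn i)) 2 (n - 4))) := by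
  have hkn := k.2
  have hb := chain_mul_branch (rel_radMk hn I) hn
  have hl : loopBack (fun i => radMk (fork n hn) I (fwd hn i))
      (fun i => radMk (fork n hn) I (bwd hn i)) 2 =
      radMk (fork n hn) I (bwd hn 1) * radMk (fork n hn) I (fwd hn 1) := by
    rw [loopBack, if_pos rfl, bwd_mul hn (l := 0) (by omega) (by split_ifs <;> omega)
      (fun v hv => mem_of_val h0 v hv) (fwd_mem hn _), zero_add]
  rw [hl] at hb
  rcases Nat.lt_or_ge k.val (n - 1) with h1 | h1
  · have hz : ∀ z ∈ posPart (fork n hn), chain (fun i => radMk (fork n hn) I (fwd hn i)) 2 (n - 4) *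
        radMk (fork n hn) I z = 0 := fun z hz =>
      chain_mul_radMk_eq_zero hn hk (by omega) (mem_of_val hkI) (by omega) hz
    exact ⟨⟨0, by rw [hz _ (fwd_mem hn _), zero_mul, zero_smul]⟩,
      ⟨0, by rw [hz _ (fwd_mem hn _), zero_mul, zero_smul]⟩⟩
  rcases Nat.lt_or_ge k.val n with h2 | h2
  · have hz : chain (fun i => radMk (fork n hn) I (fwd hn i)) 2 (n - 4) *
        radMk (fork n hn) I (fwd hn (n - 2)) * radMk (fork n hn) I (bwd hn (n - 2)) = 0 := by
      rw [mul_assoc, fwd_mul hn (l := k) (by omega) (by split_ifs <;> omega) (mem_of_val hkI)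
        (bwd_mem hn _), mul_zero]
    rw [hz, zero_add] at hb
    exact ⟨⟨0, by rw [hz, zero_smul]⟩, ⟨1, by rw [hb, one_smul]⟩⟩
  · have hz : chain (fun i => radMk (fork n hn) I (fwd hn i)) 2 (n - 4) *
        radMk (fork n hn) I (fwd hn (n - 1)) * radMk (fork n hn) I (bwd hn (n - 1)) = 0 := by
      rw [mul_assoc, fwd_mul hn (l := k) (by omega) (by split_ifs <;> omega) (mem_of_val hkI)
        (bwd_mem hn _), mul_zero]
    rw [hz, add_zero] at hb
    exact ⟨⟨1, by rw [hb, one_smul]⟩, ⟨0, by rw [hz, zero_smul]⟩⟩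

/-- The loop slides along the chain to `k` itself, so the path passes through `k` before its end.
Hence `p₂` vanishes at the vertices with label `2` on the chain. -/
theorem loop_mul_toFar_mid {k : Fin (n + 1)} (h0 : 0 ∈ I) (hkI : k ∈ I) (hk : 3 ≤ k.val)
    (hkn : k.val + 2 ≤ n) :
    radMk (fork n hn) I (bwd hn 1 * fwd hn 1 * toFar n (fwd hn) k) = 0 := by
  have h1 := chain_mul_loopBack (rel_radMk hn I) (show k.val - 2 + 4 ≤ n by omega)
  rw [loopBack, if_neg (by omega), loopBack, if_pos rfl,
    bwd_mul hn (i := 0) (l := 0) (by omega) (by split_ifs <;> omega)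
      (fun v hv => mem_of_val h0 v hv) (fwd_mem hn _), zero_add, ← map_mul, ← map_mul,
    chain_mul_radMk_eq_zero hn hk hkn (mem_of_val hkI) (by omega)
      (mul_mem_posPart_left _ (fwd_mem hn _))] at h1
  rw [toFar, if_neg (by omega), map_mul, map_chain, h1]

/-- With both far leaves in `I` both summands of the slid loop are zero. -/
theorem loop_mul_toFar_end (h0 : 0 ∈ I)
    (h1 : ∀ v : Fin (n + 1), v.val = n - 1 → v ∈ I) (h2 : ∀ v : Fin (n + 1), v.val = n → v ∈ I) :
    radMk (fork n hn) I (bwd hn 1 * fwd hn 1 * chain (fwd hn) 2 (n - 4)) = 0 := by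
  have hb := chain_mul_branch (rel_radMk hn I) hn
  rw [mul_assoc, mul_assoc, fwd_mul hn (by omega) (by split_ifs <;> omega) h1 (bwd_mem hn _),
    fwd_mul hn (by omega) (by split_ifs <;> omega) h2 (bwd_mem hn _), loopBack, if_pos rfl,
    bwd_mul hn (l := 0) (by omega) (by split_ifs <;> omega)
      (fun v hv => mem_of_val h0 v hv) (fwd_mem hn _), zero_add, mul_zero, zero_add] at hb
  rw [map_mul, map_chain, map_mul, ← hb]

end

theorem far_mem {k : Fin (n + 1)} (hk : 3 ≤ k.val) {z : Preproj (fork n hn)}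
    (hz : z ∈ posPart (fork n hn)) (j : Fin (n + 1)) :
    radMk (fork n hn) {0, k} (idem (fork n hn) 0 * z * idem (fork n hn) j) ∈
      farSpan n (fun i => radMk (fork n hn) {0, k} (fwd hn i))
        (fun i => radMk (fork n hn) {0, k} (bwd hn i)) j.val := by
  obtain ⟨h1, h2⟩ := far_branch hn (I := {0, k}) (k := k) (by simp) (by simp) hk
  refine map_mem_of_closed _ (radMk (fork n hn) {0, k}) 0
    (fun v => farSpan n (fun i => radMk (fork n hn) {0, k} (fwd hn i))
        (fun i => radMk (fork n hn) {0, k} (bwd hn i)) v.val)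
    (start_of hn _ ?_) (closed_of hn _ fun i t u hi ht hu => ?_) hz j
  · rw [farSpan, if_neg (by decide), if_neg (by decide), toFar, if_neg (by omega)]
    exact Submodule.subset_span (Or.inl (mul_one _).symm)
  · refine farSpan_closed hn (rel_radMk hn _) ?_ h1 h2 hi ht hu
    exact bwd_mul hn (l := 0) (by omega) (by split_ifs <;> omega)
      (fun v hv => mem_of_val (v := 0) (by simp) v hv) (fwd_mem hn _)

/-- Both `0` and `k` are leaves, so a product through one of them uses the reversed arrow of edge
`0` or of the edge to `k`, and these act as zero. -/
theorem far_mul {k : Fin (n + 1)} (hk : n ≤ k.val + 1) (a b : Fin n ⊕ Fin n)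
    (ha : (fork n hn).double.head a ∈ ({0, k} : Finset (Fin (n + 1))))
    (hab : (fork n hn).double.head a = (fork n hn).double.tail b) :
    edgeRep (farFwd n k) (farBwd k) a * edgeRep (farFwd n k) (farBwd k) b = 0 := by
  have hkn := k.2
  refine edgeRep_mul hn ?_ a b ha hab
  intro i j v hi hj hv
  refine ⟨fun h1 h2 => ?_, fun h1 h2 => ?_, fun h1 h2 => ?_, fun h1 h2 => ?_⟩
  · exfalso; split_ifs at h1 h2 <;> omega
  · have : j = 0 ∨ j + 1 = k.val := by split_ifs at h1 h2 <;> omega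
    have h3 : farBwd k j = 0 := by
      rcases this with h3 | h3
      · simp [farBwd, h3]
      · rw [farBwd, if_neg (by omega), if_neg (by omega), if_pos h3]
    rw [h3, mul_zero]
  · have : i = 0 := by split_ifs at h1 h2 <;> omega
    simp [this, farBwd]
  · have : i = 0 := by split_ifs at h1 h2 <;> omega
    simp [this, farBwd]

theorem farFwd_mid {k i : ℕ} (hi : 2 ≤ i) (hin : i + 3 ≤ n) : farFwd n k i = 1 := by
  rw [farFwd, if_neg (by omega), if_neg (by omega), if_neg (by omega : ¬ n ≤ i + 2)]
  split_ifs <;> rfl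

theorem chain_farFwd {k d : ℕ} (hd : d + 4 ≤ n) : chain (farFwd n k) 2 d = 1 := by
  induction d with
  | zero => rfl
  | succ d ih => rw [chain_succ, ih (by omega), one_mul, farFwd_mid (by omega) (by omega)]

theorem rep_toFar {k : Fin (n + 1)} (hk : n ≤ k.val + 1) (x : Matrix (Fin 2) (Fin 2) ℂ) :
    Matrix.single (0 : Fin (n + 1)) ⟨2, by omega⟩ x *
      rep (edgeRep (farFwd n k) (farBwd k)) (edgeRep_relation hn
        (far_rel hn hk (Nat.lt_succ_iff.1 k.2))) (toFar n (fwd hn) k) =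
      Matrix.single 0 k x := by
  have hkn := k.2
  have h1 : farFwd n k (k.val - 1) = 1 := by
    rw [farFwd, if_neg (by omega), if_neg (by omega), if_pos (by omega)]
  rw [toFar]
  split_ifs with h
  · rw [map_mul, ← mul_assoc, rep_chain hn (far_rel hn hk (Nat.lt_succ_iff.1 k.2)) (by omega) (u := ⟨n - 2, by omega⟩) rfl
      (by simp; omega), rep_fwd hn (far_rel hn hk (Nat.lt_succ_iff.1 k.2)) (t := ⟨n - 2, by omega⟩) (u := k) (by omega)
      (by simp) (by split_ifs <;> omega), Matrix.single_mul_single_same, chain_farFwd (by omega),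
      mul_one, show n - 1 = k.val - 1 by omega, h1, mul_one]
  · rw [rep_chain hn (far_rel hn hk (Nat.lt_succ_iff.1 k.2)) (by omega) (u := k) rfl (by omega), show k.val - 2 = n - 4 + 1 by omega,
      chain_succ, chain_farFwd (by omega), show 2 + (n - 4) = k.val - 1 by omega, h1, one_mul,
      mul_one]

end fork

open fork in
/-- The basis for type `D̃ₙ` and a vertex beyond the vertex `2`. -/
def arrowBasisForkFar {n : ℕ} (hn : 4 ≤ n) (k : Fin (n + 1)) (hk : 3 ≤ k.val) {δ : Prop}
    (hδ : δ ↔ n ≤ k.val + 1) : ArrowBasis (fork n hn) 0 k δ where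
  p₁ := fwd hn 0 * toFar n (fwd hn) k
  p₂ := fwd hn 0 * (bwd hn 1 * fwd hn 1) * toFar n (fwd hn) k
  q := fwd hn 0 * (bwd hn 1 * fwd hn 1) * bwd hn 0
  p₁_mem := mul_mem_posPart_right (fwd_mem hn _) _
  p₂_mem := mul_mem_posPart_right (mul_mem_posPart_right (fwd_mem hn _) _) _
  span_eq z hz := by
    have h := far_mem hn hk hz k
    rw [farSpan, if_neg (by omega), if_neg (by omega)] at h
    simpa only [map_mul, map_toFar] using h
  span_zero z hz := by
    have h := far_mem hn hk hz 0
    rw [farSpan, if_pos (by rfl)] at h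
    simpa only [map_mul] using h
  eq_zero h := by
    rw [hδ] at h
    rw [mul_assoc, map_mul, loop_mul_toFar_mid hn (k := k) (by simp) (by simp) hk (by omega),
      mul_zero]
  factor h l hl0 hlk := by
    have hkn := k.2
    have hln := l.2
    rw [hδ] at h
    have hl0' : 0 < l.val := Nat.pos_of_ne_zero fun h => hl0 (Fin.ext h)
    have hlk' : l.val ≠ k.val := fun h => hlk (Fin.ext h)
    have hlI : ∀ v : Fin (n + 1), v.val = l.val → v ∈ ({0, k, l} : Finset (Fin (n + 1))) :=
      mem_of_val (by simp)
    have hkI : ∀ v : Fin (n + 1), v.val = k.val → v ∈ ({0, k, l} : Finset (Fin (n + 1))) :=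
      mem_of_val (by simp)
    -- The vertex `1` lies on the loop in `p₂`, and `2, …, n - 2` lie on the straight path `p₁`. If
    -- `l` is the other far leaf, the loop of `p₂` slides to the far end and dies there.
    rcases Nat.lt_or_ge l.val (n - 1) with h1 | h1
    · rcases Nat.lt_or_ge l.val 3 with h2 | h2
      · rcases Nat.lt_or_ge l.val 2 with h3 | h3
        · right
          rw [map_mul, map_mul, map_mul (radMk _ _) (bwd hn 1), bwd_mul hn (l := l.val) (by omega)
            (by split_ifs <;> omega) hlI (fwd_mem hn _), mul_zero, zero_mul]
        · left
          rw [map_mul, fwd_mul hn (l := l.val) (by omega) (by rw [if_pos rfl]; omega) hlI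
            (toFar_mem hn hk)]
      · left
        have h3 : radMk (fork n hn) {0, k, l} (toFar n (fwd hn) k) = 0 := by
          rw [toFar]
          split_ifs
          · rw [map_mul, map_chain]
            exact chain_mul_radMk_eq_zero hn h2 (by omega) hlI (by omega) (fwd_mem hn _)
          · rw [show k.val - 2 = n - 4 + 1 by omega, chain_succ, map_mul, map_chain]
            exact chain_mul_radMk_eq_zero hn h2 (by omega) hlI (by omega) (fwd_mem hn _)
        rw [map_mul, h3, mul_zero]
    · right
      have h3 : radMk (fork n hn) {0, k, l} (bwd hn 1 * fwd hn 1 * chain (fwd hn) 2 (n - 4)) = 0 := by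
        rcases Nat.lt_or_ge l.val n with h4 | h4
        · exact loop_mul_toFar_end hn (by simp) (fun v hv => hlI v (by omega))
            (fun v hv => hkI v (by omega))
        · exact loop_mul_toFar_end hn (by simp) (fun v hv => hkI v (by omega))
            (fun v hv => hlI v (by omega))
      rw [mul_assoc, map_mul]
      convert mul_zero _
      rw [toFar]
      split_ifs
      · rw [← mul_assoc, map_mul, h3, zero_mul]
      · rw [show k.val - 2 = n - 4 + 1 by omega, chain_succ, ← mul_assoc, map_mul, h3, zero_mul]
  indep h := by
    rw [hδ] at h
    have hrel := far_rel hn h (Nat.lt_succ_iff.1 k.2)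
    refine linearIndependent_of_rep (x₁ := mUnit 0 0) (x₂ := mUnit 0 1)
      (edgeRep_relation hn hrel) (far_mul hn h) ?_ ?_ (linearIndependent_mUnit (by decide))
    · rw [map_mul, rep_fwd hn hrel (t := 0) (u := ⟨2, by omega⟩) (by omega)
        (by rw [if_neg (by omega)]; rfl) rfl, rep_toFar hn h]
      rfl
    · rw [map_mul, map_mul, map_mul, rep_fwd hn hrel (t := 0) (u := ⟨2, by omega⟩) (by omega)
        (by rw [if_neg (by omega)]; rfl) rfl,
        rep_bwd hn hrel (t := ⟨1, by omega⟩) (u := ⟨2, by omega⟩) (by omega)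
          (by rw [if_neg (by omega)]) rfl,
        rep_fwd hn hrel (t := ⟨1, by omega⟩) (u := ⟨2, by omega⟩) (by omega)
          (by rw [if_neg (by omega)]) rfl, Matrix.single_mul_single_same,
        Matrix.single_mul_single_same, rep_toFar hn h]
      simp [farFwd, farBwd]

/-! ### Type `D̃ₙ`: the vertices `1` and `2` -/

namespace fork

variable {n : ℕ} (hn : 4 ≤ n)

section NearEnd

/-- The path from the vertex `2` to the far end and back to the vertex `v`. -/
def turn {A : Type} [Monoid A] (n : ℕ) (F G : ℕ → A) (v : ℕ) : A :=
  chain F 2 (n - 4) * F (n - 2) * G (n - 2) * chain (fun i => G (n - 3 - i)) 0 (n - 2 - v)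

theorem map_turn {A B H : Type} [Monoid A] [Monoid B] [FunLike H A B] [MonoidHomClass H A B]
    (φ : H) (F G : ℕ → A) (v : ℕ) :
    φ (turn n F G v) = turn n (fun i => φ (F i)) (fun i => φ (G i)) v := by
  simp only [turn, map_mul, map_chain]

variable {R : Type} [Ring R] [Algebra ℂ R] {F G : ℕ → R}

omit [Algebra ℂ R] in
theorem turn_sub_two (F G : ℕ → R) :
    turn n F G (n - 2) = chain F 2 (n - 4) * F (n - 2) * G (n - 2) := by
  rw [turn, Nat.sub_self, chain_zero, mul_one]

omit [Algebra ℂ R] in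
theorem turn_mul (F G : ℕ → R) {v : ℕ} (hv : v + 3 ≤ n) :
    turn n F G (v + 1) * G v = turn n F G v := by
  rw [turn, turn, show n - 2 - v = n - 2 - (v + 1) + 1 by omega, chain_succ,
    show n - 3 - (0 + (n - 2 - (v + 1))) = v by omega, mul_assoc]

variable (h : Rel n F G) (h0 : G 0 * F 0 = 0) (h1 : G 1 * F 1 = 0)
include hn h h0 h1

-- With both near loops zero the two far loops cancel: turning at the leaf `n` is minus turning at
-- the leaf `n - 1`.
omit [Algebra ℂ R] in
theorem turn_branch :
    chain F 2 (n - 4) * F (n - 1) * G (n - 1) = - turn n F G (n - 2) := by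
  have hb := chain_mul_branch h hn
  rw [loopBack, if_pos rfl, h0, h1, add_zero, zero_mul, ← turn_sub_two F G, add_comm] at hb
  exact eq_neg_of_add_eq_zero_left hb

omit [Algebra ℂ R] hn h0 h1 in
theorem turn_last : turn n F G (n - 2) * F (n - 2) = 0 := by
  rw [turn_sub_two, mul_assoc, h.last, mul_zero]

omit [Algebra ℂ R] in
theorem turn_last' : turn n F G (n - 2) * F (n - 1) = 0 := by
  rw [← neg_neg (turn n F G (n - 2)), ← turn_branch hn h h0 h1, neg_mul, mul_assoc, h.last',
    mul_zero, neg_zero]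

-- After the turn, a path cannot go forwards again. The two claims feed each other in a descending
-- induction: the backward loop at `v + 1` is `G v * F v`, and the relation at `v` converts it into
-- the forward loop there.
omit [Algebra ℂ R] in
theorem turn_mul_fwd_and {d v : ℕ} (hd : v + d + 2 = n) (hv : 2 ≤ v) :
    turn n F G v * F v = 0 ∧ turn n F G v * loopBack F G v = 0 := by
  induction d generalizing v with
  | zero =>
    obtain rfl : v = n - 2 := by omega
    refine ⟨turn_last h, ?_⟩
    rw [← h.branch, mul_add, ← mul_assoc, turn_last h, ← mul_assoc,
      turn_last' hn h h0 h1, zero_mul, zero_mul, add_zero]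
  | succ d ih =>
    have h3 := (ih (v := v + 1) (by omega) (by omega)).2
    rw [loopBack, if_neg (by omega), Nat.add_sub_cancel, ← mul_assoc,
      turn_mul F G (by omega)] at h3
    refine ⟨h3, ?_⟩
    rw [← h.mid v hv (by omega), ← mul_assoc, h3, zero_mul]

omit hn h h0 h1 in
variable (n F G) in
/-- The spans of the paths from `0`, in the case that `k = 1`. -/
def nearSpan (v : ℕ) : Submodule ℂ R :=
  if v = 0 then Submodule.span ℂ {F 0 * turn n F G 2 * G 0}
  else if v = 1 then Submodule.span ℂ {F 0 * G 1, F 0 * turn n F G 2 * G 1}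
  else if n < v + 2 then Submodule.span ℂ {F 0 * toFar n F v}
  else Submodule.span ℂ {F 0 * toFar n F v, F 0 * turn n F G v}

/-- A surviving path goes straight out, turns at most once, at a far leaf, and then only returns. A
turn before the far end slides to the loops at `2`, which vanish because `0` and `1` are in `I`. -/
theorem nearSpan_closed {i t u : ℕ} (hi : i < n) (ht : t = if i = n - 1 then n - 2 else i)
    (hu : u = if i = 0 then 2 else i + 1) :
    (∀ s ∈ nearSpan n F G t, s * F i ∈ nearSpan n F G u) ∧
      (∀ s ∈ nearSpan n F G u, s * G i ∈ nearSpan n F G t) := by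
  have htwo := toFar_two hn F
  have two : nearSpan n F G 2 = Submodule.span ℂ {F 0, F 0 * turn n F G 2} := by
    rw [nearSpan, if_neg (by omega), if_neg (by omega), if_neg (by omega), htwo, mul_one]
  have zero : nearSpan n F G 0 = Submodule.span ℂ {F 0 * turn n F G 2 * G 0} := by
    rw [nearSpan, if_pos rfl]
  have one : nearSpan n F G 1 = Submodule.span ℂ {F 0 * G 1, F 0 * turn n F G 2 * G 1} := by
    rw [nearSpan, if_neg (by omega), if_pos rfl]
  have mid : ∀ v, 2 ≤ v → v + 2 ≤ n → nearSpan n F G v =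
      Submodule.span ℂ {F 0 * toFar n F v, F 0 * turn n F G v} := by
    intro v hv hvn
    rw [nearSpan, if_neg (by omega), if_neg (by omega), if_neg (by omega)]
  have far : ∀ v, n < v + 2 → nearSpan n F G v = Submodule.span ℂ {F 0 * toFar n F v} := by
    intro v hv
    rw [nearSpan, if_neg (by omega), if_neg (by omega), if_pos hv]
  rcases Nat.lt_or_ge i 2 with h2 | h2
  · interval_cases i
    · rw [if_neg (by omega)] at ht
      rw [if_pos rfl] at hu
      subst ht hu
      rw [two, zero]
      constructor <;> intro s hs <;> refine mul_mem_of_span ?_ hs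
      · rintro x rfl
        rw [mul_assoc _ (G 0), h0, mul_zero]
        exact zero_mem _
      · rintro x (rfl | rfl)
        · rw [h.zero]
          exact zero_mem _
        · exact Submodule.subset_span rfl
    · rw [if_neg (by omega)] at ht
      rw [if_neg (by omega)] at hu
      subst ht hu
      rw [two, one]
      constructor <;> intro s hs <;> refine mul_mem_of_span ?_ hs
      · rintro x (rfl | rfl) <;> rw [mul_assoc _ (G 1), h1, mul_zero] <;> exact zero_mem _
      · rintro x (rfl | rfl)
        · exact Submodule.subset_span (Or.inl rfl)
        · exact Submodule.subset_span (Or.inr rfl)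
  · have hfwd := toFar_mul hn F h2 hi ht hu
    rw [if_neg (by omega)] at hu
    subst hu
    rcases Nat.lt_or_ge (i + 2) n with h3 | h3
    · rw [if_neg (by omega)] at ht
      subst ht
      have hback : toFar n F (t + 1) * G t = 0 := by
        have h5 := chain_succ_mul_back h (show t - 2 + 5 ≤ n by omega)
        rw [loopBack, if_pos rfl, h0, h1, zero_add, zero_mul, show 2 + (t - 2) = t by omega] at h5
        rw [toFar, if_neg (by omega), show t + 1 - 2 = t - 2 + 1 by omega, h5]
      rw [mid t h2 (by omega), mid (t + 1) (by omega) (by omega)]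
      constructor <;> intro s hs <;> refine mul_mem_of_span ?_ hs
      · rintro x (rfl | rfl)
        · rw [mul_assoc, hfwd]
          exact Submodule.subset_span (Or.inl rfl)
        · rw [mul_assoc, (turn_mul_fwd_and hn h h0 h1 (v := t) (d := n - 2 - t) (by omega) h2).1,
            mul_zero]
          exact zero_mem _
      · rintro x (rfl | rfl)
        · rw [mul_assoc, hback, mul_zero]
          exact zero_mem _
        · rw [mul_assoc, turn_mul F G (by omega)]
          exact Submodule.subset_span (Or.inr rfl)
    · obtain rfl : t = n - 2 := by split_ifs at ht <;> omega
      have hturn : turn n F G (n - 2) * F i = 0 := by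
        rcases Nat.lt_or_ge (i + 1) n with h4 | h4
        · rw [show i = n - 2 by omega, turn_last h]
        · rw [show i = n - 1 by omega, turn_last' hn h h0 h1]
      have hback : toFar n F (i + 1) * G i = turn n F G (n - 2) ∨
          toFar n F (i + 1) * G i = - turn n F G (n - 2) := by
        rw [← hfwd, toFar_sub_two hn]
        rcases Nat.lt_or_ge (i + 1) n with h4 | h4
        · rw [show i = n - 2 by omega, turn_sub_two]
          exact Or.inl rfl
        · rw [show i = n - 1 by omega]
          exact Or.inr (turn_branch hn h h0 h1)
      rw [mid (n - 2) (by omega) (by omega), far (i + 1) (by omega)]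
      constructor <;> intro s hs <;> refine mul_mem_of_span ?_ hs
      · rintro x (rfl | rfl)
        · rw [mul_assoc, hfwd]
          exact Submodule.subset_span rfl
        · rw [mul_assoc, hturn, mul_zero]
          exact zero_mem _
      · rintro x rfl
        rw [mul_assoc]
        rcases hback with h5 | h5 <;> rw [h5]
        · exact Submodule.subset_span (Or.inr rfl)
        · rw [mul_neg]
          exact neg_mem (Submodule.subset_span (Or.inr rfl))

end NearEnd

/-- A representation with two linearly independent paths from `0` to `1`. -/
def nearFwd (i : ℕ) : Matrix (Fin 2) (Fin 2) ℂ := if i = 1 then 0 else mUnit 0 0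

/-- The action of the reversed arrows in the representation. -/
def nearBwd (n i : ℕ) : Matrix (Fin 2) (Fin 2) ℂ :=
  if i = 0 then 0 else if i = 1 then 1 else if i + 2 = n then mUnit 0 1
  else if i + 1 = n then - mUnit 0 1 else mUnit 1 1

/-- The index `0` marks the way out and `1` the way back. The switch `mUnit 0 1` takes place only at
the two far leaves, with opposite signs to satisfy the relation at `n - 2`. -/
theorem near_rel (hn : 4 ≤ n) : Rel n nearFwd (nearBwd n) := by
  have hb : ∀ i, i ≠ 1 → nearBwd n i * nearFwd i = 0 := by
    intro i hi
    rw [nearFwd, nearBwd, if_neg hi, if_neg hi]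
    split_ifs <;> simp
  have hloop : ∀ i, 2 ≤ i → loopBack nearFwd (nearBwd n) i = 0 := by
    intro i hi
    rw [loopBack]
    split_ifs
    · simp [nearFwd, nearBwd]
    · exact hb _ (by omega)
  refine ⟨by simp [nearFwd, nearBwd], by simp [nearFwd, nearBwd], ?_, ?_, hb _ (by omega),
    hb _ (by omega)⟩
  · intro i hi hin
    rw [hloop i hi, nearBwd, if_neg (by omega), if_neg (by omega), if_neg (by omega),
      if_neg (by omega), nearFwd, if_neg (by omega)]
    simp
  · have e1 : nearBwd n (n - 2) = mUnit 0 1 := by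
      rw [nearBwd, if_neg (by omega), if_neg (by omega), if_pos (by omega)]
    have e2 : nearBwd n (n - 1) = - mUnit 0 1 := by
      rw [nearBwd, if_neg (by omega), if_neg (by omega), if_neg (by omega), if_pos (by omega)]
    rw [hloop _ (by omega), e1, e2, nearFwd, nearFwd, if_neg (by omega), if_neg (by omega)]
    simp

theorem near_mul (a b : Fin n ⊕ Fin n)
    (ha : (fork n hn).double.head a ∈ ({0, ⟨1, by omega⟩} : Finset (Fin (n + 1))))
    (hab : (fork n hn).double.head a = (fork n hn).double.tail b) :
    edgeRep nearFwd (nearBwd n) a * edgeRep nearFwd (nearBwd n) b = 0 := by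
  refine edgeRep_mul hn ?_ a b ha hab
  intro i j v hi hj hv
  simp only at hv
  refine ⟨fun h1 h2 => ?_, fun h1 h2 => ?_, fun h1 h2 => ?_, fun h1 h2 => ?_⟩
  · exfalso; split_ifs at h1 h2 <;> omega
  · exfalso; split_ifs at h1 h2 <;> omega
  · have : i = 0 ∨ j = 1 := by split_ifs at h1 h2 <;> omega
    rcases this with h3 | h3 <;> simp [h3, nearBwd, nearFwd]
  · exfalso; split_ifs at h1 h2 <;> omega

theorem mem_near {z : Preproj (fork n hn)} (hz : z ∈ posPart (fork n hn)) (j : Fin (n + 1)) :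
    radMk (fork n hn) {0, ⟨1, by omega⟩} (idem (fork n hn) 0 * z * idem (fork n hn) j) ∈
      nearSpan n (fun i => radMk (fork n hn) {0, ⟨1, by omega⟩} (fwd hn i))
        (fun i => radMk (fork n hn) {0, ⟨1, by omega⟩} (bwd hn i)) j.val := by
  refine map_mem_of_closed _ (radMk (fork n hn) {0, ⟨1, by omega⟩}) 0
    (fun v => nearSpan n (fun i => radMk (fork n hn) {0, ⟨1, by omega⟩} (fwd hn i))
        (fun i => radMk (fork n hn) {0, ⟨1, by omega⟩} (bwd hn i)) v.val)
    (start_of hn _ ?_) (closed_of hn _ fun i t u hi ht hu => ?_) hz j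
  · rw [nearSpan, if_neg (by decide), if_neg (by decide), if_neg (by omega), toFar_two hn]
    exact Submodule.subset_span (Or.inl (mul_one _).symm)
  · refine nearSpan_closed hn (rel_radMk hn _) ?_ ?_ hi ht hu
    · exact bwd_mul hn (l := 0) (by omega) (by split_ifs <;> omega)
        (fun v hv => mem_of_val (v := 0) (by simp) v hv) (fwd_mem hn _)
    · exact bwd_mul hn (l := 1) (by omega) (by split_ifs <;> omega)
        (mem_of_val (v := ⟨1, by omega⟩) (by simp)) (fwd_mem hn _)

theorem chain_nearFwd {d : ℕ} : mUnit 0 0 * chain nearFwd 2 d = mUnit 0 0 := by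
  induction d with
  | zero => exact mul_one _
  | succ d ih =>
    rw [chain_succ, ← mul_assoc, ih, nearFwd, if_neg (by omega)]
    simp

theorem chain_nearBwd {d : ℕ} (hd : d + 4 ≤ n) :
    mUnit 0 1 * chain (fun i => nearBwd n (n - 3 - i)) 0 d = mUnit 0 1 := by
  induction d with
  | zero => exact mul_one _
  | succ d ih =>
    rw [chain_succ, ← mul_assoc, ih (by omega), nearBwd, if_neg (by omega), if_neg (by omega),
      if_neg (by omega), if_neg (by omega)]
    simp

theorem rep_chain_bwd {M : Type} [Ring M] [Algebra ℂ M] {F G : ℕ → M} (h : Rel n F G) {d : ℕ}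
    (hd : d + 4 ≤ n) {t u : Fin (n + 1)} (ht : t.val = n - 2) (hu : u.val = n - 2 - d) (x : M) :
    Matrix.single (0 : Fin (n + 1)) t x * rep (edgeRep F G) (edgeRep_relation hn h)
        (chain (fun i => bwd hn (n - 3 - i)) 0 d) =
      Matrix.single 0 u (x * chain (fun i => G (n - 3 - i)) 0 d) := by
  induction d generalizing u with
  | zero =>
    obtain rfl : t = u := Fin.ext (ht.trans hu.symm)
    rw [chain_zero, chain_zero, map_one, mul_one, mul_one]
  | succ d ih =>
    rw [chain_succ, map_mul, ← mul_assoc, ih (by omega) (u := ⟨n - 2 - d, by omega⟩) rfl,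
      rep_bwd hn h (i := n - 3 - (0 + d)) (u := ⟨n - 2 - d, by omega⟩) (t := u) (by omega)
        (by split_ifs <;> omega) (by simp only; split_ifs <;> omega),
      Matrix.single_mul_single_same, chain_succ, mul_assoc]

theorem rep_turn : Matrix.single (0 : Fin (n + 1)) ⟨2, by omega⟩ (mUnit 0 0) *
      rep (edgeRep nearFwd (nearBwd n)) (edgeRep_relation hn (near_rel hn))
        (turn n (fwd hn) (bwd hn) 2) =
      Matrix.single 0 ⟨2, by omega⟩ (mUnit 0 1) := by
  have e1 : nearBwd n (n - 2) = mUnit 0 1 := by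
    rw [nearBwd, if_neg (by omega), if_neg (by omega), if_pos (by omega)]
  have e2 : nearFwd (n - 2) = mUnit 0 0 := by
    rw [nearFwd, if_neg (by omega)]
  rw [turn, map_mul, map_mul, map_mul, ← mul_assoc, ← mul_assoc, ← mul_assoc,
    rep_chain hn (near_rel hn) (by omega) (u := ⟨n - 2, by omega⟩) rfl (by simp; omega),
    chain_nearFwd, rep_fwd hn (near_rel hn) (t := ⟨n - 2, by omega⟩) (u := ⟨n - 1, by omega⟩)
      (by omega) (by rw [if_neg (by omega)]) (by rw [if_neg (by omega)]; simp; omega),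
    Matrix.single_mul_single_same,
    rep_bwd hn (near_rel hn) (t := ⟨n - 2, by omega⟩) (u := ⟨n - 1, by omega⟩)
      (by omega) (by rw [if_neg (by omega)]) (by rw [if_neg (by omega)]; simp; omega),
    Matrix.single_mul_single_same, e1, e2, Matrix.single_mul_single_same,
    Matrix.single_mul_single_same, one_mul, one_mul,
    rep_chain_bwd hn (near_rel hn) (by omega) (u := ⟨2, by omega⟩) rfl (by simp; omega),
    show n - 2 - 2 = n - 4 by omega, chain_nearBwd (by omega)]

/-- The spans of the paths from `0`, in the case that `k = 2`. -/
def twoSpan (k : Fin (n + 1)) (v : ℕ) : Submodule ℂ (RadQuot (fork n hn) {0, k}) :=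
  if v = 2 then Submodule.span ℂ {radMk (fork n hn) {0, k} (fwd hn 0)} else ⊥

theorem mem_two {k : Fin (n + 1)} (hk : k.val = 2) {z : Preproj (fork n hn)}
    (hz : z ∈ posPart (fork n hn)) (j : Fin (n + 1)) :
    radMk (fork n hn) {0, k} (idem (fork n hn) 0 * z * idem (fork n hn) j) ∈
      twoSpan hn k j.val := by
  refine map_mem_of_closed _ (radMk (fork n hn) {0, k}) 0
    (fun v => twoSpan hn k v.val) (start_of hn _ ?_) ?_ hz j
  · rw [twoSpan, if_pos rfl]
    exact Submodule.subset_span rfl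
  · intro a s hs
    have h0 : s * radMk (fork n hn) {0, k} (arrow (fork n hn) a) = 0 := by
      rw [twoSpan] at hs
      split_ifs at hs
      · refine (Submodule.mem_bot ℂ).1 (mul_mem_of_span (S := ⊥) ?_ hs)
        rintro x rfl
        rw [Submodule.mem_bot]
        exact fwd_mul hn (l := k.val) (by omega) (by rw [if_pos rfl, hk])
          (mem_of_val (v := k) (by simp)) (arrow_mem_posPart _ _)
      · rw [(Submodule.mem_bot ℂ).1 hs, zero_mul]
    rw [h0]
    exact zero_mem _

end fork

open fork in
/-- The basis for type `D̃ₙ` and the vertex `1`. -/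
def arrowBasisForkNear {n : ℕ} (hn : 4 ≤ n) {δ : Prop} (hδ : δ) :
    ArrowBasis (fork n hn) 0 ⟨1, by omega⟩ δ where
  p₁ := fwd hn 0 * bwd hn 1
  p₂ := fwd hn 0 * turn n (fwd hn) (bwd hn) 2 * bwd hn 1
  q := fwd hn 0 * turn n (fwd hn) (bwd hn) 2 * bwd hn 0
  p₁_mem := mul_mem_posPart_right (fwd_mem hn _) _
  p₂_mem := mul_mem_posPart_left _ (bwd_mem hn _)
  span_eq z hz := by
    have h := mem_near hn hz ⟨1, by omega⟩
    rw [nearSpan, if_neg (by simp), if_pos rfl] at h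
    simpa only [map_mul, map_turn] using h
  span_zero z hz := by
    have h := mem_near hn hz 0
    rw [nearSpan, if_pos (by rfl)] at h
    simpa only [map_mul, map_turn] using h
  eq_zero h := absurd hδ h
  factor _ l hl0 hl1 := by
    have hln := l.2
    have hl0' : 0 < l.val := Nat.pos_of_ne_zero fun h => hl0 (Fin.ext h)
    have hl1' : l.val ≠ 1 := fun h => hl1 (Fin.ext h)
    have hlI : ∀ v : Fin (n + 1), v.val = l.val →
        v ∈ ({0, ⟨1, by omega⟩, l} : Finset (Fin (n + 1))) := mem_of_val (by simp)
    rcases Nat.lt_or_ge l.val 3 with h3 | h3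
    · left
      rw [map_mul, fwd_mul hn (l := l.val) (by omega) (by rw [if_pos rfl]; omega) hlI
        (bwd_mem hn _)]
    · right
      -- The way to the turning point already meets `l`.
      have h4 : radMk (fork n hn) {0, ⟨1, by omega⟩, l} (turn n (fwd hn) (bwd hn) (n - 2)) = 0 := by
        rw [map_turn]
        rcases Nat.lt_or_ge l.val (n - 1) with h1 | h1
        · rw [turn_sub_two, chain_mul_radMk_eq_zero hn h3 (by omega) hlI (by omega) (fwd_mem hn _), zero_mul]
        rcases Nat.lt_or_ge l.val n with h2 | h2
        · rw [turn_sub_two, mul_assoc, fwd_mul hn (l := l.val) (by omega)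
            (by split_ifs <;> omega) hlI (bwd_mem hn _), mul_zero]
        -- As written, `p₂` turns at `n - 1` and avoids `l = n`; up to sign it may be replaced by
        -- the turn at `n`.
        · have h5 := turn_branch hn (rel_radMk hn {0, ⟨1, by omega⟩, l})
            (bwd_mul hn (l := 0) (by omega) (by split_ifs <;> omega)
              (fun v hv => mem_of_val (v := 0) (by simp) v hv) (fwd_mem hn _))
            (bwd_mul hn (l := 1) (by omega) (by split_ifs <;> omega)
              (mem_of_val (v := ⟨1, by omega⟩) (by simp)) (fwd_mem hn _))
          rw [mul_assoc, fwd_mul hn (l := l.val) (by omega) (by split_ifs <;> omega) hlI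
            (bwd_mem hn _), mul_zero] at h5
          exact neg_eq_zero.1 h5.symm
      have h5 : turn n (fwd hn) (bwd hn) 2 = turn n (fwd hn) (bwd hn) (n - 2) *
          chain (fun i => bwd hn (n - 3 - i)) 0 (n - 2 - 2) := by
        rw [turn_sub_two, turn]
      rw [h5, map_mul, map_mul, map_mul, h4, zero_mul, mul_zero, zero_mul]
  indep _ := by
    have hrel := near_rel hn
    refine linearIndependent_of_rep (x₁ := mUnit 0 0) (x₂ := mUnit 0 1)
      (edgeRep_relation hn hrel) (near_mul hn) ?_ ?_ (linearIndependent_mUnit (by decide))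
    · rw [map_mul, rep_fwd hn hrel (t := 0) (u := ⟨2, by omega⟩) (by omega)
        (by rw [if_neg (by omega)]; rfl) rfl,
        rep_bwd hn hrel (t := ⟨1, by omega⟩) (u := ⟨2, by omega⟩) (by omega)
          (by rw [if_neg (by omega)]) rfl, Matrix.single_mul_single_same]
      simp [nearFwd, nearBwd]
    · rw [map_mul, map_mul, rep_fwd hn hrel (t := 0) (u := ⟨2, by omega⟩) (by omega)
        (by rw [if_neg (by omega)]; rfl) rfl,
        show nearFwd 0 = mUnit 0 0 from rfl, rep_turn hn,
        rep_bwd hn hrel (t := ⟨1, by omega⟩) (u := ⟨2, by omega⟩) (by omega)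
          (by rw [if_neg (by omega)]) rfl, Matrix.single_mul_single_same]
      simp [nearBwd]

open fork in
/-- The basis for type `D̃ₙ` and the vertex `2`. -/
def arrowBasisForkTwo {n : ℕ} (hn : 4 ≤ n) (k : Fin (n + 1)) (hk : k.val = 2) {δ : Prop}
    (hδ : ¬ δ) : ArrowBasis (fork n hn) 0 k δ where
  p₁ := fwd hn 0
  p₂ := 0
  q := 0
  p₁_mem := fwd_mem hn _
  p₂_mem := zero_mem _
  span_eq z hz := by
    have h := mem_two hn hk hz k
    rw [twoSpan, if_pos hk] at h
    exact Submodule.span_mono (by simp) h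
  span_zero z hz := by
    have h := mem_two hn hk hz 0
    rw [twoSpan, if_neg (by simp)] at h
    rw [(Submodule.mem_bot ℂ).1 h]
    exact zero_mem _
  eq_zero _ := map_zero _
  factor h := absurd h hδ
  indep h := absurd h hδ

/-! ### Nilpotent loops at the branching vertex, for types `Ẽ` -/

/-- The basis in the case that there is at most one arrow from `o` to `k`. -/
def arrowBasisOfThin {V E : Type} [Fintype V] [Fintype E] [DecidableEq V] {Q : ArrowQuiver V E}
    {o k : V} {δ : Prop} (hδ : ¬ δ) (p q : Preproj Q) (hp : p ∈ posPart Q)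
    (S : V → Submodule ℂ (RadQuot Q {o, k}))
    (hS : ∀ z ∈ posPart Q, ∀ j, radMk Q {o, k} (idem Q o * z * idem Q j) ∈ S j)
    (hk : S k ≤ Submodule.span ℂ {radMk Q {o, k} p})
    (ho : S o ≤ Submodule.span ℂ {radMk Q {o, k} q}) : ArrowBasis Q o k δ where
  p₁ := p
  p₂ := 0
  q := q
  p₁_mem := hp
  p₂_mem := zero_mem _
  span_eq z hz := Submodule.span_mono (by simp) (hk (hS z hz k))
  span_zero z hz := ho (hS z hz o)
  eq_zero _ := map_zero _
  factor h := absurd h hδ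
  indep h := absurd h hδ

section Loops

variable {R : Type} [Ring R] [Algebra ℂ R] {s x y z : R}

/-- In this family `s` is the straight path to the branching vertex and `x`, `y`, `z` are the loops
along the arms, up to sign. The relation at the vertex is `x = y + z`, and the nilpotency orders
depend on the position of `k`. -/
theorem loops_one (hx : s * x = 0) (hy : s * y = 0) (hz : s * z = 0) :
    (∀ u ∈ Submodule.span ℂ {s}, u * x ∈ Submodule.span ℂ {s}) ∧
    (∀ u ∈ Submodule.span ℂ {s}, u * y ∈ Submodule.span ℂ {s}) ∧
    (∀ u ∈ Submodule.span ℂ {s}, u * z ∈ Submodule.span ℂ {s}) := by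
  refine ⟨fun u hu => mul_mem_of_span ?_ hu, fun u hu => mul_mem_of_span ?_ hu,
    fun u hu => mul_mem_of_span ?_ hu⟩ <;> rintro _ rfl
  · rw [hx]; exact zero_mem _
  · rw [hy]; exact zero_mem _
  · rw [hz]; exact zero_mem _

/-- From `s x = 0` one gets `s y = - s z`. So after `s y` a further `y` dies by `y² = 0` and a
further `z` by `z² = 0`. -/
theorem loops_two (hx : s * x = 0) (h : x = y + z) (hyy : y * y = 0) (hzz : z * z = 0) :
    (∀ u ∈ Submodule.span ℂ {s, s * y}, u * x ∈ Submodule.span ℂ {s, s * y}) ∧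
    (∀ u ∈ Submodule.span ℂ {s, s * y}, u * y ∈ Submodule.span ℂ {s, s * y}) ∧
    (∀ u ∈ Submodule.span ℂ {s, s * y}, u * z ∈ Submodule.span ℂ {s, s * y}) := by
  have hsz : s * y = - (s * z) := by
    rw [h, mul_add] at hx
    exact eq_neg_of_add_eq_zero_left hx
  have hsy : s * z = - (s * y) := by rw [hsz, neg_neg]
  have h1 : s * y * y = 0 := by rw [mul_assoc, hyy, mul_zero]
  have h2 : s * y * z = 0 := by rw [hsz, neg_mul, mul_assoc, hzz, mul_zero, neg_zero]
  refine ⟨fun u hu => mul_mem_of_span ?_ hu, fun u hu => mul_mem_of_span ?_ hu,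
    fun u hu => mul_mem_of_span ?_ hu⟩ <;> rintro _ (rfl | rfl)
  · rw [hx]; exact zero_mem _
  · rw [h, mul_add, h1, h2, add_zero]; exact zero_mem _
  · exact Submodule.subset_span (Or.inr rfl)
  · rw [h1]; exact zero_mem _
  · rw [hsy]; exact neg_mem (Submodule.subset_span (Or.inr rfl))
  · rw [h2]; exact zero_mem _

/-- Again `s y = - s z`, and `s y x = s y z`. The word `s y z` admits no `z` since `s z³ = 0`, no
`x` since `s y x² = 0`, and hence no `y`. -/
theorem loops_three (hx : s * x = 0) (h : x = y + z) (hxx : x * x = 0) (hyy : y * y = 0)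
    (hzz : z * z * z = 0) :
    (∀ u ∈ Submodule.span ℂ {s, s * y, s * y * z},
      u * x ∈ Submodule.span ℂ {s, s * y, s * y * z}) ∧
    (∀ u ∈ Submodule.span ℂ {s, s * y, s * y * z},
      u * y ∈ Submodule.span ℂ {s, s * y, s * y * z}) ∧
    (∀ u ∈ Submodule.span ℂ {s, s * y, s * y * z},
      u * z ∈ Submodule.span ℂ {s, s * y, s * y * z}) := by
  have hsz : s * y = - (s * z) := by
    rw [h, mul_add] at hx
    exact eq_neg_of_add_eq_zero_left hx
  have hsy : s * z = - (s * y) := by rw [hsz, neg_neg]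
  have h1 : s * y * y = 0 := by rw [mul_assoc, hyy, mul_zero]
  have h2 : s * y * x = s * y * z := by rw [h, mul_add, h1, zero_add]
  have h3 : s * y * z * z = 0 := by
    rw [hsz, neg_mul, neg_mul, mul_assoc s, mul_assoc s, hzz, mul_zero, neg_zero]
  have h4 : s * y * z * x = 0 := by rw [← h2, mul_assoc, hxx, mul_zero]
  have h5 : s * y * z * y = 0 := by
    rw [h, mul_add, h3, add_zero] at h4
    exact h4
  refine ⟨fun u hu => mul_mem_of_span ?_ hu, fun u hu => mul_mem_of_span ?_ hu,
    fun u hu => mul_mem_of_span ?_ hu⟩ <;> rintro _ (rfl | rfl | rfl)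
  · rw [hx]; exact zero_mem _
  · rw [h2]; exact Submodule.subset_span (Or.inr (Or.inr rfl))
  · rw [h4]; exact zero_mem _
  · exact Submodule.subset_span (Or.inr (Or.inl rfl))
  · rw [h1]; exact zero_mem _
  · rw [h5]; exact zero_mem _
  · rw [hsy]; exact neg_mem (Submodule.subset_span (Or.inr (Or.inl rfl)))
  · exact Submodule.subset_span (Or.inr (Or.inr rfl))
  · rw [h3]; exact zero_mem _

/-- Now `z² = 0` gives `s y z = 0` and `s y x = s y²`; next `y³ = 0` gives `s y² x = s y² z`. This
last word is `s y x²`, so `x³ = 0` stops it. -/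
theorem loops_four (hx : s * x = 0) (h : x = y + z) (hxx : x * x * x = 0) (hyy : y * y * y = 0)
    (hzz : z * z = 0) :
    (∀ u ∈ Submodule.span ℂ {s, s * y, s * y * y, s * y * y * z},
      u * x ∈ Submodule.span ℂ {s, s * y, s * y * y, s * y * y * z}) ∧
    (∀ u ∈ Submodule.span ℂ {s, s * y, s * y * y, s * y * y * z},
      u * y ∈ Submodule.span ℂ {s, s * y, s * y * y, s * y * y * z}) ∧
    (∀ u ∈ Submodule.span ℂ {s, s * y, s * y * y, s * y * y * z},
      u * z ∈ Submodule.span ℂ {s, s * y, s * y * y, s * y * y * z}) := by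
  have hsz : s * y = - (s * z) := by
    rw [h, mul_add] at hx
    exact eq_neg_of_add_eq_zero_left hx
  have hsy : s * z = - (s * y) := by rw [hsz, neg_neg]
  have h1 : s * y * z = 0 := by rw [hsz, neg_mul, mul_assoc, hzz, mul_zero, neg_zero]
  have h2 : s * y * x = s * y * y := by rw [h, mul_add, h1, add_zero]
  have h3 : s * y * y * y = 0 := by rw [mul_assoc s, mul_assoc s, hyy, mul_zero]
  have h4 : s * y * y * x = s * y * y * z := by rw [h, mul_add, h3, zero_add]
  have h5 : s * y * y * z * z = 0 := by rw [mul_assoc, hzz, mul_zero]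
  have h6 : s * y * y * z * x = 0 := by
    rw [← h4, ← h2, mul_assoc (s * y), mul_assoc (s * y), hxx, mul_zero]
  have h7 : s * y * y * z * y = 0 := by
    rw [h, mul_add, h5, add_zero] at h6
    exact h6
  refine ⟨fun u hu => mul_mem_of_span ?_ hu, fun u hu => mul_mem_of_span ?_ hu,
    fun u hu => mul_mem_of_span ?_ hu⟩ <;> rintro _ (rfl | rfl | rfl | rfl)
  · rw [hx]; exact zero_mem _
  · rw [h2]; exact Submodule.subset_span (Or.inr (Or.inr (Or.inl rfl)))
  · rw [h4]; exact Submodule.subset_span (Or.inr (Or.inr (Or.inr rfl)))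
  · rw [h6]; exact zero_mem _
  · exact Submodule.subset_span (Or.inr (Or.inl rfl))
  · exact Submodule.subset_span (Or.inr (Or.inr (Or.inl rfl)))
  · rw [h3]; exact zero_mem _
  · rw [h7]; exact zero_mem _
  · rw [hsy]; exact neg_mem (Submodule.subset_span (Or.inr (Or.inl rfl)))
  · rw [h1]; exact zero_mem _
  · exact Submodule.subset_span (Or.inr (Or.inr (Or.inr rfl)))
  · rw [h5]; exact zero_mem _

end Loops

/-- The right translate of a subspace of an algebra. -/
def mulR {R : Type} [Ring R] [Algebra ℂ R] (S : Submodule ℂ R) (r : R) : Submodule ℂ R :=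
  S.map (LinearMap.mulRight ℂ r)

section MulR

variable {R : Type} [Ring R] [Algebra ℂ R] {S T : Submodule ℂ R} {r x : R}

theorem mul_mem_mulR {u : R} (hu : u ∈ S) (r : R) : u * r ∈ mulR S r := ⟨u, hu, rfl⟩

theorem mulR_closed (h : ∀ u ∈ S, u * r * x ∈ T) : ∀ s ∈ mulR S r, s * x ∈ T := by
  rintro _ ⟨u, hu, rfl⟩
  exact h u hu

theorem sup_closed {S' : Submodule ℂ R} (h : ∀ u ∈ S, u * x ∈ T) (h' : ∀ u ∈ S', u * x ∈ T) :
    ∀ s ∈ S ⊔ S', s * x ∈ T := by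
  intro s hs
  obtain ⟨u, hu, v, hv, rfl⟩ := Submodule.mem_sup.1 hs
  rw [add_mul]
  exact add_mem (h u hu) (h' v hv)

theorem singleton_closed {p : R} (h : p * x ∈ T) : ∀ s ∈ Submodule.span ℂ {p}, s * x ∈ T :=
  fun _ hs => mul_mem_of_span (by rintro _ rfl; exact h) hs

theorem mulR_bot : mulR (⊥ : Submodule ℂ R) r = ⊥ := Submodule.map_bot _

theorem mulR_le (h : ∀ u ∈ S, u * r ∈ T) : mulR S r ≤ T := by
  rintro _ ⟨u, hu, rfl⟩
  exact h u hu

theorem mem_of_eq_zero {u : R} (h : u = 0) : u ∈ T := h ▸ zero_mem _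

theorem mulR_span_le {X : Set R} (h : ∀ u ∈ X, u * r ∈ T) : mulR (Submodule.span ℂ X) r ≤ T :=
  mulR_le fun _ hu => mul_mem_of_span h hu

end MulR

/-! ### Continuation from the branching vertex back to `0` and forth to `k` -/

section Paths

variable {R : Type} [Ring R] [Algebra ℂ R] {T : Submodule ℂ R} {s x y z a b w : R}

theorem mulR_one (h : s * b = 0) : mulR (Submodule.span ℂ {s}) b ≤ T := by
  refine mulR_span_le ?_
  rintro _ rfl
  exact mem_of_eq_zero h

theorem mulR_two_back (h : s * b = 0) :
    mulR (Submodule.span ℂ {s, s * y}) b ≤ Submodule.span ℂ {s * y * b} := by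
  refine mulR_span_le ?_
  rintro _ (rfl | rfl)
  · exact mem_of_eq_zero h
  · exact Submodule.subset_span rfl

/-- The factor `b` is the way back to `0`, which kills `s` and everything that ends in `x`. As `s y
z = s y x`, only `s y b` is left. -/
theorem mulR_three_back (hb : s * b = 0) (hxb : x * b = 0) (h : x = y + z) (hyy : y * y = 0) :
    mulR (Submodule.span ℂ {s, s * y, s * y * z}) b ≤ Submodule.span ℂ {s * y * b} := by
  have h2 : s * y * z = s * y * x := by rw [h, mul_add, mul_assoc s y y, hyy, mul_zero, zero_add]
  refine mulR_span_le ?_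
  rintro _ (rfl | rfl | rfl)
  · exact mem_of_eq_zero hb
  · exact Submodule.subset_span rfl
  · refine mem_of_eq_zero ?_
    rw [h2, mul_assoc, hxb, mul_zero]

theorem mulR_four_back (hb : s * b = 0) (hxb : x * b = 0) (hs : s * x = 0) (h : x = y + z)
    (hyyy : y * y * y = 0) (hzz : z * z = 0) :
    mulR (Submodule.span ℂ {s, s * y, s * y * y, s * y * y * z}) b ≤
      Submodule.span ℂ {s * y * b} := by
  rw [h, mul_add] at hs
  have h1 : s * y * z = 0 := by
    rw [eq_neg_of_add_eq_zero_left hs, neg_mul, mul_assoc, hzz, mul_zero, neg_zero]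
  have h2 : s * y * y = s * y * x := by rw [h, mul_add, h1, add_zero]
  have h3 : s * y * y * y = 0 := by rw [mul_assoc, mul_assoc, ← mul_assoc y, hyyy, mul_zero]
  have h4 : s * y * y * z = s * y * y * x := by rw [h, mul_add, h3, zero_add]
  refine mulR_span_le ?_
  rintro _ (rfl | rfl | rfl | rfl)
  · exact mem_of_eq_zero hb
  · exact Submodule.subset_span rfl
  · refine mem_of_eq_zero ?_
    rw [h2, mul_assoc, hxb, mul_zero]
  · refine mem_of_eq_zero ?_
    rw [h4, mul_assoc, hxb, mul_zero]

theorem mulR_two_forth (h : y * a = 0) :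
    mulR (Submodule.span ℂ {s, s * y}) a ≤ Submodule.span ℂ {s * a} := by
  refine mulR_span_le ?_
  rintro _ (rfl | rfl)
  · exact Submodule.subset_span rfl
  · refine mem_of_eq_zero ?_
    rw [mul_assoc, h, mul_zero]

/-- The factor `a` is the way to `k`. A loop `y` on the same arm slides outwards until it meets `k`,
whence `y a = 0`. -/
theorem mulR_three_forth (h : y * a = 0) :
    mulR (Submodule.span ℂ {s, s * y, w}) a ≤ Submodule.span ℂ {s * a, w * a} := by
  refine mulR_span_le ?_
  rintro _ (rfl | rfl | rfl)
  · exact Submodule.subset_span (Or.inl rfl)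
  · refine mem_of_eq_zero ?_
    rw [mul_assoc, h, mul_zero]
  · exact Submodule.subset_span (Or.inr rfl)

theorem mulR_four_forth (h : y * a = 0) :
    mulR (Submodule.span ℂ {s, s * y, s * y * y, w}) a ≤ Submodule.span ℂ {s * a, w * a} := by
  refine mulR_span_le ?_
  rintro _ (rfl | rfl | rfl | rfl)
  · exact Submodule.subset_span (Or.inl rfl)
  · refine mem_of_eq_zero ?_
    rw [mul_assoc, h, mul_zero]
  · refine mem_of_eq_zero ?_
    rw [mul_assoc, h, mul_zero]
  · exact Submodule.subset_span (Or.inr rfl)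

end Paths

section Images

variable {V E : Type} [Fintype V] [Fintype E] (Q : ArrowQuiver V E) (I : Finset V)

/-- The image of an arrow in `Π / Π₊ e_I Π₊`. -/
def up (c : E) : RadQuot Q I := radMk Q I (arrow Q (Sum.inl c))

/-- The image of a reversed arrow in `Π / Π₊ e_I Π₊`. -/
def down (c : E) : RadQuot Q I := radMk Q I (arrow Q (Sum.inr c))

variable {Q I}

theorem radMk_inl (c : E) : radMk Q I (arrow Q (Sum.inl c)) = up Q I c := rfl

theorem radMk_inr (c : E) : radMk Q I (arrow Q (Sum.inr c)) = down Q I c := rfl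

theorem up_mul_up {c : E} (h : Q.head c ∈ I) (d : E) : up Q I c * up Q I d = 0 :=
  radMk_arrow_mul_arrow (a := Sum.inl c) h _

theorem up_mul_down {c : E} (h : Q.head c ∈ I) (d : E) : up Q I c * down Q I d = 0 :=
  radMk_arrow_mul_arrow (a := Sum.inl c) h _

theorem down_mul_up {c : E} (h : Q.tail c ∈ I) (d : E) : down Q I c * up Q I d = 0 :=
  radMk_arrow_mul_arrow (a := Sum.inr c) h _

theorem down_mul_down {c : E} (h : Q.tail c ∈ I) (d : E) : down Q I c * down Q I d = 0 :=
  radMk_arrow_mul_arrow (a := Sum.inr c) h _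

variable (Q I) in
theorem up_down_relation [DecidableEq V] (v : V) :
    ∑ c, (if Q.tail c = v then up Q I c * down Q I c else 0) =
      ∑ c, (if Q.head c = v then down Q I c * up Q I c else 0) := by
  have h := congrArg (radMk Q I) (vertex_relation Q v)
  simpa only [map_sum, apply_ite (radMk Q I), map_mul, map_zero, radMk_inl, radMk_inr] using h

end Images

/-! ### Type `Ẽ₇` -/

/-- The quiver of type `Ẽ₇`. -/
def quiverE7 : ArrowQuiver (Fin 8) (Fin 7) where
  tail := ![0, 1, 2, 3, 4, 5, 3]
  head := ![1, 2, 3, 4, 5, 6, 7]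

namespace quiverE7

/-- The arrows. -/
abbrev f (i : Fin 7) : Preproj quiverE7 := arrow quiverE7 (Sum.inl i)

/-- The reversed arrows. -/
abbrev g (i : Fin 7) : Preproj quiverE7 := arrow quiverE7 (Sum.inr i)

theorem tail_eq (c : Fin 7) : quiverE7.tail c = (![0, 1, 2, 3, 4, 5, 3] : Fin 7 → Fin 8) c := rfl

theorem head_eq (c : Fin 7) : quiverE7.head c = (![1, 2, 3, 4, 5, 6, 7] : Fin 7 → Fin 8) c := rfl

/-- The relations at the vertices. -/
structure Rel {R : Type} [Ring R] (F G : Fin 7 → R) : Prop where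
  r0 : F 0 * G 0 = 0
  r1 : F 1 * G 1 = G 0 * F 0
  r2 : F 2 * G 2 = G 1 * F 1
  r3 : F 3 * G 3 + F 6 * G 6 = G 2 * F 2
  r4 : F 4 * G 4 = G 3 * F 3
  r5 : F 5 * G 5 = G 4 * F 4
  r6 : G 5 * F 5 = 0
  r7 : G 6 * F 6 = 0

/-- One direction gives the relations in the quotient of `Π`, the other shows that the matrices
`repMat` define a representation. -/
theorem rel_iff {R : Type} [Ring R] (F G : Fin 7 → R) :
    (∀ v, ∑ c, (if quiverE7.tail c = v then F c * G c else 0) =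
      ∑ c, (if quiverE7.head c = v then G c * F c else 0)) ↔ Rel F G := by
  have key : ∀ P : Fin 8 → Prop, (∀ v, P v) ↔ P 0 ∧ P 1 ∧ P 2 ∧ P 3 ∧ P 4 ∧ P 5 ∧ P 6 ∧ P 7 := by
    intro P
    constructor
    · intro h
      exact ⟨h 0, h 1, h 2, h 3, h 4, h 5, h 6, h 7⟩
    · rintro ⟨h0, h1, h2, h3, h4, h5, h6, h7⟩ v
      fin_cases v <;> assumption
  rw [key]
  simp only [Fin.sum_univ_seven, tail_eq, head_eq]
  simp
  constructor
  · rintro ⟨h0, h1, h2, h3, h4, h5, h6, h7⟩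
    exact ⟨h0, h1, h2, h3, h4, h5, h6.symm, h7.symm⟩
  · rintro ⟨h0, h1, h2, h3, h4, h5, h6, h7⟩
    exact ⟨h0, h1, h2, h3, h4, h5, h6.symm, h7.symm⟩

theorem rel_up_down (I : Finset (Fin 8)) : Rel (up quiverE7 I) (down quiverE7 I) :=
  (rel_iff _ _).1 (up_down_relation quiverE7 I)

/-- The spans of the paths from `0` in terms of the span `S` of those that end at the branching
vertex. -/
def spans {R : Type} [Ring R] [Algebra ℂ R] (F G : Fin 7 → R) (S : Submodule ℂ R) :
    Fin 8 → Submodule ℂ R :=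
  ![mulR S (G 2 * G 1 * G 0), Submodule.span ℂ {F 0} ⊔ mulR S (G 2 * G 1),
    Submodule.span ℂ {F 0 * F 1} ⊔ mulR S (G 2), S, mulR S (F 3), mulR S (F 3 * F 4),
    mulR S (F 3 * F 4 * F 5), mulR S (F 6)]

section

variable {R : Type} [Ring R] [Algebra ℂ R] {F G : Fin 7 → R} (h : Rel F G)
  (h0 : G 0 * F 0 = 0)
include h h0

-- The turn slides back along the arm to `G 0 * F 0`, which passes through `0`.
omit [Algebra ℂ R] in
theorem s_mul_back : F 0 * F 1 * F 2 * G 2 = 0 := by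
  rw [mul_assoc _ (F 2), h.r2, mul_assoc (F 0), ← mul_assoc (F 1), h.r1, h0, zero_mul, mul_zero]

omit [Algebra ℂ R] in
theorem s_mul_x : F 0 * F 1 * F 2 * (G 2 * F 2) = 0 := by
  rw [← mul_assoc, s_mul_back h h0, zero_mul]

variable {S : Submodule ℂ R} (hs : F 0 * F 1 * F 2 ∈ S)
  (hx : ∀ u ∈ S, u * (G 2 * F 2) ∈ S) (hy : ∀ u ∈ S, u * (F 3 * G 3) ∈ S)
  (hz : ∀ u ∈ S, u * (F 6 * G 6) ∈ S)
include hs hx hy hz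

/-- On an arm, the relations at vertices of valency two trade a change of direction for a loop at
the branching vertex. Stability of `S` under the three loops is therefore all that is needed, here
and in `closed_g`. -/
theorem closed_f (c : Fin 7) : ∀ s ∈ spans F G S (quiverE7.tail c),
    s * F c ∈ spans F G S (quiverE7.head c) := by
  match c with
  | 0 =>
    refine mulR_closed fun u hu => ?_
    rw [mul_assoc, mul_assoc _ (G 0), h0, mul_zero, mul_zero]
    exact zero_mem _
  | 1 =>
    refine sup_closed (singleton_closed ?_) (mulR_closed fun u hu => ?_)
    · exact Submodule.mem_sup_left (Submodule.subset_span rfl)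
    · rw [mul_assoc, mul_assoc (G 2), ← h.r2, ← mul_assoc (G 2), ← mul_assoc]
      exact Submodule.mem_sup_right (mul_mem_mulR (hx u hu) _)
  | 2 =>
    refine sup_closed (singleton_closed hs) (mulR_closed fun u hu => ?_)
    rw [mul_assoc]
    exact hx u hu
  | 3 => exact fun u hu => mul_mem_mulR hu _
  | 4 =>
    refine mulR_closed fun u hu => ?_
    rw [mul_assoc]
    exact mul_mem_mulR hu _
  | 5 =>
    refine mulR_closed fun u hu => ?_
    rw [mul_assoc]
    exact mul_mem_mulR hu _
  | 6 => exact fun u hu => mul_mem_mulR hu _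

theorem closed_g (c : Fin 7) : ∀ s ∈ spans F G S (quiverE7.head c),
    s * G c ∈ spans F G S (quiverE7.tail c) := by
  match c with
  | 0 =>
    refine sup_closed (singleton_closed ?_) (mulR_closed fun u hu => ?_)
    · rw [h.r0]
      exact zero_mem _
    · rw [mul_assoc]
      exact mul_mem_mulR hu _
  | 1 =>
    refine sup_closed (singleton_closed ?_) (mulR_closed fun u hu => ?_)
    · rw [mul_assoc, h.r1, h0, mul_zero]
      exact zero_mem _
    · rw [mul_assoc]
      exact Submodule.mem_sup_right (mul_mem_mulR hu _)
  | 2 => exact fun u hu => Submodule.mem_sup_right (mul_mem_mulR hu _)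
  | 3 =>
    refine mulR_closed fun u hu => ?_
    rw [mul_assoc]
    exact hy u hu
  | 4 =>
    refine mulR_closed fun u hu => ?_
    rw [mul_assoc, mul_assoc (F 3), h.r4, ← mul_assoc (F 3), ← mul_assoc]
    exact mul_mem_mulR (hy u hu) _
  | 5 =>
    refine mulR_closed fun u hu => ?_
    have h5 : F 3 * F 4 * (F 5 * G 5) = F 3 * G 3 * (F 3 * F 4) := by
      rw [h.r5, ← mul_assoc, mul_assoc (F 3), h.r4]
      simp only [mul_assoc]
    rw [mul_assoc, mul_assoc (F 3 * F 4), h5, ← mul_assoc]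
    exact mul_mem_mulR (hy u hu) _
  | 6 =>
    refine mulR_closed fun u hu => ?_
    rw [mul_assoc]
    exact hz u hu

end

section

variable {I : Finset (Fin 8)}

theorem mem_spans (h0 : 0 ∈ I) {S : Submodule ℂ (RadQuot quiverE7 I)}
    (hs : up quiverE7 I 0 * up quiverE7 I 1 * up quiverE7 I 2 ∈ S)
    (hxyz : (∀ u ∈ S, u * (down quiverE7 I 2 * up quiverE7 I 2) ∈ S) ∧
      (∀ u ∈ S, u * (up quiverE7 I 3 * down quiverE7 I 3) ∈ S) ∧
      (∀ u ∈ S, u * (up quiverE7 I 6 * down quiverE7 I 6) ∈ S))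
    {z : Preproj quiverE7} (hz : z ∈ posPart quiverE7) (j : Fin 8) :
    radMk quiverE7 I (idem quiverE7 0 * z * idem quiverE7 j) ∈
      spans (up quiverE7 I) (down quiverE7 I) S j := by
  have h00 : down quiverE7 I 0 * up quiverE7 I 0 = 0 := down_mul_up h0 _
  refine map_mem_of_closed _ (radMk quiverE7 I) 0 _ ?_ ?_ hz j
  · rintro (c | c) hc
    · have : c = 0 := by
        revert hc
        change quiverE7.tail c = 0 → c = 0
        revert c
        decide
      subst this
      exact Submodule.mem_sup_left (Submodule.subset_span rfl)
    · exfalso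
      revert hc
      change quiverE7.head c = 0 → False
      revert c
      decide
  · rintro (c | c)
    · exact closed_f (rel_up_down I) h00 hs hxyz.1 hxyz.2.1 hxyz.2.2 c
    · exact closed_g (rel_up_down I) h00 hs hxyz.1 hxyz.2.1 hxyz.2.2 c

theorem f_mem (i : Fin 7) : f i ∈ posPart quiverE7 := arrow_mem_posPart _ _

end

section

variable {R : Type} [Ring R] {F G : Fin 7 → R} (h : Rel F G)
include h

theorem loop_four : F 3 * G 3 * F 3 = F 3 * (F 4 * G 4) := by rw [h.r4, mul_assoc]

theorem loop_five : F 3 * G 3 * (F 3 * F 4) = F 3 * F 4 * (F 5 * G 5) := by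
  rw [h.r5, ← mul_assoc (F 3 * G 3), loop_four h]
  simp only [mul_assoc]

theorem zz : F 6 * G 6 * (F 6 * G 6) = 0 := by
  rw [mul_assoc, ← mul_assoc (G 6), h.r7, zero_mul, mul_zero]

/-- Sliding the middle loop outwards exposes `F 3 * G 3 * (F 3 * F 4)`, the loop that has reached `k
= 6`. -/
theorem yyy (hy : F 3 * G 3 * (F 3 * F 4) = 0) :
    F 3 * G 3 * (F 3 * G 3) * (F 3 * G 3) = 0 := by
  have e : F 3 * G 3 * (F 3 * (F 4 * G 4) * G 3) = F 3 * G 3 * (F 3 * F 4) * G 4 * G 3 := by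
    simp only [mul_assoc]
  rw [mul_assoc (F 3 * G 3), ← mul_assoc (F 3 * G 3) (F 3), loop_four h, e, hy, zero_mul, zero_mul]

variable (h0 : G 0 * F 0 = 0)
include h0

theorem straight_mul : F 0 * F 1 * F 2 * (F 3 * G 3) + F 0 * F 1 * F 2 * (F 6 * G 6) = 0 := by
  rw [← mul_add, h.r3, s_mul_x h h0]

/-- The arm towards `0` has length three, and three nested turns reach `G 0 * F 0`. -/
theorem xxx : G 2 * F 2 * (G 2 * F 2) * (G 2 * F 2) = 0 := by
  have e1 : F 2 * G 2 * F 2 * G 2 = G 1 * (F 1 * G 1) * F 1 := by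
    rw [h.r2, mul_assoc _ (F 2), h.r2]
    simp only [mul_assoc]
  have e2 : G 2 * F 2 * (G 2 * F 2) * (G 2 * F 2) = G 2 * (F 2 * G 2 * F 2 * G 2) * F 2 := by
    simp only [mul_assoc]
  rw [e2, e1, h.r1, h0, mul_zero, zero_mul, mul_zero, zero_mul]

theorem straight_mul_back : F 0 * F 1 * F 2 * (G 2 * G 1 * G 0) = 0 := by
  rw [← mul_assoc, ← mul_assoc, s_mul_back h h0, zero_mul, zero_mul]

theorem loop_mul_back : G 2 * F 2 * (G 2 * G 1 * G 0) = 0 := by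
  have e : G 2 * F 2 * (G 2 * G 1 * G 0) = G 2 * (F 2 * G 2) * G 1 * G 0 := by
    simp only [mul_assoc]
  have e' : G 2 * (G 1 * F 1) * G 1 * G 0 = G 2 * G 1 * (F 1 * G 1) * G 0 := by
    simp only [mul_assoc]
  rw [e, h.r2, e', h.r1, h0, mul_zero, zero_mul]

end

/-- The basis for `Ẽ₇` and a vertex `k`, from a stable space `S` of paths to the branching vertex. -/
theorem nonempty_of_thin {k : Fin 8} {δ : Prop} (hδ : ¬ δ) (p q : Preproj quiverE7)
    (hp : p ∈ posPart quiverE7) (S : Submodule ℂ (RadQuot quiverE7 {0, k}))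
    (hs : up quiverE7 {0, k} 0 * up quiverE7 {0, k} 1 * up quiverE7 {0, k} 2 ∈ S)
    (hxyz : (∀ u ∈ S, u * (down quiverE7 {0, k} 2 * up quiverE7 {0, k} 2) ∈ S) ∧
      (∀ u ∈ S, u * (up quiverE7 {0, k} 3 * down quiverE7 {0, k} 3) ∈ S) ∧
      (∀ u ∈ S, u * (up quiverE7 {0, k} 6 * down quiverE7 {0, k} 6) ∈ S))
    (hk : spans (up quiverE7 {0, k}) (down quiverE7 {0, k}) S k ≤
      Submodule.span ℂ {radMk quiverE7 {0, k} p})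
    (ho : mulR S (down quiverE7 {0, k} 2 * down quiverE7 {0, k} 1 * down quiverE7 {0, k} 0) ≤
      Submodule.span ℂ {radMk quiverE7 {0, k} q}) :
    Nonempty (ArrowBasis quiverE7 0 k δ) :=
  ⟨arrowBasisOfThin hδ p q hp (spans (up quiverE7 {0, k}) (down quiverE7 {0, k}) S)
    (fun _ hz' j => mem_spans (Finset.mem_insert_self _ _) hs hxyz hz' j) hk ho⟩

/-- The basis for `Ẽ₇` and a vertex `k` such that the straight path spans all paths from `0` to the
branching vertex. -/
theorem nonempty_of_straight {k : Fin 8} {δ : Prop} (hδ : ¬ δ) (p : Preproj quiverE7)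
    (hp : p ∈ posPart quiverE7)
    (hy : up quiverE7 {0, k} 0 * up quiverE7 {0, k} 1 * up quiverE7 {0, k} 2 *
      (up quiverE7 {0, k} 3 * down quiverE7 {0, k} 3) = 0)
    (hz : up quiverE7 {0, k} 0 * up quiverE7 {0, k} 1 * up quiverE7 {0, k} 2 *
      (up quiverE7 {0, k} 6 * down quiverE7 {0, k} 6) = 0)
    (h : spans (up quiverE7 {0, k}) (down quiverE7 {0, k})
      (Submodule.span ℂ {up quiverE7 {0, k} 0 * up quiverE7 {0, k} 1 * up quiverE7 {0, k} 2}) k ≤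
      Submodule.span ℂ {radMk quiverE7 {0, k} p}) :
    Nonempty (ArrowBasis quiverE7 0 k δ) := by
  have h00 : down quiverE7 {0, k} 0 * up quiverE7 {0, k} 0 = 0 :=
    down_mul_up (show (0 : Fin 8) ∈ ({0, k} : Finset (Fin 8)) from Finset.mem_insert_self _ _) _
  have hr := rel_up_down {0, k}
  exact nonempty_of_thin hδ p 0 hp _ (Submodule.mem_span_singleton_self _)
    (loops_one (s_mul_x hr h00) hy hz) h (mulR_one (straight_mul_back hr h00))

theorem nonempty_one {δ : Prop} (hδ : ¬ δ) : Nonempty (ArrowBasis quiverE7 0 1 δ) := by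
  have h : up quiverE7 {0, 1} 0 * up quiverE7 {0, 1} 1 = 0 := up_mul_up (by decide) _
  refine nonempty_of_straight hδ (f 0) (f_mem 0) (by simp [h]) (by simp [h]) ?_
  refine sup_le le_rfl ?_
  simp [h, mulR_bot]

theorem nonempty_two {δ : Prop} (hδ : ¬ δ) : Nonempty (ArrowBasis quiverE7 0 2 δ) := by
  have h : up quiverE7 {0, 2} 1 * up quiverE7 {0, 2} 2 = 0 := up_mul_up (by decide) _
  have h' : up quiverE7 {0, 2} 0 * up quiverE7 {0, 2} 1 * up quiverE7 {0, 2} 2 = 0 := by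
    rw [mul_assoc, h, mul_zero]
  refine nonempty_of_straight hδ (f 0 * f 1) (mul_mem_posPart_left _ (f_mem 1))
    (by rw [h', zero_mul]) (by rw [h', zero_mul]) ?_
  refine sup_le (by rw [map_mul]; exact le_rfl) ?_
  simp [h', mulR_bot]

theorem nonempty_three {δ : Prop} (hδ : ¬ δ) : Nonempty (ArrowBasis quiverE7 0 3 δ) := by
  have h : ∀ c, up quiverE7 {0, 3} 2 * up quiverE7 {0, 3} c = 0 := up_mul_up (by decide)
  refine nonempty_of_straight hδ (f 0 * f 1 * f 2) (mul_mem_posPart_left _ (f_mem 2))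
    ?_ ?_ (by simp only [map_mul]; exact le_rfl) <;>
  rw [← mul_assoc, mul_assoc _ (up _ _ 2), h, mul_zero, zero_mul]

/-- The loop `y` passes through `k`, which is adjacent to the branching vertex; then `s y + s z = 0`
leaves no `s z` either. The vertex `7` is treated alike with `z`. -/
theorem nonempty_four {δ : Prop} (hδ : ¬ δ) : Nonempty (ArrowBasis quiverE7 0 4 δ) := by
  have hy : up quiverE7 {0, 4} 0 * up quiverE7 {0, 4} 1 * up quiverE7 {0, 4} 2 *
      (up quiverE7 {0, 4} 3 * down quiverE7 {0, 4} 3) = 0 := by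
    rw [up_mul_down (c := 3) (by decide), mul_zero]
  have hz := straight_mul (rel_up_down {0, 4}) (down_mul_up (by decide) _)
  rw [hy, zero_add] at hz
  refine nonempty_of_straight hδ (f 0 * f 1 * f 2 * f 3) (mul_mem_posPart_left _ (f_mem 3)) hy hz ?_
  refine mulR_span_le ?_
  rintro _ rfl
  simp only [map_mul]
  exact Submodule.subset_span rfl

theorem nonempty_seven {δ : Prop} (hδ : ¬ δ) : Nonempty (ArrowBasis quiverE7 0 7 δ) := by
  have hz : up quiverE7 {0, 7} 0 * up quiverE7 {0, 7} 1 * up quiverE7 {0, 7} 2 *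
      (up quiverE7 {0, 7} 6 * down quiverE7 {0, 7} 6) = 0 := by
    rw [up_mul_down (c := 6) (by decide), mul_zero]
  have hy := straight_mul (rel_up_down {0, 7}) (down_mul_up (by decide) _)
  rw [hz, add_zero] at hy
  refine nonempty_of_straight hδ (f 0 * f 1 * f 2 * f 6) (mul_mem_posPart_left _ (f_mem 6)) hy hz ?_
  refine mulR_span_le ?_
  rintro _ rfl
  simp only [map_mul]
  exact Submodule.subset_span rfl

/-- The loop `y` slides one step along its arm and meets `k`. Thus `y² = 0`, and `y` dies on the way
to `k`, where only the straight path remains; the word `s y` still contributes the loop at `0`. -/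
theorem nonempty_five {δ : Prop} (hδ : ¬ δ) : Nonempty (ArrowBasis quiverE7 0 5 δ) := by
  have h00 : down quiverE7 {0, 5} 0 * up quiverE7 {0, 5} 0 = 0 := down_mul_up (by decide) _
  have hr := rel_up_down {0, 5}
  have hyf := loop_four hr
  rw [up_mul_down (c := 4) (by decide), mul_zero] at hyf
  refine nonempty_of_thin hδ (f 0 * f 1 * f 2 * (f 3 * f 4))
    (f 0 * f 1 * f 2 * (f 3 * g 3) * (g 2 * g 1 * g 0))
    (mul_mem_posPart_left _ (mul_mem_posPart_left _ (f_mem 4))) _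
    (Submodule.subset_span (Set.mem_insert _ _))
    (loops_two (s_mul_x hr h00) hr.r3.symm (by rw [← mul_assoc, hyf, zero_mul]) (zz hr)) ?_ ?_
  · simp only [map_mul, radMk_inl]
    exact mulR_two_forth (by rw [← mul_assoc, hyf, zero_mul])
  · simp only [map_mul, radMk_inl, radMk_inr]
    exact mulR_two_back (straight_mul_back hr h00)

/-- A representation with two linearly independent paths from `0` to `6`. -/
def repMat : Fin 7 ⊕ Fin 7 → Matrix (Fin 4) (Fin 4) ℂ :=
  Sum.elim
    ![mUnit 0 0, mUnit 0 0 + mUnit 1 2, mUnit 0 0 + mUnit 1 2 + mUnit 2 3,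
      mUnit 0 0 + mUnit 1 1 + mUnit 3 3, mUnit 0 0 + mUnit 3 3, mUnit 0 0 + mUnit 3 3,
      mUnit 0 0 + mUnit 2 2]
    ![0, mUnit 1 1, mUnit 1 1 + mUnit 2 2, mUnit 0 1 + mUnit 1 2, mUnit 0 1, 0,
      - mUnit 0 1 + mUnit 2 3]

/-- At the branching vertex the four row vectors model the basis `s`, `s y`, `s y²`, `s y² z` of
`loops_four`: there `y` acts as `mUnit 0 1 + mUnit 1 2`, `z` as `- mUnit 0 1 + mUnit 2 3`, and `x`
as their sum. -/
theorem repMat_rel : Rel (fun i => repMat (Sum.inl i)) (fun i => repMat (Sum.inr i)) := by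
  constructor <;> simp [repMat, add_mul, mul_add]
  abel

theorem repMat_mul (a b : Fin 7 ⊕ Fin 7)
    (ha : quiverE7.double.head a ∈ ({0, 6} : Finset (Fin 8)))
    (hab : quiverE7.double.head a = quiverE7.double.tail b) : repMat a * repMat b = 0 := by
  have h1 : ∀ a b : Fin 7 ⊕ Fin 7, quiverE7.double.head a ∈ ({0, 6} : Finset (Fin 8)) →
      quiverE7.double.head a = quiverE7.double.tail b → a = Sum.inr 0 ∨ b = Sum.inr 5 := by
    decide
  rcases h1 a b ha hab with rfl | rfl <;> simp [repMat]

theorem rep_f (i : Fin 7) : rep repMat ((rel_iff _ _).2 repMat_rel) (f i) =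
    Matrix.single ((![0, 1, 2, 3, 4, 5, 3] : Fin 7 → Fin 8) i)
      ((![1, 2, 3, 4, 5, 6, 7] : Fin 7 → Fin 8) i) (repMat (Sum.inl i)) :=
  rep_arrow _ _ _

theorem rep_g (i : Fin 7) : rep repMat ((rel_iff _ _).2 repMat_rel) (g i) =
    Matrix.single ((![1, 2, 3, 4, 5, 6, 7] : Fin 7 → Fin 8) i)
      ((![0, 1, 2, 3, 4, 5, 3] : Fin 7 → Fin 8) i) (repMat (Sum.inr i)) :=
  rep_arrow _ _ _

/-- On the way to `k = 6` the words `s y` and `s y²` die, because `y` slides to `k`; the words `s`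
and `s y² z` survive. -/
theorem nonempty_six {δ : Prop} (hδ : δ) : Nonempty (ArrowBasis quiverE7 0 6 δ) := by
  have h00 : down quiverE7 {0, 6} 0 * up quiverE7 {0, 6} 0 = 0 := down_mul_up (by decide) _
  have hr := rel_up_down {0, 6}
  have hyf := loop_five hr
  rw [up_mul_down (c := 5) (by decide), mul_zero] at hyf
  have hw := loops_four (s_mul_x hr h00) hr.r3.symm (xxx hr h00) (yyy hr hyf) (zz hr)
  have hspan := fun z (hz : z ∈ posPart quiverE7) =>
    mem_spans (by decide) (Submodule.subset_span (Or.inl rfl)) hw hz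
  refine ⟨{
    p₁ := f 0 * f 1 * f 2 * (f 3 * f 4 * f 5)
    p₂ := f 0 * f 1 * f 2 * (f 3 * g 3) * (f 3 * g 3) * (f 6 * g 6) * (f 3 * f 4 * f 5)
    q := f 0 * f 1 * f 2 * (f 3 * g 3) * (g 2 * g 1 * g 0)
    p₁_mem := mul_mem_posPart_left _ (mul_mem_posPart_left _ (f_mem 5))
    p₂_mem := mul_mem_posPart_left _ (mul_mem_posPart_left _ (f_mem 5))
    span_eq := fun z hz => by
      simp only [map_mul, radMk_inl, radMk_inr]
      have h := mulR_four_forth (by rw [← mul_assoc, hyf, zero_mul]) (hspan z hz 6)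
      simpa only [map_mul] using h
    span_zero := fun z hz => by
      have h := mulR_four_back (straight_mul_back hr h00) (loop_mul_back hr h00) (s_mul_x hr h00)
        hr.r3.symm (yyy hr hyf) (zz hr) (hspan z hz 0)
      simpa only [map_mul, radMk_inl, radMk_inr] using h
    eq_zero := fun h => absurd hδ h
    factor := fun _ l hl hl' => ?_
    indep := fun _ => linearIndependent_of_rep (x₁ := mUnit 0 0) (x₂ := mUnit 0 3)
      ((rel_iff _ _).2 repMat_rel) repMat_mul ?_ ?_ (linearIndependent_mUnit (by decide)) }⟩
  -- The straight path `p₁` visits `1, …, 5`, and the loop `f 6 * g 6` in `p₂` visits `7`.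
  · have hl7 : l = 1 ∨ l = 2 ∨ l = 3 ∨ l = 4 ∨ l = 5 ∨ l = 7 := by
      revert l
      decide
    simp only [map_mul, radMk_inl, radMk_inr]
    rcases hl7 with rfl | rfl | rfl | rfl | rfl | rfl
    · left
      rw [up_mul_up (c := 0) (by decide), zero_mul, zero_mul]
    · left
      rw [mul_assoc (up _ _ 0), up_mul_up (c := 1) (by decide), mul_zero, zero_mul]
    · left
      rw [mul_assoc _ (up _ _ 2), ← mul_assoc (up _ _ 2), ← mul_assoc (up _ _ 2),
        up_mul_up (c := 2) (by decide), zero_mul, zero_mul, mul_zero]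
    · left
      rw [up_mul_up (c := 3) (by decide), zero_mul, mul_zero]
    · left
      rw [mul_assoc (up _ _ 3), up_mul_up (c := 4) (by decide), mul_zero, mul_zero]
    · right
      rw [up_mul_down (c := 6) (by decide), mul_zero, zero_mul]
  · simp only [map_mul, rep_f]
    simp [repMat, add_mul, mul_add]
  · simp only [map_mul, rep_f, rep_g]
    simp [repMat, add_mul, mul_add]

theorem nonempty_arrowBasis (k : Fin 8) (hk : k ≠ 0) :
    Nonempty (ArrowBasis quiverE7 0 k (k = 6)) := by
  have h : k = 1 ∨ k = 2 ∨ k = 3 ∨ k = 4 ∨ k = 5 ∨ k = 6 ∨ k = 7 := by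
    revert k
    decide
  rcases h with rfl | rfl | rfl | rfl | rfl | rfl | rfl
  · exact nonempty_one (by decide)
  · exact nonempty_two (by decide)
  · exact nonempty_three (by decide)
  · exact nonempty_four (by decide)
  · exact nonempty_five (by decide)
  · exact nonempty_six rfl
  · exact nonempty_seven (by decide)

end quiverE7

/-! ### Type `Ẽ₈` -/

/-- The quiver of type `Ẽ₈`. -/
def quiverE8 : ArrowQuiver (Fin 9) (Fin 8) where
  tail := ![0, 1, 2, 3, 4, 5, 6, 5]
  head := ![1, 2, 3, 4, 5, 6, 7, 8]

namespace quiverE8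

/-- The arrows. -/
abbrev f (i : Fin 8) : Preproj quiverE8 := arrow quiverE8 (Sum.inl i)

/-- The reversed arrows. -/
abbrev g (i : Fin 8) : Preproj quiverE8 := arrow quiverE8 (Sum.inr i)

theorem tail_eq (c : Fin 8) : quiverE8.tail c = (![0, 1, 2, 3, 4, 5, 6, 5] : Fin 8 → Fin 9) c :=
  rfl

theorem head_eq (c : Fin 8) : quiverE8.head c = (![1, 2, 3, 4, 5, 6, 7, 8] : Fin 8 → Fin 9) c :=
  rfl

/-- The relations at the vertices. -/
structure Rel {R : Type} [Ring R] (F G : Fin 8 → R) : Prop where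
  r0 : F 0 * G 0 = 0
  r1 : F 1 * G 1 = G 0 * F 0
  r2 : F 2 * G 2 = G 1 * F 1
  r3 : F 3 * G 3 = G 2 * F 2
  r4 : F 4 * G 4 = G 3 * F 3
  r5 : F 5 * G 5 + F 7 * G 7 = G 4 * F 4
  r6 : F 6 * G 6 = G 5 * F 5
  r7 : G 6 * F 6 = 0
  r8 : G 7 * F 7 = 0

theorem rel_of_sum {R : Type} [Ring R] {F G : Fin 8 → R}
    (h : ∀ v, ∑ c, (if quiverE8.tail c = v then F c * G c else 0) =
      ∑ c, (if quiverE8.head c = v then G c * F c else 0)) : Rel F G := by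
  have h0 := h 0
  have h1 := h 1
  have h2 := h 2
  have h3 := h 3
  have h4 := h 4
  have h5 := h 5
  have h6 := h 6
  have h7 := h 7
  have h8 := h 8
  simp only [Fin.sum_univ_eight, tail_eq, head_eq] at h0 h1 h2 h3 h4 h5 h6 h7 h8
  simp at h0 h1 h2 h3 h4 h5 h6 h7 h8
  exact ⟨h0, h1, h2, h3, h4, h5, h6, h7.symm, h8.symm⟩

theorem rel_up_down (I : Finset (Fin 9)) : Rel (up quiverE8 I) (down quiverE8 I) :=
  rel_of_sum (up_down_relation quiverE8 I)

/-- The spans of the paths from `0` in terms of the span `S` of those that end at the branching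
vertex. -/
def spans {R : Type} [Ring R] [Algebra ℂ R] (F G : Fin 8 → R) (S : Submodule ℂ R) :
    Fin 9 → Submodule ℂ R :=
  ![mulR S (G 4 * G 3 * G 2 * G 1 * G 0), Submodule.span ℂ {F 0} ⊔ mulR S (G 4 * G 3 * G 2 * G 1),
    Submodule.span ℂ {F 0 * F 1} ⊔ mulR S (G 4 * G 3 * G 2),
    Submodule.span ℂ {F 0 * F 1 * F 2} ⊔ mulR S (G 4 * G 3),
    Submodule.span ℂ {F 0 * F 1 * F 2 * F 3} ⊔ mulR S (G 4), S, mulR S (F 5), mulR S (F 5 * F 6),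
    mulR S (F 7)]

section

variable {R : Type} [Ring R] {F G : Fin 8 → R} (h : Rel F G)
include h

/-- On the long arm, a step forwards after the way back becomes a loop `x` at the branching vertex
followed by a shorter way back; the next two lemmas repeat this further out. -/
theorem back_three : G 4 * G 3 * F 3 = G 4 * F 4 * G 4 := by
  rw [mul_assoc, ← h.r4, mul_assoc]

theorem back_two : G 4 * G 3 * G 2 * F 2 = G 4 * F 4 * (G 4 * G 3) := by
  rw [mul_assoc, ← h.r3, ← mul_assoc, back_three h, mul_assoc]

theorem back_one : G 4 * G 3 * G 2 * G 1 * F 1 = G 4 * F 4 * (G 4 * G 3 * G 2) := by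
  rw [mul_assoc, ← h.r2, ← mul_assoc, back_two h, mul_assoc]

theorem loop_six : F 5 * G 5 * F 5 = F 5 * (F 6 * G 6) := by rw [h.r6, mul_assoc]

theorem zz : F 7 * G 7 * (F 7 * G 7) = 0 := by
  rw [mul_assoc, ← mul_assoc (G 7), h.r8, zero_mul, mul_zero]

variable (h0 : G 0 * F 0 = 0)
include h0

theorem forth_one : F 0 * F 1 * G 1 = 0 := by
  rw [mul_assoc, h.r1, h0, mul_zero]

theorem forth_two : F 0 * F 1 * F 2 * G 2 = 0 := by
  rw [mul_assoc, h.r2, ← mul_assoc, forth_one h h0, zero_mul]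

theorem forth_three : F 0 * F 1 * F 2 * F 3 * G 3 = 0 := by
  rw [mul_assoc, h.r3, ← mul_assoc, forth_two h h0, zero_mul]

theorem forth_four : F 0 * F 1 * F 2 * F 3 * F 4 * G 4 = 0 := by
  rw [mul_assoc, h.r4, ← mul_assoc, forth_three h h0, zero_mul]

theorem s_mul_x : F 0 * F 1 * F 2 * F 3 * F 4 * (G 4 * F 4) = 0 := by
  rw [← mul_assoc, forth_four h h0, zero_mul]

theorem straight_mul_back :
    F 0 * F 1 * F 2 * F 3 * F 4 * (G 4 * G 3 * G 2 * G 1 * G 0) = 0 := by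
  simp only [← mul_assoc]
  rw [forth_four h h0]
  simp only [zero_mul]

theorem straight_mul : F 0 * F 1 * F 2 * F 3 * F 4 * (F 5 * G 5) +
    F 0 * F 1 * F 2 * F 3 * F 4 * (F 7 * G 7) = 0 := by
  rw [← mul_add, h.r5, s_mul_x h h0]

end

section

variable {R : Type} [Ring R] [Algebra ℂ R] {F G : Fin 8 → R} (h : Rel F G)
  (h0 : G 0 * F 0 = 0) {S : Submodule ℂ R} (hs : F 0 * F 1 * F 2 * F 3 * F 4 ∈ S)
  (hx : ∀ u ∈ S, u * (G 4 * F 4) ∈ S) (hy : ∀ u ∈ S, u * (F 5 * G 5) ∈ S)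
  (hz : ∀ u ∈ S, u * (F 7 * G 7) ∈ S)
include h h0 hs hx hy hz

theorem closed_f (c : Fin 8) : ∀ s ∈ spans F G S (quiverE8.tail c),
    s * F c ∈ spans F G S (quiverE8.head c) := by
  match c with
  | 0 =>
    refine mulR_closed fun u hu => mem_of_eq_zero ?_
    rw [mul_assoc, mul_assoc _ (G 0), h0, mul_zero, mul_zero]
  | 1 =>
    refine sup_closed (singleton_closed ?_) (mulR_closed fun u hu => ?_)
    · exact Submodule.mem_sup_left (Submodule.subset_span rfl)
    · rw [mul_assoc, back_one h, ← mul_assoc]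
      exact Submodule.mem_sup_right (mul_mem_mulR (hx u hu) _)
  | 2 =>
    refine sup_closed (singleton_closed ?_) (mulR_closed fun u hu => ?_)
    · exact Submodule.mem_sup_left (Submodule.subset_span rfl)
    · rw [mul_assoc, back_two h, ← mul_assoc]
      exact Submodule.mem_sup_right (mul_mem_mulR (hx u hu) _)
  | 3 =>
    refine sup_closed (singleton_closed ?_) (mulR_closed fun u hu => ?_)
    · exact Submodule.mem_sup_left (Submodule.subset_span rfl)
    · rw [mul_assoc, back_three h, ← mul_assoc]
      exact Submodule.mem_sup_right (mul_mem_mulR (hx u hu) _)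
  | 4 =>
    refine sup_closed (singleton_closed hs) (mulR_closed fun u hu => ?_)
    rw [mul_assoc]
    exact hx u hu
  | 5 => exact fun u hu => mul_mem_mulR hu _
  | 6 =>
    refine mulR_closed fun u hu => ?_
    rw [mul_assoc]
    exact mul_mem_mulR hu _
  | 7 => exact fun u hu => mul_mem_mulR hu _

theorem closed_g (c : Fin 8) : ∀ s ∈ spans F G S (quiverE8.head c),
    s * G c ∈ spans F G S (quiverE8.tail c) := by
  match c with
  | 0 =>
    refine sup_closed (singleton_closed (mem_of_eq_zero h.r0)) (mulR_closed fun u hu => ?_)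
    rw [mul_assoc]
    exact mul_mem_mulR hu _
  | 1 =>
    refine sup_closed (singleton_closed (mem_of_eq_zero (forth_one h h0)))
      (mulR_closed fun u hu => ?_)
    rw [mul_assoc]
    exact Submodule.mem_sup_right (mul_mem_mulR hu _)
  | 2 =>
    refine sup_closed (singleton_closed (mem_of_eq_zero (forth_two h h0)))
      (mulR_closed fun u hu => ?_)
    rw [mul_assoc]
    exact Submodule.mem_sup_right (mul_mem_mulR hu _)
  | 3 =>
    refine sup_closed (singleton_closed (mem_of_eq_zero (forth_three h h0)))
      (mulR_closed fun u hu => ?_)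
    rw [mul_assoc]
    exact Submodule.mem_sup_right (mul_mem_mulR hu _)
  | 4 => exact fun u hu => Submodule.mem_sup_right (mul_mem_mulR hu _)
  | 5 =>
    refine mulR_closed fun u hu => ?_
    rw [mul_assoc]
    exact hy u hu
  | 6 =>
    refine mulR_closed fun u hu => ?_
    rw [mul_assoc, mul_assoc (F 5), ← loop_six h, ← mul_assoc]
    exact mul_mem_mulR (hy u hu) _
  | 7 =>
    refine mulR_closed fun u hu => ?_
    rw [mul_assoc]
    exact hz u hu

end

theorem f_mem (i : Fin 8) : f i ∈ posPart quiverE8 := arrow_mem_posPart _ _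

/-- The straight path to the branching vertex. -/
def straight (I : Finset (Fin 9)) : RadQuot quiverE8 I :=
  up quiverE8 I 0 * up quiverE8 I 1 * up quiverE8 I 2 * up quiverE8 I 3 * up quiverE8 I 4

theorem mem_spans {I : Finset (Fin 9)} (h0 : 0 ∈ I) {S : Submodule ℂ (RadQuot quiverE8 I)}
    (hs : straight I ∈ S)
    (hxyz : (∀ u ∈ S, u * (down quiverE8 I 4 * up quiverE8 I 4) ∈ S) ∧
      (∀ u ∈ S, u * (up quiverE8 I 5 * down quiverE8 I 5) ∈ S) ∧
      (∀ u ∈ S, u * (up quiverE8 I 7 * down quiverE8 I 7) ∈ S))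
    {z : Preproj quiverE8} (hz : z ∈ posPart quiverE8) (j : Fin 9) :
    radMk quiverE8 I (idem quiverE8 0 * z * idem quiverE8 j) ∈
      spans (up quiverE8 I) (down quiverE8 I) S j := by
  have h00 : down quiverE8 I 0 * up quiverE8 I 0 = 0 := down_mul_up h0 _
  refine map_mem_of_closed _ (radMk quiverE8 I) 0 _ ?_ ?_ hz j
  · rintro (c | c) hc
    · have : c = 0 := by
        revert hc
        change quiverE8.tail c = 0 → c = 0
        revert c
        decide
      subst this
      exact Submodule.mem_sup_left (Submodule.subset_span rfl)
    · exfalso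
      revert hc
      change quiverE8.head c = 0 → False
      revert c
      decide
  · rintro (c | c)
    · exact closed_f (rel_up_down I) h00 hs hxyz.1 hxyz.2.1 hxyz.2.2 c
    · exact closed_g (rel_up_down I) h00 hs hxyz.1 hxyz.2.1 hxyz.2.2 c

/-- The basis for `Ẽ₈` and a vertex `k`, from a stable space `S` of paths to the branching vertex. -/
theorem nonempty_of_thin {k : Fin 9} {δ : Prop} (hδ : ¬ δ) (p q : Preproj quiverE8)
    (hp : p ∈ posPart quiverE8) (S : Submodule ℂ (RadQuot quiverE8 {0, k}))
    (hs : straight {0, k} ∈ S)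
    (hxyz : (∀ u ∈ S, u * (down quiverE8 {0, k} 4 * up quiverE8 {0, k} 4) ∈ S) ∧
      (∀ u ∈ S, u * (up quiverE8 {0, k} 5 * down quiverE8 {0, k} 5) ∈ S) ∧
      (∀ u ∈ S, u * (up quiverE8 {0, k} 7 * down quiverE8 {0, k} 7) ∈ S))
    (hk : spans (up quiverE8 {0, k}) (down quiverE8 {0, k}) S k ≤
      Submodule.span ℂ {radMk quiverE8 {0, k} p})
    (ho : mulR S (down quiverE8 {0, k} 4 * down quiverE8 {0, k} 3 * down quiverE8 {0, k} 2 *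
      down quiverE8 {0, k} 1 * down quiverE8 {0, k} 0) ≤
      Submodule.span ℂ {radMk quiverE8 {0, k} q}) :
    Nonempty (ArrowBasis quiverE8 0 k δ) :=
  ⟨arrowBasisOfThin hδ p q hp (spans (up quiverE8 {0, k}) (down quiverE8 {0, k}) S)
    (fun _ hz' j => mem_spans (Finset.mem_insert_self _ _) hs hxyz hz' j) hk ho⟩

/-- The basis for `Ẽ₈` and a vertex `k` such that the straight path spans all paths from `0` to the
branching vertex. -/
theorem nonempty_of_straight {k : Fin 9} {δ : Prop} (hδ : ¬ δ) (p : Preproj quiverE8)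
    (hp : p ∈ posPart quiverE8)
    (hy : straight {0, k} * (up quiverE8 {0, k} 5 * down quiverE8 {0, k} 5) = 0)
    (hz : straight {0, k} * (up quiverE8 {0, k} 7 * down quiverE8 {0, k} 7) = 0)
    (h : spans (up quiverE8 {0, k}) (down quiverE8 {0, k})
      (Submodule.span ℂ {straight {0, k}}) k ≤ Submodule.span ℂ {radMk quiverE8 {0, k} p}) :
    Nonempty (ArrowBasis quiverE8 0 k δ) := by
  have h00 : down quiverE8 {0, k} 0 * up quiverE8 {0, k} 0 = 0 :=
    down_mul_up (show (0 : Fin 9) ∈ ({0, k} : Finset (Fin 9)) from Finset.mem_insert_self _ _) _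
  have hr := rel_up_down {0, k}
  exact nonempty_of_thin hδ p 0 hp _ (Submodule.mem_span_singleton_self _)
    (loops_one (s_mul_x hr h00) hy hz) h (mulR_one (straight_mul_back hr h00))

theorem mulR_straight_le {I : Finset (Fin 9)} (h : straight I = 0) {b : RadQuot quiverE8 I}
    {T : Submodule ℂ (RadQuot quiverE8 I)} : mulR (Submodule.span ℂ {straight I}) b ≤ T :=
  mulR_one (by rw [h, zero_mul])

theorem nonempty_one {δ : Prop} (hδ : ¬ δ) : Nonempty (ArrowBasis quiverE8 0 1 δ) := by
  have h : straight {0, 1} = 0 := by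
    rw [straight, up_mul_up (c := 0) (by decide)]
    simp only [zero_mul]
  exact nonempty_of_straight hδ (f 0) (f_mem 0) (by rw [h, zero_mul]) (by rw [h, zero_mul])
    (sup_le le_rfl (mulR_straight_le h))

theorem nonempty_two {δ : Prop} (hδ : ¬ δ) : Nonempty (ArrowBasis quiverE8 0 2 δ) := by
  have h : straight {0, 2} = 0 := by
    rw [straight, mul_assoc (up _ _ 0), up_mul_up (c := 1) (by decide)]
    simp only [zero_mul, mul_zero]
  exact nonempty_of_straight hδ (f 0 * f 1) (mul_mem_posPart_left _ (f_mem 1))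
    (by rw [h, zero_mul]) (by rw [h, zero_mul])
    (sup_le (by simp only [map_mul]; exact le_rfl) (mulR_straight_le h))

theorem nonempty_three {δ : Prop} (hδ : ¬ δ) : Nonempty (ArrowBasis quiverE8 0 3 δ) := by
  have h : straight {0, 3} = 0 := by
    rw [straight, mul_assoc _ (up _ _ 2), up_mul_up (c := 2) (by decide)]
    simp only [zero_mul, mul_zero]
  exact nonempty_of_straight hδ (f 0 * f 1 * f 2) (mul_mem_posPart_left _ (f_mem 2))
    (by rw [h, zero_mul]) (by rw [h, zero_mul])
    (sup_le (by simp only [map_mul]; exact le_rfl) (mulR_straight_le h))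

theorem nonempty_four {δ : Prop} (hδ : ¬ δ) : Nonempty (ArrowBasis quiverE8 0 4 δ) := by
  have h : straight {0, 4} = 0 := by
    rw [straight, mul_assoc _ (up _ _ 3), up_mul_up (c := 3) (by decide), mul_zero]
  exact nonempty_of_straight hδ (f 0 * f 1 * f 2 * f 3) (mul_mem_posPart_left _ (f_mem 3))
    (by rw [h, zero_mul]) (by rw [h, zero_mul])
    (sup_le (by simp only [map_mul]; exact le_rfl) (mulR_straight_le h))

theorem nonempty_five {δ : Prop} (hδ : ¬ δ) : Nonempty (ArrowBasis quiverE8 0 5 δ) := by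
  have h : ∀ c, straight {0, 5} * up quiverE8 {0, 5} c = 0 := fun c => by
    rw [straight, mul_assoc, up_mul_up (c := 4) (by decide), mul_zero]
  exact nonempty_of_straight hδ (f 0 * f 1 * f 2 * f 3 * f 4) (mul_mem_posPart_left _ (f_mem 4))
    (by rw [← mul_assoc, h, zero_mul]) (by rw [← mul_assoc, h, zero_mul])
    (by simp only [map_mul]; exact le_rfl)

theorem nonempty_six {δ : Prop} (hδ : ¬ δ) : Nonempty (ArrowBasis quiverE8 0 6 δ) := by
  have hy : straight {0, 6} * (up quiverE8 {0, 6} 5 * down quiverE8 {0, 6} 5) = 0 := by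
    rw [up_mul_down (c := 5) (by decide), mul_zero]
  have hz := straight_mul (rel_up_down {0, 6}) (down_mul_up (by decide) _)
  rw [← straight, hy, zero_add] at hz
  refine nonempty_of_straight hδ (f 0 * f 1 * f 2 * f 3 * f 4 * f 5)
    (mul_mem_posPart_left _ (f_mem 5)) hy hz (mulR_span_le ?_)
  rintro _ rfl
  simp only [map_mul]
  exact Submodule.subset_span rfl

theorem nonempty_eight {δ : Prop} (hδ : ¬ δ) : Nonempty (ArrowBasis quiverE8 0 8 δ) := by
  have hz : straight {0, 8} * (up quiverE8 {0, 8} 7 * down quiverE8 {0, 8} 7) = 0 := by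
    rw [up_mul_down (c := 7) (by decide), mul_zero]
  have hy := straight_mul (rel_up_down {0, 8}) (down_mul_up (by decide) _)
  rw [← straight, hz, add_zero] at hy
  refine nonempty_of_straight hδ (f 0 * f 1 * f 2 * f 3 * f 4 * f 7)
    (mul_mem_posPart_left _ (f_mem 7)) hy hz (mulR_span_le ?_)
  rintro _ rfl
  simp only [map_mul]
  exact Submodule.subset_span rfl

/-- The leaf `7` has label `2`. Its arm is so short that `y² = 0`, and `z² = 0` then ends every word
after `s y`; `y` itself dies on the way to `k`. -/
theorem nonempty_seven {δ : Prop} (hδ : ¬ δ) : Nonempty (ArrowBasis quiverE8 0 7 δ) := by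
  have h00 : down quiverE8 {0, 7} 0 * up quiverE8 {0, 7} 0 = 0 := down_mul_up (by decide) _
  have hr := rel_up_down {0, 7}
  have hyf := loop_six hr
  rw [up_mul_down (c := 6) (by decide), mul_zero] at hyf
  refine nonempty_of_thin hδ (f 0 * f 1 * f 2 * f 3 * f 4 * (f 5 * f 6))
    (f 0 * f 1 * f 2 * f 3 * f 4 * (f 5 * g 5) * (g 4 * g 3 * g 2 * g 1 * g 0))
    (mul_mem_posPart_left _ (mul_mem_posPart_left _ (f_mem 6))) _
    (Submodule.subset_span (Set.mem_insert _ _))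
    (loops_two (s_mul_x hr h00) hr.r5.symm (by rw [← mul_assoc, hyf, zero_mul]) (zz hr)) ?_ ?_
  · simp only [map_mul, radMk_inl]
    exact mulR_two_forth (by rw [← mul_assoc, hyf, zero_mul])
  · simp only [map_mul, radMk_inl, radMk_inr]
    exact mulR_two_back (straight_mul_back hr h00)

theorem nonempty_arrowBasis (k : Fin 9) (hk : k ≠ 0) {δ : Prop} (hδ : ¬ δ) :
    Nonempty (ArrowBasis quiverE8 0 k δ) := by
  have h : k = 1 ∨ k = 2 ∨ k = 3 ∨ k = 4 ∨ k = 5 ∨ k = 6 ∨ k = 7 ∨ k = 8 := by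
    revert k
    decide
  rcases h with rfl | rfl | rfl | rfl | rfl | rfl | rfl | rfl
  · exact nonempty_one hδ
  · exact nonempty_two hδ
  · exact nonempty_three hδ
  · exact nonempty_four hδ
  · exact nonempty_five hδ
  · exact nonempty_six hδ
  · exact nonempty_seven hδ
  · exact nonempty_eight hδ

end quiverE8

/-! ### Type `Ẽ₆` -/

/-- The quiver of type `Ẽ₆`. -/
def quiverE6 : ArrowQuiver (Fin 7) (Fin 6) where
  tail := ![0, 1, 2, 3, 4, 5]
  head := ![1, 4, 3, 4, 5, 6]

namespace quiverE6

/-- The arrows. -/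
abbrev f (i : Fin 6) : Preproj quiverE6 := arrow quiverE6 (Sum.inl i)

/-- The reversed arrows. -/
abbrev g (i : Fin 6) : Preproj quiverE6 := arrow quiverE6 (Sum.inr i)

theorem tail_eq (c : Fin 6) : quiverE6.tail c = (![0, 1, 2, 3, 4, 5] : Fin 6 → Fin 7) c := rfl

theorem head_eq (c : Fin 6) : quiverE6.head c = (![1, 4, 3, 4, 5, 6] : Fin 6 → Fin 7) c := rfl

/-- The relations at the vertices. -/
structure Rel {R : Type} [Ring R] (F G : Fin 6 → R) : Prop where
  r0 : F 0 * G 0 = 0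
  r1 : F 1 * G 1 = G 0 * F 0
  r2 : F 2 * G 2 = 0
  r3 : F 3 * G 3 = G 2 * F 2
  r4 : F 4 * G 4 = G 1 * F 1 + G 3 * F 3
  r5 : F 5 * G 5 = G 4 * F 4
  r6 : G 5 * F 5 = 0

theorem rel_iff {R : Type} [Ring R] (F G : Fin 6 → R) :
    (∀ v, ∑ c, (if quiverE6.tail c = v then F c * G c else 0) =
      ∑ c, (if quiverE6.head c = v then G c * F c else 0)) ↔ Rel F G := by
  have key : ∀ P : Fin 7 → Prop, (∀ v, P v) ↔ P 0 ∧ P 1 ∧ P 2 ∧ P 3 ∧ P 4 ∧ P 5 ∧ P 6 := by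
    intro P
    constructor
    · intro h
      exact ⟨h 0, h 1, h 2, h 3, h 4, h 5, h 6⟩
    · rintro ⟨h0, h1, h2, h3, h4, h5, h6⟩ v
      fin_cases v <;> assumption
  rw [key]
  simp only [Fin.sum_univ_six, tail_eq, head_eq]
  simp
  constructor
  · rintro ⟨h0, h1, h2, h3, h4, h5, h6⟩
    exact ⟨h0, h1, h2, h3, h4, h5, h6.symm⟩
  · rintro ⟨h0, h1, h2, h3, h4, h5, h6⟩
    exact ⟨h0, h1, h2, h3, h4, h5, h6.symm⟩

theorem rel_up_down (I : Finset (Fin 7)) : Rel (up quiverE6 I) (down quiverE6 I) :=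
  (rel_iff _ _).1 (up_down_relation quiverE6 I)

/-- The spans of the paths from `0` in terms of the span `S` of those that end at the branching
vertex. -/
def spans {R : Type} [Ring R] [Algebra ℂ R] (F G : Fin 6 → R) (S : Submodule ℂ R) :
    Fin 7 → Submodule ℂ R :=
  ![mulR S (G 1 * G 0), Submodule.span ℂ {F 0} ⊔ mulR S (G 1), mulR S (G 3 * G 2), mulR S (G 3), S,
    mulR S (F 4), mulR S (F 4 * F 5)]

section

variable {R : Type} [Ring R] {F G : Fin 6 → R} (h : Rel F G)
include h

theorem loop_five : F 4 * G 4 * F 4 = F 4 * (F 5 * G 5) := by rw [h.r5, mul_assoc]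

theorem loop_three : G 3 * F 3 * G 3 = G 3 * (G 2 * F 2) := by rw [← h.r3, mul_assoc]

theorem loop_five_cube : F 4 * G 4 * (F 4 * G 4) * (F 4 * G 4) = 0 := by
  have e : F 4 * G 4 * (F 4 * G 4) * (F 4 * G 4) = F 4 * (G 4 * F 4) * (G 4 * F 4) * G 4 := by
    simp only [mul_assoc]
  rw [e, ← h.r5, mul_assoc (F 4), mul_assoc (F 5), ← mul_assoc (G 5), h.r6, zero_mul, mul_zero,
    mul_zero, zero_mul]

theorem loop_three_cube : G 3 * F 3 * (G 3 * F 3) * (G 3 * F 3) = 0 := by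
  have e : G 3 * F 3 * (G 3 * F 3) * (G 3 * F 3) = G 3 * (F 3 * G 3) * (F 3 * G 3) * F 3 := by
    simp only [mul_assoc]
  rw [e, h.r3, mul_assoc (G 3), mul_assoc (G 2), ← mul_assoc (F 2), h.r2, zero_mul, mul_zero,
    mul_zero, zero_mul]

theorem loop_five_mul : F 4 * G 4 * (F 4 * F 5) = 0 := by
  rw [← mul_assoc, loop_five h, mul_assoc, mul_assoc, h.r6, mul_zero, mul_zero]

theorem loop_three_mul : G 3 * F 3 * (G 3 * G 2) = 0 := by
  rw [← mul_assoc, loop_three h, mul_assoc, mul_assoc, h.r2, mul_zero, mul_zero]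

variable (h0 : G 0 * F 0 = 0)
include h0

theorem straight_back : F 0 * F 1 * G 1 = 0 := by
  rw [mul_assoc, h.r1, h0, mul_zero]

theorem s_mul_x : F 0 * F 1 * (G 1 * F 1) = 0 := by
  rw [← mul_assoc, straight_back h h0, zero_mul]

theorem xx : G 1 * F 1 * (G 1 * F 1) = 0 := by
  rw [mul_assoc, ← mul_assoc (F 1), h.r1, h0, zero_mul, mul_zero]

theorem straight_mul_back : F 0 * F 1 * (G 1 * G 0) = 0 := by
  rw [← mul_assoc, straight_back h h0, zero_mul]

theorem loop_mul_back : G 1 * F 1 * (G 1 * G 0) = 0 := by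
  rw [mul_assoc, ← mul_assoc (F 1), h.r1, h0, zero_mul, mul_zero]

/-- After the straight path the two loops away from `0` agree. This exchanges the two other arms and
is used to see a vertex that a path avoids as written. -/
theorem straight_mul : F 0 * F 1 * (F 4 * G 4) = F 0 * F 1 * (G 3 * F 3) := by
  rw [h.r4, mul_add, s_mul_x h h0, zero_add]

end

section

variable {R : Type} [Ring R] [Algebra ℂ R] {F G : Fin 6 → R} (h : Rel F G)
  (h0 : G 0 * F 0 = 0) {S : Submodule ℂ R} (hs : F 0 * F 1 ∈ S)
  (hx : ∀ u ∈ S, u * (G 1 * F 1) ∈ S) (hy : ∀ u ∈ S, u * (F 4 * G 4) ∈ S)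
  (hz : ∀ u ∈ S, u * (G 3 * F 3) ∈ S)
include h h0 hs hx hy hz

theorem closed_f (c : Fin 6) : ∀ s ∈ spans F G S (quiverE6.tail c),
    s * F c ∈ spans F G S (quiverE6.head c) := by
  match c with
  | 0 =>
    refine mulR_closed fun u hu => mem_of_eq_zero ?_
    rw [mul_assoc, mul_assoc _ (G 0), h0, mul_zero, mul_zero]
  | 1 =>
    refine sup_closed (singleton_closed hs) (mulR_closed fun u hu => ?_)
    rw [mul_assoc]
    exact hx u hu
  | 2 =>
    refine mulR_closed fun u hu => ?_
    rw [mul_assoc, mul_assoc (G 3), ← loop_three h, ← mul_assoc]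
    exact mul_mem_mulR (hz u hu) _
  | 3 =>
    refine mulR_closed fun u hu => ?_
    rw [mul_assoc]
    exact hz u hu
  | 4 => exact fun u hu => mul_mem_mulR hu _
  | 5 =>
    refine mulR_closed fun u hu => ?_
    rw [mul_assoc]
    exact mul_mem_mulR hu _

theorem closed_g (c : Fin 6) : ∀ s ∈ spans F G S (quiverE6.head c),
    s * G c ∈ spans F G S (quiverE6.tail c) := by
  match c with
  | 0 =>
    refine sup_closed (singleton_closed (mem_of_eq_zero h.r0)) (mulR_closed fun u hu => ?_)
    rw [mul_assoc]
    exact mul_mem_mulR hu _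
  | 1 => exact fun u hu => Submodule.mem_sup_right (mul_mem_mulR hu _)
  | 2 =>
    refine mulR_closed fun u hu => ?_
    rw [mul_assoc]
    exact mul_mem_mulR hu _
  | 3 => exact fun u hu => mul_mem_mulR hu _
  | 4 =>
    refine mulR_closed fun u hu => ?_
    rw [mul_assoc]
    exact hy u hu
  | 5 =>
    refine mulR_closed fun u hu => ?_
    rw [mul_assoc, mul_assoc (F 4), ← loop_five h, ← mul_assoc]
    exact mul_mem_mulR (hy u hu) _

end

theorem f_mem (i : Fin 6) : f i ∈ posPart quiverE6 := arrow_mem_posPart _ _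

theorem g_mem (i : Fin 6) : g i ∈ posPart quiverE6 := arrow_mem_posPart _ _

theorem mem_spans {I : Finset (Fin 7)} (h0 : 0 ∈ I) {S : Submodule ℂ (RadQuot quiverE6 I)}
    (hs : up quiverE6 I 0 * up quiverE6 I 1 ∈ S)
    (hx : ∀ u ∈ S, u * (down quiverE6 I 1 * up quiverE6 I 1) ∈ S)
    (hy : ∀ u ∈ S, u * (up quiverE6 I 4 * down quiverE6 I 4) ∈ S)
    (hz : ∀ u ∈ S, u * (down quiverE6 I 3 * up quiverE6 I 3) ∈ S)
    {z : Preproj quiverE6} (hz' : z ∈ posPart quiverE6) (j : Fin 7) :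
    radMk quiverE6 I (idem quiverE6 0 * z * idem quiverE6 j) ∈
      spans (up quiverE6 I) (down quiverE6 I) S j := by
  have h00 : down quiverE6 I 0 * up quiverE6 I 0 = 0 := down_mul_up h0 _
  refine map_mem_of_closed _ (radMk quiverE6 I) 0 _ ?_ ?_ hz' j
  · rintro (c | c) hc
    · have : c = 0 := by
        revert hc
        change quiverE6.tail c = 0 → c = 0
        revert c
        decide
      subst this
      exact Submodule.mem_sup_left (Submodule.subset_span rfl)
    · exfalso
      revert hc
      change quiverE6.head c = 0 → False
      revert c
      decide
  · rintro (c | c)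
    · exact closed_f (rel_up_down I) h00 hs hx hy hz c
    · exact closed_g (rel_up_down I) h00 hs hx hy hz c

/-- The basis for `Ẽ₆` and a vertex `k` such that the straight path spans all paths from `0` to the
branching vertex. -/
theorem nonempty_of_straight {k : Fin 7} {δ : Prop} (hδ : ¬ δ) (p : Preproj quiverE6)
    (hp : p ∈ posPart quiverE6)
    (hy : up quiverE6 {0, k} 0 * up quiverE6 {0, k} 1 *
      (up quiverE6 {0, k} 4 * down quiverE6 {0, k} 4) = 0)
    (h : spans (up quiverE6 {0, k}) (down quiverE6 {0, k})
      (Submodule.span ℂ {up quiverE6 {0, k} 0 * up quiverE6 {0, k} 1}) k ≤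
      Submodule.span ℂ {radMk quiverE6 {0, k} p}) :
    Nonempty (ArrowBasis quiverE6 0 k δ) := by
  have h0 : (0 : Fin 7) ∈ ({0, k} : Finset (Fin 7)) := Finset.mem_insert_self _ _
  have h00 : down quiverE6 {0, k} 0 * up quiverE6 {0, k} 0 = 0 := down_mul_up h0 _
  have hr := rel_up_down {0, k}
  have hz := straight_mul hr h00
  rw [hy] at hz
  have hl := loops_one (s_mul_x hr h00) hy hz.symm
  exact ⟨arrowBasisOfThin hδ p 0 hp (spans (up quiverE6 {0, k}) (down quiverE6 {0, k})
      (Submodule.span ℂ {up quiverE6 {0, k} 0 * up quiverE6 {0, k} 1}))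
    (fun _ hz' j => mem_spans h0 (Submodule.mem_span_singleton_self _) hl.1 hl.2.1 hl.2.2 hz' j) h
    (mulR_one (straight_mul_back hr h00))⟩

theorem nonempty_one {δ : Prop} (hδ : ¬ δ) : Nonempty (ArrowBasis quiverE6 0 1 δ) := by
  have h : up quiverE6 {0, 1} 0 * up quiverE6 {0, 1} 1 = 0 := up_mul_up (by decide) _
  exact nonempty_of_straight hδ (f 0) (f_mem 0) (by rw [h, zero_mul])
    (sup_le le_rfl (mulR_one (by rw [h, zero_mul])))

theorem nonempty_four {δ : Prop} (hδ : ¬ δ) : Nonempty (ArrowBasis quiverE6 0 4 δ) := by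
  refine nonempty_of_straight hδ (f 0 * f 1) (mul_mem_posPart_left _ (f_mem 1)) ?_
    (by simp only [map_mul]; exact le_rfl)
  rw [← mul_assoc, mul_assoc _ (up _ _ 1), up_mul_up (c := 1) (by decide), mul_zero, zero_mul]

theorem nonempty_five {δ : Prop} (hδ : ¬ δ) : Nonempty (ArrowBasis quiverE6 0 5 δ) := by
  refine nonempty_of_straight hδ (f 0 * f 1 * f 4) (mul_mem_posPart_left _ (f_mem 4))
    (by rw [up_mul_down (c := 4) (by decide), mul_zero]) (mulR_span_le ?_)
  rintro _ rfl
  simp only [map_mul]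
  exact Submodule.subset_span rfl

theorem nonempty_three {δ : Prop} (hδ : ¬ δ) : Nonempty (ArrowBasis quiverE6 0 3 δ) := by
  refine nonempty_of_straight hδ (f 0 * f 1 * g 3) (mul_mem_posPart_left _ (g_mem 3))
    (by rw [straight_mul (rel_up_down {0, 3}) (down_mul_up (by decide) _),
      down_mul_up (c := 3) (by decide), mul_zero]) (mulR_span_le ?_)
  rintro _ rfl
  simp only [map_mul]
  exact Submodule.subset_span rfl

section

variable {m : Fin 6 ⊕ Fin 6 → Matrix (Fin 3) (Fin 3) ℂ}
  (hm : Rel (fun i => m (Sum.inl i)) (fun i => m (Sum.inr i)))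

theorem rep_f (i : Fin 6) : rep m ((rel_iff _ _).2 hm) (f i) =
    Matrix.single ((![0, 1, 2, 3, 4, 5] : Fin 6 → Fin 7) i)
      ((![1, 4, 3, 4, 5, 6] : Fin 6 → Fin 7) i) (m (Sum.inl i)) :=
  rep_arrow _ _ _

theorem rep_g (i : Fin 6) : rep m ((rel_iff _ _).2 hm) (g i) =
    Matrix.single ((![1, 4, 3, 4, 5, 6] : Fin 6 → Fin 7) i)
      ((![0, 1, 2, 3, 4, 5] : Fin 6 → Fin 7) i) (m (Sum.inr i)) :=
  rep_arrow _ _ _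

end

/-- A representation with two linearly independent paths from `0` to `6`. -/
def repSix : Fin 6 ⊕ Fin 6 → Matrix (Fin 3) (Fin 3) ℂ :=
  Sum.elim
    ![mUnit 0 0, mUnit 0 0 + mUnit 1 2, mUnit 0 1, mUnit 0 1 - mUnit 1 2, mUnit 0 0 + mUnit 2 2,
      mUnit 0 0 + mUnit 2 2]
    ![0, mUnit 1 1, mUnit 0 0, mUnit 0 0 + mUnit 1 1, mUnit 0 1, 0]

/-- The three row vectors at the branching vertex model `s`, `s y`, `s y z` of `loops_three`, with
`y = F 4 * G 4` and `z = -(G 3 * F 3)`. -/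
theorem repSix_rel : Rel (fun i => repSix (Sum.inl i)) (fun i => repSix (Sum.inr i)) := by
  constructor <;> simp [repSix, add_mul, mul_add, sub_mul, mul_sub]

theorem repSix_mul (a b : Fin 6 ⊕ Fin 6)
    (ha : quiverE6.double.head a ∈ ({0, 6} : Finset (Fin 7)))
    (hab : quiverE6.double.head a = quiverE6.double.tail b) : repSix a * repSix b = 0 := by
  have h1 : ∀ a b : Fin 6 ⊕ Fin 6, quiverE6.double.head a ∈ ({0, 6} : Finset (Fin 7)) →
      quiverE6.double.head a = quiverE6.double.tail b → a = Sum.inr 0 ∨ b = Sum.inr 5 := by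
    decide
  rcases h1 a b ha hab with rfl | rfl <;> simp [repSix]

/-- A representation with two linearly independent paths from `0` to `2`. -/
def repTwo : Fin 6 ⊕ Fin 6 → Matrix (Fin 3) (Fin 3) ℂ :=
  Sum.elim
    ![mUnit 0 0, mUnit 0 0 - mUnit 1 2, 0, mUnit 0 1, mUnit 0 0 + mUnit 1 1, mUnit 0 0]
    ![0, mUnit 1 1, mUnit 0 0 + mUnit 2 2, mUnit 0 0 + mUnit 2 2, mUnit 0 1 - mUnit 1 2, mUnit 0 1]

/-- As for `repSix`, with the arms of `2` and `6` exchanged: `y = G 3 * F 3` and `z = -(F 4 * G 4)`.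
-/
theorem repTwo_rel : Rel (fun i => repTwo (Sum.inl i)) (fun i => repTwo (Sum.inr i)) := by
  constructor <;> simp [repTwo, add_mul, mul_add, sub_mul, mul_sub]
  abel

theorem repTwo_mul (a b : Fin 6 ⊕ Fin 6)
    (ha : quiverE6.double.head a ∈ ({0, 2} : Finset (Fin 7)))
    (hab : quiverE6.double.head a = quiverE6.double.tail b) : repTwo a * repTwo b = 0 := by
  have h1 : ∀ a b : Fin 6 ⊕ Fin 6, quiverE6.double.head a ∈ ({0, 2} : Finset (Fin 7)) →
      quiverE6.double.head a = quiverE6.double.tail b → a = Sum.inr 0 ∨ b = Sum.inl 2 := by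
    decide
  rcases h1 a b ha hab with rfl | rfl <;> simp [repTwo]

/-- The orientation makes the relation `x = y - G 3 * F 3`, so `loops_three` is applied with `z`
negated. Here `y² = 0` comes from `k`, `x² = 0` from `0`, and `z³ = 0` from the leaf `2`. -/
theorem nonempty_six {δ : Prop} (hδ : δ) : Nonempty (ArrowBasis quiverE6 0 6 δ) := by
  have h00 : down quiverE6 {0, 6} 0 * up quiverE6 {0, 6} 0 = 0 := down_mul_up (by decide) _
  have hr := rel_up_down {0, 6}
  have hxyz : down quiverE6 {0, 6} 1 * up quiverE6 {0, 6} 1 =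
      up quiverE6 {0, 6} 4 * down quiverE6 {0, 6} 4 +
        -(down quiverE6 {0, 6} 3 * up quiverE6 {0, 6} 3) := by rw [hr.r4, add_neg_cancel_right]
  have hyy : up quiverE6 {0, 6} 4 * down quiverE6 {0, 6} 4 *
      (up quiverE6 {0, 6} 4 * down quiverE6 {0, 6} 4) = 0 := by
    rw [← mul_assoc, loop_five hr, up_mul_down (c := 5) (by decide), mul_zero, zero_mul]
  have hw := loops_three (s_mul_x hr h00) hxyz (xx hr h00) hyy
    (by rw [neg_mul_neg, mul_neg, loop_three_cube hr, neg_zero])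
  have hspan := fun z (hz : z ∈ posPart quiverE6) =>
    mem_spans (by decide) (Submodule.subset_span (Or.inl rfl)) hw.1 hw.2.1
      (fun u hu => by simpa only [mul_neg, neg_mem_iff] using hw.2.2 u hu) hz
  refine ⟨{
    p₁ := f 0 * f 1 * (f 4 * f 5)
    p₂ := f 0 * f 1 * (f 4 * g 4) * -(g 3 * f 3) * (f 4 * f 5)
    q := f 0 * f 1 * (f 4 * g 4) * (g 1 * g 0)
    p₁_mem := mul_mem_posPart_left _ (mul_mem_posPart_left _ (f_mem 5))
    p₂_mem := mul_mem_posPart_left _ (mul_mem_posPart_left _ (f_mem 5))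
    span_eq := fun z hz => by
      have h := mulR_three_forth (loop_five_mul hr) (hspan z hz 6)
      simpa only [map_mul, map_neg, radMk_inl, radMk_inr] using h
    span_zero := fun z hz => by
      have h := mulR_three_back (straight_mul_back hr h00) (loop_mul_back hr h00) hxyz hyy
        (hspan z hz 0)
      simpa only [map_mul, radMk_inl, radMk_inr] using h
    eq_zero := fun h => absurd hδ h
    factor := fun _ l hl hl' => ?_
    indep := fun _ => linearIndependent_of_rep (x₁ := mUnit 0 0) (x₂ := mUnit 0 2)
      ((rel_iff _ _).2 repSix_rel) repSix_mul ?_ ?_ (linearIndependent_mUnit (by decide)) }⟩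
  · have hl7 : l = 1 ∨ l = 2 ∨ l = 3 ∨ l = 4 ∨ l = 5 := by
      revert l
      decide
    simp only [map_mul, map_neg, radMk_inl, radMk_inr]
    rcases hl7 with rfl | rfl | rfl | rfl | rfl
    · left
      rw [up_mul_up (c := 0) (by decide), zero_mul]
    · right
      -- After exchanging the first loop, `p₂` runs twice along the arm of `2`, and the double loop
      -- slides out to the vertex `2`.
      rw [straight_mul (rel_up_down {0, 6, 2}) (down_mul_up (by decide) _), mul_neg,
        mul_assoc _ (_ * _) (_ * _), ← mul_assoc (_ * _) _ (up _ _ 3), loop_three (rel_up_down _),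
        down_mul_up (c := 2) (by decide)]
      simp only [mul_zero, zero_mul, neg_zero]
    · right
      rw [down_mul_up (c := 3) (by decide), neg_zero, mul_zero, zero_mul]
    · left
      rw [← mul_assoc, mul_assoc (up _ _ 0), up_mul_up (c := 1) (by decide), mul_zero, zero_mul]
    · left
      rw [up_mul_up (c := 4) (by decide), mul_zero]
  · simp only [map_mul, rep_f repSix_rel]
    simp [repSix, add_mul, mul_add]
  · simp only [map_mul, map_neg, rep_f repSix_rel, rep_g repSix_rel]
    simp [repSix, add_mul, mul_add, mul_sub, ← Matrix.single_neg]

theorem nonempty_two {δ : Prop} (hδ : δ) : Nonempty (ArrowBasis quiverE6 0 2 δ) := by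
  have h00 : down quiverE6 {0, 2} 0 * up quiverE6 {0, 2} 0 = 0 := down_mul_up (by decide) _
  have hr := rel_up_down {0, 2}
  have hxyz : -(down quiverE6 {0, 2} 1 * up quiverE6 {0, 2} 1) =
      down quiverE6 {0, 2} 3 * up quiverE6 {0, 2} 3 +
        -(up quiverE6 {0, 2} 4 * down quiverE6 {0, 2} 4) := by
    rw [hr.r4, neg_add_rev, add_neg_cancel_left]
  have hyy : down quiverE6 {0, 2} 3 * up quiverE6 {0, 2} 3 *
      (down quiverE6 {0, 2} 3 * up quiverE6 {0, 2} 3) = 0 := by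
    rw [← mul_assoc, loop_three hr, down_mul_up (c := 2) (by decide), mul_zero, zero_mul]
  have hw := loops_three (by rw [mul_neg, s_mul_x hr h00, neg_zero]) hxyz
    (by rw [neg_mul_neg, xx hr h00]) hyy
    (by rw [neg_mul_neg, mul_neg, loop_five_cube hr, neg_zero])
  have hspan := fun z (hz : z ∈ posPart quiverE6) =>
    mem_spans (by decide) (Submodule.subset_span (Or.inl rfl))
      (fun u hu => by simpa only [mul_neg, neg_mem_iff] using hw.1 u hu)
      (fun u hu => by simpa only [mul_neg, neg_mem_iff] using hw.2.2 u hu) hw.2.1 hz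
  refine ⟨{
    p₁ := f 0 * f 1 * (g 3 * g 2)
    p₂ := f 0 * f 1 * (g 3 * f 3) * -(f 4 * g 4) * (g 3 * g 2)
    q := f 0 * f 1 * (g 3 * f 3) * (g 1 * g 0)
    p₁_mem := mul_mem_posPart_left _ (mul_mem_posPart_left _ (g_mem 2))
    p₂_mem := mul_mem_posPart_left _ (mul_mem_posPart_left _ (g_mem 2))
    span_eq := fun z hz => by
      have h := mulR_three_forth (loop_three_mul hr) (hspan z hz 2)
      simpa only [map_mul, map_neg, radMk_inl, radMk_inr] using h
    span_zero := fun z hz => by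
      have h := mulR_three_back (straight_mul_back hr h00)
        (by rw [neg_mul, loop_mul_back hr h00, neg_zero]) hxyz hyy (hspan z hz 0)
      simpa only [map_mul, radMk_inl, radMk_inr] using h
    eq_zero := fun h => absurd hδ h
    factor := fun _ l hl hl' => ?_
    indep := fun _ => linearIndependent_of_rep (x₁ := mUnit 0 0) (x₂ := mUnit 0 2)
      ((rel_iff _ _).2 repTwo_rel) repTwo_mul ?_ ?_ (linearIndependent_mUnit (by decide)) }⟩
  · have hl7 : l = 1 ∨ l = 3 ∨ l = 4 ∨ l = 5 ∨ l = 6 := by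
      revert l
      decide
    simp only [map_mul, map_neg, radMk_inl, radMk_inr]
    rcases hl7 with rfl | rfl | rfl | rfl | rfl
    · left
      rw [up_mul_up (c := 0) (by decide), zero_mul]
    · left
      rw [down_mul_down (c := 3) (by decide), mul_zero]
    · left
      rw [← mul_assoc, mul_assoc (up _ _ 0), up_mul_down (c := 1) (by decide), mul_zero, zero_mul]
    · right
      rw [up_mul_down (c := 4) (by decide), neg_zero, mul_zero, zero_mul]
    · right
      -- The mirror image: the double loop along the arm of `6` reaches `6`.
      rw [← straight_mul (rel_up_down {0, 2, 6}) (down_mul_up (by decide) _), mul_neg,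
        mul_assoc _ (_ * _) (_ * _), ← mul_assoc (_ * _) _ (down _ _ 4),
        loop_five (rel_up_down _), up_mul_down (c := 5) (by decide)]
      simp only [mul_zero, zero_mul, neg_zero]
  · simp only [map_mul, rep_f repTwo_rel, rep_g repTwo_rel]
    simp [repTwo, add_mul, mul_add, mul_sub]
  · simp only [map_mul, map_neg, rep_f repTwo_rel, rep_g repTwo_rel]
    simp [repTwo, add_mul, mul_add, mul_sub, ← Matrix.single_neg]

theorem nonempty_arrowBasis (k : Fin 7) (hk : k ≠ 0) :
    Nonempty (ArrowBasis quiverE6 0 k (k = 2 ∨ k = 6)) := by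
  have h : k = 1 ∨ k = 2 ∨ k = 3 ∨ k = 4 ∨ k = 5 ∨ k = 6 := by
    revert k
    decide
  rcases h with rfl | rfl | rfl | rfl | rfl | rfl
  · exact nonempty_one (by decide)
  · exact nonempty_two (Or.inl rfl)
  · exact nonempty_three (by decide)
  · exact nonempty_four (by decide)
  · exact nonempty_five (by decide)
  · exact nonempty_six (Or.inr rfl)

end quiverE6

end ArrowQuiver

end

/-! ### The theorem, type by type -/

open ArrowQuiver in
theorem mainTheorem8 (Δ : ExtDynkin) (I : Finset Δ.Vertex) (h0 : 0 ∈ I) (j : Δ.Vertex)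
    (hj : ¬ (I = {0} ∧ j = 0)) :
    (Δ.quiver.numArrows I 0 j = 0 ∨ Δ.quiver.numArrows I 0 j = 1 ∨
      Δ.quiver.numArrows I 0 j = 2) ∧
    (Δ.quiver.numArrows I 0 j = 2 ↔ I = {0, j} ∧ Δ.delta j = 1) := by
  refine numArrows_of_arrowBasis (fun k => Δ.delta k = 1) (fun k hk => Nonempty.some ?_) h0 j hj
  match Δ, k, hk with
  | .A n hn, k, hk => exact ⟨arrowBasisCycle hn k hk rfl⟩
  | .D n hn, k, hk =>
    have hk0 : k.val ≠ 0 := fun h => hk (Fin.ext h)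
    have hkn : k.val < n + 1 := k.isLt
    -- Among the vertices other than `0`, the label is `1` exactly at the three remaining leaves.
    have hδ : (ExtDynkin.D n hn).delta k = 1 ↔ k.val = 1 ∨ n ≤ k.val + 1 := by
      change (if k.val = 0 ∨ k.val = 1 ∨ k.val = n - 1 ∨ k.val = n then 1 else 2) = 1 ↔ _
      split_ifs <;> omega
    change Nonempty (ArrowBasis (fork n hn) 0 k _)
    rcases lt_trichotomy k.val 2 with h | h | h
    · have hlt : 1 < n + 1 := by omega
      obtain rfl : k = ⟨1, hlt⟩ := Fin.ext (show k.val = 1 by omega)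
      exact ⟨arrowBasisForkNear hn (hδ.2 (Or.inl rfl))⟩
    · exact ⟨arrowBasisForkTwo hn k h (by rw [hδ]; omega)⟩
    · exact ⟨arrowBasisForkFar hn k h (hδ.trans (by omega))⟩
  | .E6, k, hk =>
    have h : (k = 2 ∨ k = 6) = (ExtDynkin.E6.delta k = 1) := by
      rw [eq_iff_iff]
      revert k
      decide
    exact h ▸ quiverE6.nonempty_arrowBasis k hk
  | .E7, k, hk =>
    have h : (k = 6) = (ExtDynkin.E7.delta k = 1) := by
      rw [eq_iff_iff]
      revert k
      decide
    exact h ▸ quiverE7.nonempty_arrowBasis k hk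
  | .E8, k, hk =>
    refine quiverE8.nonempty_arrowBasis k hk ?_
    revert k
    decide
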